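/- Let $C_0>0$. There exist constants $c,c'>0$ and $n_0\in\mathbb N$, depending only on $C_0$, such that the following holds. Let $\xi$ be a real random variable with mean $0$ and variance $1$ such that either $|\xi|\le C_0$ almost surely, or the law of $\xi$ satisfies the logarithmic Sobolev inequality with constant $C_0$: $$\mathbb E\big[f(\xi)^2\log f(\xi)^2\big]-\mathbb E\big[f(\xi)^2\big]\log\mathbb E\big[f(\xi)^2\big]\le C_0\,\mathbb E\big[|f'(\xi)|^2\big]$$ for all smooth compactly supported $f:\mathbb R\to\mathbb R$ (with $0\log 0=0$). Let $n\ge n_0$, let $a_1,\dots,a_n,b_1,\dots,b_n$ be i.i.d. copies of $\xi$, let $$P_n(x)=\frac1{\sqrt n}\sum_{k=1}^n\big(a_k\cos(kx)+b_k\sin(kx)\big),$$ and let $N_n$ be the number of distinct roots of $P_n$ in $[-\pi,\pi]$, with the convention $N_n=0$ if $P_n$ is identically zero. Then for every $\varepsilon\ge n^{-c}$, $$\mathbb P\big(|N_n-\mathbb E N_n|\ge\varepsilon n\big)\le e^{-c'\varepsilon^9n}.$$ -/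

import Mathlib

open MeasureTheory ProbabilityTheory

noncomputable section

/-- The trigonometric polynomial
`P_n(x) = n^{-1/2} ∑_{k=1}^n (a_k cos (k x) + b_k sin (k x))`.
The coefficients are indexed by `Fin n = {0, …, n-1}`, so that the entry `j` is the coefficient
belonging to `k = j + 1`. -/
def trigPoly (n : ℕ) (a b : Fin n → ℝ) (x : ℝ) : ℝ :=
  (1 / Real.sqrt n) *
    ∑ j : Fin n, (a j * Real.cos (((j : ℕ) + 1 : ℝ) * x) + b j * Real.sin (((j : ℕ) + 1 : ℝ) * x))

/-- The number of (distinct) roots of the trigonometric polynomial in `[-π, π]`. A trigonometric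
polynomial that is not identically zero has finitely many of them; for the zero polynomial
the value is `0` by convention. -/
def rootCount (n : ℕ) (a b : Fin n → ℝ) : ℕ :=
  {x : ℝ | x ∈ Set.Icc (-Real.pi) Real.pi ∧ trigPoly n a b x = 0}.ncard

/-- `Ent_ν(g) = E_ν (g log g) - (E_ν g) log (E_ν g)`, with `0 log 0 = 0`. -/
def entropyOf (ν : Measure ℝ) (g : ℝ → ℝ) : ℝ :=
  ∫ x, g x * Real.log (g x) ∂ν - (∫ x, g x ∂ν) * Real.log (∫ x, g x ∂ν)

/-- The law `ν` satisfies the logarithmic Sobolev inequality with constant `C`: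
`Ent_ν(f²) ≤ C E_ν |f'|²` for all smooth compactly supported (hence bounded) `f`. -/
def SatisfiesLogSobolev (ν : Measure ℝ) (C : ℝ) : Prop :=
  ∀ f : ℝ → ℝ, ContDiff ℝ (⊤ : ℕ∞) f → HasCompactSupport f →
    entropyOf ν (fun x => f x ^ 2) ≤ C * ∫ x, |deriv f x| ^ 2 ∂ν

end

/-! The root count `N` is not a Lipschitz function of the coefficients, so it is compared with a
statistic that is. Put `f y = P_n (y / n)` on an interval of length `2πn`. All frequencies lie in
`(0, 1]`, so `f` and each of its derivatives at a point are linear forms of Euclidean norm at most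
one in the coefficient vector.

Deterministic part. Let `S = η⁻¹ ∫ signChange r (f y) (f (y + η))`, a smoothed count of the sign
changes across windows of length `η`. Then `abs_rootCount_sub_le` gives `|N - S| ≤ R = 2 + (162 b /
η) A + 160 b D`, where `A` measures the set on which `|f|` is of order at most `r` and `D`
integrates the excess of the derivatives over a level `s`. A stretch with many roots per unit length
forces `|f| ≤ r` on all of it (Lagrange interpolation) unless the derivatives are large there
(`length_le_of_many_roots`); a dyadic stopping argument removes such stretches. For the other roots,
where `f''` is controlled, a window holding a root has no critical point unless `|f| ≤ r` at its
left end, so there roots and sign changes correspond (`windowCount_le_of_tame`).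

Concentration. Both assumptions on the law give sub-Gaussian bounds, free of dimension, for convex
Lipschitz functions of the coefficients (`exists_convexConcentration`): Maurey's property (τ) for
bounded laws, tensorisation and Herbst's argument under the logarithmic Sobolev inequality. The
former needs convexity, so `S` and `R` are written as differences of convex functions. Their
Lipschitz constants are of order `√n` times powers of the parameters, because Parseval's identity
bounds the `L¹` norm of `f` by a multiple of `√n` times the norm of the coefficients
(`integral_abs_scaledDeriv_le`).

Expectation. `𝔼 A` is small by a small-ball estimate obtained from characteristic functions
(`integral_exp_neg_sq_linear_le`), and `𝔼 D` is small by exponential tails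
(`integral_excess_linear_le`). So `𝔼 R ≤ T / 4`, and deviations of `N` of size `T` come from
deviations of `S` or `R` of size `T / 4`.

Parameters. With `ε = ρ^24` one takes `b ≈ s = ρ⁻¹`, `η = ρ^28`, `r = 28 ρ^54`, `T = ρ^24 n`. The
Lipschitz constant is then of order `ρ^(-83) √n`, so the exponent is of order `ρ^214 n`, which is at
least `ρ^216 n = ε^9 n`. -/

/-! ### Property (τ) and concentration of convex functions for bounded laws. -/

theorem measurePreserving_fin_cons (ν : Measure ℝ) [IsProbabilityMeasure ν] (N : ℕ) :
    MeasurePreserving (fun p : ℝ × (Fin N → ℝ) => (Fin.cons p.1 p.2 : Fin (N + 1) → ℝ))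
      (ν.prod (Measure.pi fun _ => ν)) (Measure.pi fun _ => ν) := by
  have h := (measurePreserving_piFinSuccAbove (fun _ : Fin (N + 1) => ν) 0).symm
  convert h using 1
  ext p i
  simp [MeasurableEquiv.piFinSuccAbove]

theorem continuous_fin_cons (N : ℕ) :
    Continuous (fun p : ℝ × (Fin N → ℝ) => (Fin.cons p.1 p.2 : Fin (N + 1) → ℝ)) := by
  refine continuous_pi fun i => ?_
  refine Fin.cases ?_ (fun j => ?_) i
  · simpa using continuous_fst
  · simp only [Fin.cons_succ]
    fun_prop

theorem integrable_comp_fin_cons {ν : Measure ℝ} [IsProbabilityMeasure ν] {N : ℕ}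
    {f : (Fin (N + 1) → ℝ) → ℝ} (hf : Integrable f (Measure.pi fun _ => ν)) :
    Integrable (fun p : ℝ × (Fin N → ℝ) => f (Fin.cons p.1 p.2))
      (ν.prod (Measure.pi fun _ => ν)) :=
  (measurePreserving_fin_cons ν N).integrable_comp_of_integrable hf

theorem integral_pi_fin_succ {ν : Measure ℝ} [IsProbabilityMeasure ν] {N : ℕ}
    {f : (Fin (N + 1) → ℝ) → ℝ} (hf : Integrable f (Measure.pi fun _ => ν)) :
    ∫ x, f x ∂(Measure.pi fun _ => ν) =
      ∫ y, ∫ t, f (Fin.cons t y) ∂ν ∂(Measure.pi fun _ : Fin N => ν) := by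
  have h := measurePreserving_fin_cons ν N
  have h1 : ∫ x, f x ∂(Measure.pi fun _ => ν) = ∫ p : ℝ × (Fin N → ℝ), f (Fin.cons p.1 p.2)
      ∂(ν.prod (Measure.pi fun _ => ν)) := by
    rw [← h.map_eq, integral_map h.measurable.aemeasurable]
    rw [h.map_eq]; exact hf.1
  rw [h1, integral_prod_symm _ (integrable_comp_fin_cons hf)]

theorem ae_pi_abs_le {ι : Type*} [Fintype ι] {ν : Measure ℝ} [IsProbabilityMeasure ν] {C : ℝ}
    (h : ∀ᵐ x ∂ν, |x| ≤ C) : ∀ᵐ x ∂(Measure.pi fun _ : ι => ν), ∀ i, |x i| ≤ C := by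
  rw [ae_all_iff]
  intro i
  exact (measurePreserving_eval (fun _ : ι => ν) i).quasiMeasurePreserving.ae h

theorem integrable_pi_of_continuous {ι : Type*} [Fintype ι] {ν : Measure ℝ}
    [IsProbabilityMeasure ν] {C : ℝ} (h : ∀ᵐ x ∂ν, |x| ≤ C) {f : (ι → ℝ) → ℝ}
    (hf : Continuous f) : Integrable f (Measure.pi fun _ : ι => ν) := by
  have hK : IsCompact (Set.Icc (fun _ : ι => -C) (fun _ => C)) := isCompact_Icc
  obtain ⟨M, hM⟩ := hK.exists_bound_of_continuousOn hf.continuousOn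
  refine Integrable.of_bound hf.aestronglyMeasurable M ?_
  filter_upwards [ae_pi_abs_le (ι := ι) h] with x hx
  exact hM x ⟨fun i => (abs_le.1 (hx i)).1, fun i => (abs_le.1 (hx i)).2⟩

theorem integrable_of_continuous_of_ae_abs_le {ν : Measure ℝ} [IsProbabilityMeasure ν] {C : ℝ}
    (h : ∀ᵐ x ∂ν, |x| ≤ C) {f : ℝ → ℝ} (hf : Continuous f) : Integrable f ν := by
  obtain ⟨M, hM⟩ := (isCompact_Icc (a := -C) (b := C)).exists_bound_of_continuousOn hf.continuousOn
  refine Integrable.of_bound hf.aestronglyMeasurable M ?_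
  filter_upwards [h] with x hx
  exact hM x (abs_le.1 hx)

/-- Both sides are compared with `1 + u - u^2`, using `exp v ≤ 1 + v + v^2` for `|v| ≤ 1`. -/
theorem exp_le_two_sub_exp_neg {u : ℝ} (h0 : 0 ≤ u) (h1 : u ≤ 1 / 4) :
    Real.exp (u - 2 * u ^ 2) ≤ 2 - Real.exp (-u) := by
  have hv : |u - 2 * u ^ 2| ≤ 1 := by rw [abs_le]; constructor <;> nlinarith
  have h2 := Real.abs_exp_sub_one_sub_id_le hv
  have hw : |-u| ≤ 1 := by rw [abs_neg, abs_of_nonneg h0]; linarith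
  have h3 := Real.abs_exp_sub_one_sub_id_le hw
  have h4 := (abs_le.1 h2).2
  have h5 := (abs_le.1 h3).2
  have h6 : (u - 2 * u ^ 2) ^ 2 ≤ u ^ 2 := by
    have : 0 ≤ u - 2 * u ^ 2 := by nlinarith
    nlinarith [sq_nonneg u]
  nlinarith

/-- Optimising the interpolation between two values of a convex function. -/
theorem exists_interpolation_exp_le {u : ℝ} (h0 : 0 ≤ u) :
    ∃ θ : ℝ, 0 ≤ θ ∧ θ ≤ 1 ∧ Real.exp ((1 - θ) * u + θ ^ 2 / 8) ≤ 2 - Real.exp (-u) := by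
  by_cases h1 : u ≤ 1 / 4
  -- `θ = 4u` minimises `(1 - θ) u + θ^2 / 8`; for `u > 1/4` the minimum over `[0, 1]` sits at `θ =
  -- 1`.
  · refine ⟨4 * u, by linarith, by linarith, ?_⟩
    have : (1 - 4 * u) * u + (4 * u) ^ 2 / 8 = u - 2 * u ^ 2 := by ring
    rw [this]
    exact exp_le_two_sub_exp_neg h0 h1
  · refine ⟨1, by norm_num, le_refl _, ?_⟩
    push Not at h1
    have h2 := exp_le_two_sub_exp_neg (u := 1 / 4) (by norm_num) le_rfl
    have h3 : Real.exp (-u) ≤ Real.exp (-(1 / 4)) := Real.exp_le_exp.2 (by linarith)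
    have h4 : (1 - 1) * u + (1 : ℝ) ^ 2 / 8 = 1 / 4 - 2 * (1 / 4) ^ 2 := by norm_num
    rw [h4]
    linarith

/-- Two-point form of property (τ). At the point with the larger value of `f`, `g` is compared with
`f` at a point moved a fraction `θ` towards the other one: convexity gains a term linear in `θ`, and
bounded support keeps the cost below `θ^2 / 8`. At the other point `g ≤ f` suffices. -/
theorem exp_sub_add_exp_sub_le_two {C c : ℝ} (hc0 : 0 ≤ c)
    (hc : c * (2 * C) ^ 2 ≤ 1 / 8) {f g : ℝ → ℝ} (hf : ConvexOn ℝ Set.univ f)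
    (hgf : ∀ x y, g x ≤ f y + c * (x - y) ^ 2) {x y : ℝ} (hx : |x| ≤ C) (hy : |y| ≤ C) :
    Real.exp (g x - f y) + Real.exp (g y - f x) ≤ 2 := by
  wlog h : f y ≤ f x generalizing x y
  · have := this hy hx (le_of_not_ge h)
    linarith
  obtain ⟨θ, h0, h1, hθ⟩ := exists_interpolation_exp_le (sub_nonneg.2 h)
  have h2 : g x - f y ≤ (1 - θ) * (f x - f y) + θ ^ 2 / 8 := by
    have h3 := hgf x ((1 - θ) * x + θ * y)
    have h4 := hf.2 (Set.mem_univ x) (Set.mem_univ y) (sub_nonneg.2 h1) h0 (by ring)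
    simp only [smul_eq_mul] at h4
    have h5 : c * (x - ((1 - θ) * x + θ * y)) ^ 2 ≤ θ ^ 2 / 8 := by
      have h6 : (x - y) ^ 2 ≤ (2 * C) ^ 2 := by
        rw [← sq_abs]
        refine pow_le_pow_left₀ (abs_nonneg _) ?_ 2
        calc |x - y| ≤ |x| + |y| := abs_sub _ _
          _ ≤ 2 * C := by linarith
      have h7 : c * (x - ((1 - θ) * x + θ * y)) ^ 2 = θ ^ 2 * (c * (x - y) ^ 2) := by ring
      rw [h7]
      have h8 : c * (x - y) ^ 2 ≤ 1 / 8 := (mul_le_mul_of_nonneg_left h6 hc0).trans hc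
      nlinarith [sq_nonneg θ]
    linarith
  have h3 : g y - f x ≤ -(f x - f y) := by
    have := hgf y y
    simp at this
    linarith
  have h4 := Real.exp_le_exp.2 h2
  have h5 := Real.exp_le_exp.2 h3
  linarith

/-- The two-point inequality is integrated over `ν ⊗ ν`; exchanging the variables shows that its two
terms have the same integral. -/
theorem integral_exp_mul_integral_exp_neg_le_one {ν : Measure ℝ} [IsProbabilityMeasure ν]
    {C c : ℝ} (hν : ∀ᵐ x ∂ν, |x| ≤ C) (hc0 : 0 ≤ c) (hc : c * (2 * C) ^ 2 ≤ 1 / 8)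
    {f g : ℝ → ℝ} (hf : ConvexOn ℝ Set.univ f) (hfc : Continuous f) (hgc : Continuous g)
    (hgf : ∀ x y, g x ≤ f y + c * (x - y) ^ 2) :
    (∫ x, Real.exp (g x) ∂ν) * ∫ x, Real.exp (-f x) ∂ν ≤ 1 := by
  have hi1 : Integrable (fun x => Real.exp (g x)) ν :=
    integrable_of_continuous_of_ae_abs_le hν (by fun_prop)
  have hi2 : Integrable (fun x => Real.exp (-f x)) ν :=
    integrable_of_continuous_of_ae_abs_le hν (by fun_prop)
  have hi3 := hi1.mul_prod hi2
  have e1 := integral_prod_mul (μ := ν) (ν := ν) (fun x => Real.exp (g x)) (fun x => Real.exp (-f x))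
  have e2 := integral_prod_swap (μ := ν) (ν := ν)
    (fun z : ℝ × ℝ => Real.exp (g z.1) * Real.exp (-f z.2))
  have hi4 : Integrable (fun z : ℝ × ℝ => Real.exp (g z.2) * Real.exp (-f z.1)) (ν.prod ν) :=
    hi3.swap
  have key : ∫ z : ℝ × ℝ, (Real.exp (g z.1) * Real.exp (-f z.2)
      + Real.exp (g z.2) * Real.exp (-f z.1)) ∂(ν.prod ν) ≤ ∫ z : ℝ × ℝ, (2 : ℝ) ∂(ν.prod ν) := by
    refine integral_mono_ae (hi3.add hi4) (integrable_const _) ?_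
    have ha : ∀ᵐ z : ℝ × ℝ ∂(ν.prod ν), |z.1| ≤ C :=
      Measure.quasiMeasurePreserving_fst.ae hν
    have hb : ∀ᵐ z : ℝ × ℝ ∂(ν.prod ν), |z.2| ≤ C :=
      Measure.quasiMeasurePreserving_snd.ae hν
    filter_upwards [ha, hb] with z hz1 hz2
    have := exp_sub_add_exp_sub_le_two hc0 hc hf hgf hz1 hz2
    simpa only [← Real.exp_add, ← sub_eq_add_neg] using this
  rw [integral_add hi3 hi4] at key
  simp only [Prod.fst_swap, Prod.snd_swap] at e2
  rw [e2, e1] at key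
  simp at key
  linarith

noncomputable section

/-- `log ∫ e^A dν`. -/
def logIntegralExp (ν : Measure ℝ) (A : ℝ → ℝ) : ℝ := Real.log (∫ t, Real.exp (A t) ∂ν)

/-- Infimal convolution in the first variable with a quadratic cost. -/
def partialInfConv {E : Type*} (c : ℝ) (f : ℝ × E → ℝ) (t : ℝ) (y : E) : ℝ :=
  ⨅ z : ℝ, (f (t - z, y) + c * z ^ 2)

end

section LogIntegralExp

variable {ν : Measure ℝ} [IsProbabilityMeasure ν]

theorem exp_logIntegralExp {A : ℝ → ℝ} (hA : Integrable (fun t => Real.exp (A t)) ν) :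
    Real.exp (logIntegralExp ν A) = ∫ t, Real.exp (A t) ∂ν :=
  Real.exp_log (integral_exp_pos hA)

theorem logIntegralExp_le_add {A B : ℝ → ℝ} {k : ℝ} (hA : Integrable (fun t => Real.exp (A t)) ν)
    (hB : Integrable (fun t => Real.exp (B t)) ν) (h : ∀ t, A t ≤ B t + k) :
    logIntegralExp ν A ≤ logIntegralExp ν B + k := by
  rw [← Real.exp_le_exp, Real.exp_add, exp_logIntegralExp hA, exp_logIntegralExp hB,
    ← integral_mul_const]
  refine integral_mono hA (hB.mul_const _) fun t => ?_
  simpa only [← Real.exp_add] using Real.exp_le_exp.2 (h t)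

/-- This is Hölder's inequality, derived from convexity of `exp` once both exponentials are
normalised to integral one. It keeps convexity when a coordinate is integrated out. -/
theorem logIntegralExp_convex {A B D : ℝ → ℝ} {θ θ' : ℝ}
    (hA : Integrable (fun t => Real.exp (A t)) ν) (hB : Integrable (fun t => Real.exp (B t)) ν)
    (hD : Integrable (fun t => Real.exp (D t)) ν) (h0 : 0 ≤ θ) (h0' : 0 ≤ θ') (h1 : θ + θ' = 1)
    (h : ∀ t, D t ≤ θ * A t + θ' * B t) :
    logIntegralExp ν D ≤ θ * logIntegralExp ν A + θ' * logIntegralExp ν B := by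
  set a := logIntegralExp ν A with ha
  set b := logIntegralExp ν B with hb
  have hiA : ∫ t, Real.exp (A t - a) ∂ν = 1 := by
    simp_rw [Real.exp_sub]
    rw [integral_div, ha, exp_logIntegralExp hA, div_self (integral_exp_pos hA).ne']
  have hiB : ∫ t, Real.exp (B t - b) ∂ν = 1 := by
    simp_rw [Real.exp_sub]
    rw [integral_div, hb, exp_logIntegralExp hB, div_self (integral_exp_pos hB).ne']
  have hA' : Integrable (fun t => Real.exp (A t - a)) ν := by
    simp_rw [Real.exp_sub]; exact hA.div_const _
  have hB' : Integrable (fun t => Real.exp (B t - b)) ν := by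
    simp_rw [Real.exp_sub]; exact hB.div_const _
  rw [← Real.exp_le_exp, exp_logIntegralExp hD]
  have key : ∫ t, Real.exp (D t) ∂ν ≤ ∫ t, Real.exp (θ * a + θ' * b) *
      (θ * Real.exp (A t - a) + θ' * Real.exp (B t - b)) ∂ν := by
    refine integral_mono hD (((hA'.const_mul θ).add (hB'.const_mul θ')).const_mul _) fun t => ?_
    have hc := convexOn_exp.2 (Set.mem_univ (A t - a)) (Set.mem_univ (B t - b)) h0 h0' h1
    simp only [smul_eq_mul] at hc
    calc Real.exp (D t) ≤ Real.exp ((θ * a + θ' * b) + (θ * (A t - a) + θ' * (B t - b))) :=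
          Real.exp_le_exp.2 ((h t).trans (le_of_eq (by ring)))
      _ ≤ _ := by
          rw [Real.exp_add]
          exact mul_le_mul_of_nonneg_left hc (Real.exp_nonneg _)
  rw [integral_const_mul, integral_add (hA'.const_mul θ) (hB'.const_mul θ'), integral_const_mul,
    integral_const_mul, hiA, hiB, mul_one, mul_one, h1, mul_one] at key
  exact key

end LogIntegralExp

section PartialInfConv

variable {E : Type*} [NormedAddCommGroup E] {c : ℝ} {f : ℝ × E → ℝ} {K : NNReal}

/-- The quadratic cost outweighs the linear decrease permitted by the Lipschitz bound, so the real
infimum is a genuine one. -/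
theorem partialInfConv_bddBelow (hc : 0 < c) (hf : LipschitzWith K f) (t : ℝ) (y : E) :
    BddBelow (Set.range fun z : ℝ => f (t - z, y) + c * z ^ 2) := by
  refine ⟨f (t, y) - K ^ 2 / (4 * c), ?_⟩
  rintro _ ⟨z, rfl⟩
  have h := hf.dist_le_mul (t, y) (t - z, y)
  rw [Prod.dist_eq, dist_self, Real.dist_eq, Real.dist_eq] at h
  simp only [sub_sub_cancel] at h
  rw [max_eq_left (abs_nonneg z)] at h
  have h1 := (abs_le.1 h).2
  have h2 : (K : ℝ) * |z| ≤ c * z ^ 2 + K ^ 2 / (4 * c) := by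
    have h3 : c * z ^ 2 + K ^ 2 / (4 * c) - K * |z| = (2 * c * |z| - K) ^ 2 / (4 * c) := by
      rw [← sq_abs z]; field_simp; ring
    have : 0 ≤ (2 * c * |z| - K) ^ 2 / (4 * c) := by positivity
    linarith
  simp only
  linarith

theorem partialInfConv_le (hc : 0 < c) (hf : LipschitzWith K f) (t z : ℝ) (y : E) :
    partialInfConv c f t y ≤ f (t - z, y) + c * z ^ 2 :=
  ciInf_le (partialInfConv_bddBelow hc hf t y) z

theorem partialInfConv_lipschitz (hc : 0 < c) (hf : LipschitzWith K f) :
    LipschitzWith K (fun p : ℝ × E => partialInfConv c f p.1 p.2) := by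
  refine LipschitzWith.of_le_add_mul K fun p p' => ?_
  rw [← sub_le_iff_le_add]
  refine le_ciInf fun z => ?_
  have h1 := partialInfConv_le hc hf p.1 z p.2
  have h2 := hf.dist_le_mul (p.1 - z, p.2) (p'.1 - z, p'.2)
  have h3 : dist (p.1 - z, p.2) (p'.1 - z, p'.2) = dist p p' := by
    simp [Prod.dist_eq]
  rw [h3, Real.dist_eq] at h2
  have h4 := (abs_le.1 h2).2
  linarith

/-- Minimising a jointly convex function over one variable preserves convexity: near-minimisers for
`y` and `y'` are averaged. -/
theorem partialInfConv_convex [NormedSpace ℝ E] (hc : 0 < c) (hf : LipschitzWith K f) (hconv : ConvexOn ℝ Set.univ f)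
    (t : ℝ) {y y' : E} {θ θ' : ℝ} (h0 : 0 ≤ θ) (h0' : 0 ≤ θ') (h1 : θ + θ' = 1) :
    partialInfConv c f t (θ • y + θ' • y') ≤
      θ * partialInfConv c f t y + θ' * partialInfConv c f t y' := by
  refine le_of_forall_pos_le_add fun ε hε => ?_
  obtain ⟨z, hz⟩ := exists_lt_of_ciInf_lt (lt_add_of_pos_right (partialInfConv c f t y) hε)
  obtain ⟨z', hz'⟩ := exists_lt_of_ciInf_lt (lt_add_of_pos_right (partialInfConv c f t y') hε)
  have h2 := partialInfConv_le hc hf t (θ * z + θ' * z') (θ • y + θ' • y')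
  have h3 := hconv.2 (Set.mem_univ (t - z, y)) (Set.mem_univ (t - z', y')) h0 h0' h1
  have h4 : θ • (t - z, y) + θ' • (t - z', y') = (t - (θ * z + θ' * z'), θ • y + θ' • y') := by
    ext
    · simp only [Prod.smul_mk, Prod.mk_add_mk, smul_eq_mul]
      linear_combination t * h1
    · simp
  rw [h4] at h3
  simp only [smul_eq_mul] at h3
  have h5 : (θ * z + θ' * z') ^ 2 ≤ θ * z ^ 2 + θ' * z' ^ 2 := by
    have : θ' = 1 - θ := by linarith
    subst this
    nlinarith [mul_nonneg (mul_nonneg h0 h0') (sq_nonneg (z - z'))]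
  have h6 := mul_le_mul_of_nonneg_left h5 hc.le
  have h7 := mul_le_mul_of_nonneg_left hz.le h0
  have h8 := mul_le_mul_of_nonneg_left hz'.le h0'
  have h9 : θ * ε + θ' * ε = ε := by rw [← add_mul, h1, one_mul]
  linarith

end PartialInfConv

theorem dist_fin_cons {N : ℕ} (t t' : ℝ) (y y' : Fin N → ℝ) :
    dist (Fin.cons t y : Fin (N + 1) → ℝ) (Fin.cons t' y') ≤ dist (t, y) (t', y') := by
  refine (dist_pi_le_iff dist_nonneg).2 fun i => ?_
  refine Fin.cases ?_ (fun j => ?_) i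
  · simp only [Fin.cons_zero]
    exact le_max_left (dist t t') (dist y y')
  · simp only [Fin.cons_succ]
    exact (dist_le_pi_dist y y' j).trans (le_max_right (dist t t') (dist y y'))

theorem LipschitzWith.comp_fin_cons {N : ℕ} {f : (Fin (N + 1) → ℝ) → ℝ} {K : NNReal}
    (hf : LipschitzWith K f) :
    LipschitzWith K (fun p : ℝ × (Fin N → ℝ) => f (Fin.cons p.1 p.2)) := by
  refine LipschitzWith.of_dist_le_mul fun p p' => ?_
  exact (hf.dist_le_mul _ _).trans
    (mul_le_mul_of_nonneg_left (dist_fin_cons p.1 p'.1 p.2 p'.2) K.2)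

theorem ConvexOn.comp_fin_cons {N : ℕ} {f : (Fin (N + 1) → ℝ) → ℝ}
    (hf : ConvexOn ℝ Set.univ f) :
    ConvexOn ℝ Set.univ (fun p : ℝ × (Fin N → ℝ) => f (Fin.cons p.1 p.2)) := by
  refine ⟨convex_univ, fun p _ p' _ a b ha hb hab => ?_⟩
  have h := hf.2 (Set.mem_univ (Fin.cons p.1 p.2)) (Set.mem_univ (Fin.cons p'.1 p'.2)) ha hb hab
  convert h using 2
  ext i
  refine Fin.cases ?_ (fun j => ?_) i <;> simp

theorem LipschitzWith.section_right {E : Type*} [PseudoMetricSpace E] {f : ℝ × E → ℝ} {K : NNReal}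
    (hf : LipschitzWith K f) (t : ℝ) (y y' : E) : f (t, y) ≤ f (t, y') + K * dist y y' := by
  have h := hf.dist_le_mul (t, y) (t, y')
  rw [Prod.dist_eq, dist_self, max_eq_right dist_nonneg, Real.dist_eq] at h
  linarith [(abs_le.1 h).2]

/-- Maurey's property `(τ)` for products of a boundedly supported measure on the line. -/
theorem integral_exp_mul_integral_exp_neg_le_one_pi {ν : Measure ℝ} [IsProbabilityMeasure ν]
    {C c : ℝ} (hν : ∀ᵐ x ∂ν, |x| ≤ C) (hc0 : 0 < c)
    (hc : c * (2 * C) ^ 2 ≤ 1 / 8) : ∀ (N : ℕ) (f g : (Fin N → ℝ) → ℝ),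
    ConvexOn ℝ Set.univ f → (∃ K, LipschitzWith K f) → (∃ K, LipschitzWith K g) →
    (∀ x y, g x ≤ f y + c * ∑ i, (x i - y i) ^ 2) →
    (∫ x, Real.exp (g x) ∂(Measure.pi fun _ => ν)) *
      ∫ x, Real.exp (-f x) ∂(Measure.pi fun _ => ν) ≤ 1 := by
  intro N
  induction N with
  | zero =>
    intro f g _ _ _ hgf
    have h1 : ∀ x : Fin 0 → ℝ, x = 0 := fun x => Subsingleton.elim _ _
    have h2 : (fun x => Real.exp (g x)) = fun _ => Real.exp (g 0) := by ext x; rw [h1 x]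
    have h3 : (fun x => Real.exp (-f x)) = fun _ => Real.exp (-f 0) := by ext x; rw [h1 x]
    rw [h2, h3]
    simp only [integral_const, probReal_univ, smul_eq_mul, one_mul]
    rw [← Real.exp_add, Real.exp_le_one_iff]
    have := hgf 0 0
    simp only [Finset.univ_eq_empty, Finset.sum_empty, mul_zero, add_zero] at this
    linarith
  | succ N ih =>
    rintro f g hf ⟨K, hK⟩ ⟨K', hK'⟩ hgf
    set f' : ℝ × (Fin N → ℝ) → ℝ := fun p => f (Fin.cons p.1 p.2) with hf'
    have hfL : LipschitzWith K f' := hK.comp_fin_cons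
    have hfC : ConvexOn ℝ Set.univ f' := hf.comp_fin_cons
    have hgL : LipschitzWith K' (fun p : ℝ × (Fin N → ℝ) => g (Fin.cons p.1 p.2)) :=
      hK'.comp_fin_cons
    have hqL := partialInfConv_lipschitz hc0 hfL
    have hqc : ∀ y, Continuous fun t => partialInfConv c f' t y := fun y =>
      hqL.continuous.comp (by fun_prop : Continuous fun t : ℝ => (t, y))
    have hfc : ∀ y, Continuous fun t => f' (t, y) := fun y =>
      hfL.continuous.comp (by fun_prop : Continuous fun t : ℝ => (t, y))
    have hgc : ∀ y : Fin N → ℝ, Continuous fun t => g (Fin.cons t y) := fun y =>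
      hgL.continuous.comp (by fun_prop : Continuous fun t : ℝ => (t, y))
    have hqi : ∀ y, Integrable (fun t => Real.exp (partialInfConv c f' t y)) ν := fun y =>
      integrable_of_continuous_of_ae_abs_le hν (Real.continuous_exp.comp (hqc y))
    have hgi : ∀ y : Fin N → ℝ, Integrable (fun t => Real.exp (g (Fin.cons t y))) ν := fun y =>
      integrable_of_continuous_of_ae_abs_le hν (Real.continuous_exp.comp (hgc y))
    -- The first coordinate is integrated out; the induction hypothesis applies to the pair `g₀`,
    -- `G` in the remaining `N` coordinates.
    set g₀ : (Fin N → ℝ) → ℝ := fun y => logIntegralExp ν fun t => partialInfConv c f' t y with hg₀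
    set G : (Fin N → ℝ) → ℝ := fun y => logIntegralExp ν fun t => g (Fin.cons t y) with hG
    have hg₀L : LipschitzWith K g₀ := by
      refine LipschitzWith.of_le_add_mul K fun y y' => ?_
      exact logIntegralExp_le_add (hqi y) (hqi y') fun t => hqL.section_right t y y'
    have hGL : LipschitzWith K' G := by
      refine LipschitzWith.of_le_add_mul K' fun y y' => ?_
      exact logIntegralExp_le_add (hgi y) (hgi y') fun t => hgL.section_right t y y'
    have hg₀C : ConvexOn ℝ Set.univ g₀ := by
      refine ⟨convex_univ, fun y _ y' _ a b ha hb hab => ?_⟩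
      exact logIntegralExp_convex (hqi y) (hqi y') (hqi _) ha hb hab fun t =>
        partialInfConv_convex hc0 hfL hfC t ha hb hab
    have hGg : ∀ x y, G x ≤ g₀ y + c * ∑ i, (x i - y i) ^ 2 := by
      intro x y
      refine logIntegralExp_le_add (hgi x) (hqi y) fun t => ?_
      rw [← sub_le_iff_le_add]
      refine le_ciInf fun z => ?_
      have := hgf (Fin.cons t x) (Fin.cons (t - z) y)
      simp only [Fin.sum_univ_succ, Fin.cons_zero, Fin.cons_succ, sub_sub_cancel] at this
      simp only [hf']
      linarith
    have key := ih g₀ G hg₀C ⟨K, hg₀L⟩ ⟨K', hGL⟩ hGg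
    -- The one-dimensional inequality on each fibre, for `f'` and its infimal convolution, replaces
    -- the fibre integral of `exp (-f)` by `exp (-g₀)`.
    have hone : ∀ y, ∫ t, Real.exp (-f (Fin.cons t y)) ∂ν ≤ Real.exp (-g₀ y) := by
      intro y
      have hcv : ConvexOn ℝ Set.univ fun t => f' (t, y) := by
        refine ⟨convex_univ, fun t _ t' _ a b ha hb hab => ?_⟩
        have := hfC.2 (Set.mem_univ (t, y)) (Set.mem_univ (t', y)) ha hb hab
        rwa [Prod.smul_mk, Prod.smul_mk, Prod.mk_add_mk, ← add_smul, hab, one_smul] at this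
      have h := integral_exp_mul_integral_exp_neg_le_one hν hc0.le hc hcv (hfc y) (hqc y)
        (fun x t => by
          have := partialInfConv_le hc0 hfL x (x - t) y
          rwa [sub_sub_cancel] at this)
      rw [← exp_logIntegralExp (hqi y)] at h
      rw [Real.exp_neg, ← one_div, le_div_iff₀ (Real.exp_pos _), mul_comm]
      exact h
    have hfi : Integrable (fun x => Real.exp (-f x)) (Measure.pi fun _ : Fin (N + 1) => ν) :=
      integrable_pi_of_continuous hν (Real.continuous_exp.comp hK.continuous.neg)
    have hgi' : Integrable (fun x => Real.exp (g x)) (Measure.pi fun _ : Fin (N + 1) => ν) :=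
      integrable_pi_of_continuous hν (Real.continuous_exp.comp hK'.continuous)
    rw [integral_pi_fin_succ hfi, integral_pi_fin_succ hgi']
    have e1 : ∀ y, ∫ t, Real.exp (g (Fin.cons t y)) ∂ν = Real.exp (G y) := fun y =>
      (exp_logIntegralExp (hgi y)).symm
    simp_rw [e1]
    refine le_trans (mul_le_mul_of_nonneg_left ?_ (integral_nonneg fun _ => Real.exp_nonneg _)) key
    refine integral_mono (integrable_comp_fin_cons hfi).integral_prod_right ?_ hone
    exact integrable_pi_of_continuous hν (Real.continuous_exp.comp hg₀L.continuous.neg)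

/-- Sub-Gaussian concentration of convex Lipschitz functions of bounded independent variables. -/
theorem integral_exp_sub_integral_le_of_bounded {ν : Measure ℝ} [IsProbabilityMeasure ν]
    {C : ℝ} (hC : 0 < C) (hν : ∀ᵐ x ∂ν, |x| ≤ C) {N : ℕ} {F : (Fin N → ℝ) → ℝ}
    (hF : ConvexOn ℝ Set.univ F) {L : ℝ} (hL : 0 ≤ L)
    (hLip : ∀ x y, |F x - F y| ≤ L * √(∑ i, (x i - y i) ^ 2)) (lam : ℝ) :
    Integrable (fun x => Real.exp (lam * F x)) (Measure.pi fun _ => ν) ∧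
    ∫ x, Real.exp (lam * (F x - ∫ y, F y ∂(Measure.pi fun _ => ν))) ∂(Measure.pi fun _ => ν) ≤
      Real.exp (8 * C ^ 2 * lam ^ 2 * L ^ 2) := by
  have hsq : ∀ x y : Fin N → ℝ, √(∑ i, (x i - y i) ^ 2) ≤ √N * dist x y := by
    intro x y
    rw [← Real.sqrt_sq (dist_nonneg (x := x) (y := y)), ← Real.sqrt_mul (Nat.cast_nonneg N)]
    refine Real.sqrt_le_sqrt ?_
    calc ∑ i, (x i - y i) ^ 2 ≤ ∑ _i : Fin N, dist x y ^ 2 := by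
          refine Finset.sum_le_sum fun i _ => ?_
          rw [← sq_abs, ← Real.dist_eq]
          exact pow_le_pow_left₀ dist_nonneg (dist_le_pi_dist x y i) 2
      _ = N * dist x y ^ 2 := by simp
  have hFL : LipschitzWith (Real.toNNReal (L * √N)) F := by
    refine LipschitzWith.of_dist_le_mul fun x y => ?_
    rw [Real.coe_toNNReal _ (by positivity), Real.dist_eq, mul_assoc]
    exact (hLip x y).trans (mul_le_mul_of_nonneg_left (hsq x y) hL)
  have hFc : Continuous F := hFL.continuous
  have hint : ∀ s : ℝ, Integrable (fun x => Real.exp (s * F x)) (Measure.pi fun _ : Fin N => ν) :=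
    fun s => integrable_pi_of_continuous hν (by fun_prop)
  have hFi : Integrable F (Measure.pi fun _ : Fin N => ν) := integrable_pi_of_continuous hν hFc
  set m := ∫ y, F y ∂(Measure.pi fun _ : Fin N => ν) with hm
  refine ⟨hint lam, ?_⟩
  have hpos : ∀ s : ℝ, 0 ≤ s →
      (∫ x, Real.exp (s * (F x - m)) ∂(Measure.pi fun _ : Fin N => ν)) *
      (∫ x, Real.exp (-s * (F x - m)) ∂(Measure.pi fun _ : Fin N => ν)) ≤
      Real.exp (8 * C ^ 2 * s ^ 2 * L ^ 2) := by
    intro s hs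
    -- `c` is the largest cost with `c (2C)^2 ≤ 1/8`, and `D` below is the maximum over `d` of `s L
    -- d - c d^2`.
    set c : ℝ := 1 / (32 * C ^ 2) with hcdef
    have hc0 : 0 < c := by positivity
    set D := 8 * C ^ 2 * s ^ 2 * L ^ 2 with hD
    have hcv : ConvexOn ℝ Set.univ fun x => s * (F x - m) := by
      have := (hF.add_const (-m)).smul hs
      simpa [smul_eq_mul, sub_eq_add_neg] using this
    have hLs : LipschitzWith (Real.toNNReal (s * (L * √N))) fun x => s * (F x - m) := by
      refine LipschitzWith.of_dist_le_mul fun x y => ?_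
      have := hFL.dist_le_mul x y
      rw [Real.coe_toNNReal _ (by positivity), Real.dist_eq] at this ⊢
      rw [← mul_sub, sub_sub_sub_cancel_right, abs_mul, abs_of_nonneg hs, mul_assoc]
      exact mul_le_mul_of_nonneg_left this hs
    have hLs' : LipschitzWith (Real.toNNReal (s * (L * √N))) fun x => s * (F x - m) - D := by
      refine LipschitzWith.of_dist_le_mul fun x y => ?_
      rw [dist_sub_right]
      exact hLs.dist_le_mul x y
    have h := integral_exp_mul_integral_exp_neg_le_one_pi hν hc0
      (by rw [hcdef]; field_simp; norm_num) N _ _ hcv ⟨_, hLs⟩ ⟨_, hLs'⟩ (by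
        intro x y
        set d := √(∑ i, (x i - y i) ^ 2) with hd
        have hd2 : ∑ i, (x i - y i) ^ 2 = d ^ 2 :=
          (Real.sq_sqrt (Finset.sum_nonneg fun i _ => sq_nonneg _)).symm
        have h1 := (abs_le.1 (hLip x y)).2
        have h2 : s * (F x - F y) ≤ s * (L * d) := mul_le_mul_of_nonneg_left h1 hs
        have h3 : c * d ^ 2 + D - s * (L * d) = (d / (4 * C) - 4 * C * s * L) ^ 2 * (1 / 2) := by
          rw [hcdef, hD]; field_simp; ring
        have h4 : 0 ≤ (d / (4 * C) - 4 * C * s * L) ^ 2 * (1 / 2) := by positivity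
        rw [hd2]
        linarith)
    simp_rw [Real.exp_sub _ D] at h
    rw [integral_div, div_mul_eq_mul_div, div_le_one (Real.exp_pos _)] at h
    simpa only [neg_mul] using h
  -- By Jensen both factors in `hpos` are at least one, so each alone is bounded by their product.
  -- This also covers negative `lam`, for which `lam * F` is concave.
  have hjensen : ∀ s : ℝ, 1 ≤ ∫ x, Real.exp (s * (F x - m)) ∂(Measure.pi fun _ : Fin N => ν) := by
    intro s
    have hi : Integrable (fun x => s * (F x - m)) (Measure.pi fun _ : Fin N => ν) :=
      (hFi.sub (integrable_const m)).const_mul s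
    have hi' : Integrable (fun x => Real.exp (s * (F x - m))) (Measure.pi fun _ : Fin N => ν) :=
      integrable_pi_of_continuous hν (by fun_prop)
    have h1 : ∫ x, (s * (F x - m) + 1) ∂(Measure.pi fun _ : Fin N => ν) ≤
        ∫ x, Real.exp (s * (F x - m)) ∂(Measure.pi fun _ : Fin N => ν) :=
      integral_mono (hi.add (integrable_const 1)) hi' fun x => Real.add_one_le_exp _
    rw [integral_add hi (integrable_const 1), integral_const_mul,
      integral_sub hFi (integrable_const m)] at h1
    simpa [hm] using h1
  rcases le_total 0 lam with h | h
  · refine le_trans ?_ (hpos lam h)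
    exact le_mul_of_one_le_right (integral_nonneg fun _ => Real.exp_nonneg _) (hjensen _)
  · have h' := hpos (-lam) (by linarith)
    rw [neg_neg, neg_sq] at h'
    refine le_trans ?_ h'
    exact le_mul_of_one_le_left (integral_nonneg fun _ => Real.exp_nonneg _) (hjensen _)

/-! ### Logarithmic Sobolev inequality: tensorisation and Herbst's argument. -/

section

open Filter Topology

theorem exists_abs_mul_log_le (B : ℝ) : ∃ M : ℝ, ∀ u : ℝ, |u| ≤ B → |u * Real.log u| ≤ M := by
  obtain ⟨M, hM⟩ := (isCompact_Icc (a := -B) (b := B)).exists_bound_of_continuousOn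
    Real.continuous_mul_log.continuousOn
  exact ⟨M, fun u hu => hM u (abs_le.1 hu)⟩

/-- The logarithmic Sobolev inequality extends to bounded functions with bounded derivative. -/
theorem SatisfiesLogSobolev.entropyOf_sq_le {ν : Measure ℝ} [IsProbabilityMeasure ν] {C : ℝ}
    (h : SatisfiesLogSobolev ν C) {f : ℝ → ℝ} (hf : ContDiff ℝ (⊤ : ℕ∞) f) {B D : ℝ}
    (hB : ∀ x, |f x| ≤ B) (hD : ∀ x, |deriv f x| ≤ D) :
    entropyOf ν (fun x => f x ^ 2) ≤ C * ∫ x, |deriv f x| ^ 2 ∂ν := by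
  let χ : ContDiffBump (0 : ℝ) := ⟨1, 2, one_pos, one_lt_two⟩
  have hχ : ContDiff ℝ (⊤ : ℕ∞) χ := χ.contDiff
  have hχd : ContDiff ℝ (⊤ : ℕ∞) (deriv χ) := by
    have := contDiff_infty_iff_deriv.1 hχ
    exact this.2
  have hB0 : 0 ≤ B := (abs_nonneg _).trans (hB 0)
  have hD0 : 0 ≤ D := (abs_nonneg _).trans (hD 0)
  obtain ⟨D', hD'⟩ := χ.hasCompactSupport.deriv.exists_bound_of_continuous hχd.continuous
  have hD'0 : 0 ≤ D' := (norm_nonneg _).trans (hD' 0)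
  -- The cutoffs agree with `f` on growing balls and their derivatives add `O(1 / k)`; all
  -- integrands stay bounded, so dominated convergence passes the inequality to `f`.
  set fk : ℕ → ℝ → ℝ := fun k x => f x * χ (x / (k + 1)) with hfk
  have hk : ∀ k : ℕ, (1 : ℝ) ≤ k + 1 := fun k => by
    have : (0 : ℝ) ≤ k := Nat.cast_nonneg k
    linarith
  have hsm : ∀ k, ContDiff ℝ (⊤ : ℕ∞) (fk k) := fun k => by
    refine hf.mul (hχ.comp ?_)
    exact contDiff_id.div_const _
  have hcs : ∀ k, HasCompactSupport (fk k) := fun k => by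
    refine HasCompactSupport.mul_left ?_
    have h1 := χ.hasCompactSupport
    have h2 : (fun x : ℝ => χ (x / (k + 1))) = fun x => χ (((k : ℝ) + 1)⁻¹ • x) := by
      ext x; rw [smul_eq_mul, div_eq_inv_mul]
    rw [h2]
    exact h1.comp_smul (inv_ne_zero (by linarith [hk k]))
  have hdfd : Differentiable ℝ f := hf.differentiable (by simp)
  have hdχ : Differentiable ℝ χ := hχ.differentiable (by simp)
  have hder : ∀ k x, deriv (fk k) x =
      deriv f x * χ (x / (k + 1)) + f x * (deriv χ (x / (k + 1)) / (k + 1)) := by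
    intro k x
    have h1 := (hdfd x).hasDerivAt
    have h2 : HasDerivAt (fun x : ℝ => χ (x / (k + 1))) (deriv χ (x / (k + 1)) * (1 / (k + 1))) x :=
      HasDerivAt.comp (h₂ := χ) (h := fun x : ℝ => x / (k + 1)) x (hdχ (x / (k + 1))).hasDerivAt
        ((hasDerivAt_id x).div_const _)
    have := (h1.mul h2).deriv
    rw [show fk k = f * fun x : ℝ => χ (x / (k + 1)) from rfl, this]
    ring
  have hev : ∀ x, ∀ᶠ k : ℕ in atTop, χ (x / (k + 1)) = 1 := by
    intro x
    obtain ⟨m, hm⟩ := exists_nat_ge |x|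
    filter_upwards [eventually_ge_atTop m] with k hkm
    refine χ.one_of_mem_closedBall ?_
    have hk0 : (0 : ℝ) < k + 1 := by linarith [hk k]
    rw [mem_closedBall_zero_iff, Real.norm_eq_abs, abs_div, abs_of_pos hk0, div_le_iff₀ hk0]
    have : (m : ℝ) ≤ k := Nat.cast_le.2 hkm
    change |x| ≤ 1 * ((k : ℝ) + 1)
    linarith
  have hfkx : ∀ x, Tendsto (fun k => fk k x) atTop (𝓝 (f x)) := by
    intro x
    refine tendsto_const_nhds.congr' ?_
    filter_upwards [hev x] with k hkx
    simp [hfk, hkx]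
  have hdkx : ∀ x, Tendsto (fun k => deriv (fk k) x) atTop (𝓝 (deriv f x)) := by
    intro x
    have h0 : Tendsto (fun k : ℕ => f x * (deriv χ (x / (k + 1)) / (k + 1))) atTop (𝓝 0) := by
      have h1 : Tendsto (fun k : ℕ => B * D' * (1 / ((k : ℝ) + 1))) atTop (𝓝 (B * D' * 0)) :=
        tendsto_one_div_add_atTop_nhds_zero_nat.const_mul _
      rw [mul_zero] at h1
      refine squeeze_zero_norm (fun k => ?_) h1
      rw [norm_mul, norm_div, Real.norm_of_nonneg (by linarith [hk k] : (0 : ℝ) ≤ k + 1),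
        mul_assoc, mul_one_div]
      have h3 := hD' (x / (k + 1))
      have h4 : (0 : ℝ) < k + 1 := by linarith [hk k]
      exact mul_le_mul (hB x) (div_le_div_of_nonneg_right h3 h4.le) (by positivity) hB0
    have h2 : Tendsto (fun k : ℕ => deriv f x * χ (x / (k + 1))) atTop (𝓝 (deriv f x)) := by
      refine tendsto_const_nhds.congr' ?_
      filter_upwards [hev x] with k hkx
      simp [hkx]
    have h3 := h2.add h0
    rw [add_zero] at h3
    exact h3.congr fun k => (hder k x).symm
  have hfkB : ∀ k x, |fk k x| ≤ B := by
    intro k x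
    rw [hfk, abs_mul, abs_of_nonneg χ.nonneg]
    exact (mul_le_of_le_one_right (abs_nonneg _) χ.le_one).trans (hB x)
  have hdkB : ∀ k x, |deriv (fk k) x| ≤ D + B * D' := by
    intro k x
    rw [hder]
    refine (abs_add_le _ _).trans (add_le_add ?_ ?_)
    · rw [abs_mul, abs_of_nonneg χ.nonneg]
      exact (mul_le_of_le_one_right (abs_nonneg _) χ.le_one).trans (hD x)
    · rw [abs_mul, abs_div, abs_of_pos (by linarith [hk k] : (0 : ℝ) < k + 1)]
      have h4 : (0 : ℝ) < k + 1 := by linarith [hk k]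
      exact mul_le_mul (hB x) ((div_le_self (abs_nonneg _) (hk k)).trans (hD' _))
        (by positivity) hB0
  have hsq : ∀ k x, |fk k x ^ 2| ≤ B ^ 2 := fun k x => by
    rw [abs_pow]; exact pow_le_pow_left₀ (abs_nonneg _) (hfkB k x) 2
  obtain ⟨M, hM⟩ := exists_abs_mul_log_le (B ^ 2)
  have hcont : ∀ k, Continuous (fk k) := fun k => (hsm k).continuous
  have t1 : Tendsto (fun k => ∫ x, fk k x ^ 2 * Real.log (fk k x ^ 2) ∂ν) atTop
      (𝓝 (∫ x, f x ^ 2 * Real.log (f x ^ 2) ∂ν)) := by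
    refine tendsto_integral_of_dominated_convergence (fun _ => M) (fun k => ?_)
      (integrable_const M) (fun k => ae_of_all _ fun x => hM _ (hsq k x)) (ae_of_all _ fun x => ?_)
    · exact (Real.continuous_mul_log.comp ((hcont k).pow 2)).aestronglyMeasurable
    · exact (Real.continuous_mul_log.tendsto _).comp ((hfkx x).pow 2)
  have t2 : Tendsto (fun k => ∫ x, fk k x ^ 2 ∂ν) atTop (𝓝 (∫ x, f x ^ 2 ∂ν)) := by
    refine tendsto_integral_of_dominated_convergence (fun _ => B ^ 2) (fun k => ?_)
      (integrable_const _) (fun k => ae_of_all _ fun x => hsq k x) (ae_of_all _ fun x => ?_)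
    · exact ((hcont k).pow 2).aestronglyMeasurable
    · exact (hfkx x).pow 2
  have t3 : Tendsto (fun k => C * ∫ x, |deriv (fk k) x| ^ 2 ∂ν) atTop
      (𝓝 (C * ∫ x, |deriv f x| ^ 2 ∂ν)) := by
    refine Tendsto.const_mul _ ?_
    refine tendsto_integral_of_dominated_convergence (fun _ => (D + B * D') ^ 2) (fun k => ?_)
      (integrable_const _) (fun k => ae_of_all _ fun x => ?_) (ae_of_all _ fun x => ?_)
    · exact (((hsm k).continuous_deriv (by simp)).abs.pow 2).aestronglyMeasurable
    · rw [Real.norm_eq_abs, abs_pow, abs_abs]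
      exact pow_le_pow_left₀ (abs_nonneg _) (hdkB k x) 2
    · exact (hdkx x).abs.pow 2
  refine le_of_tendsto_of_tendsto' (t1.sub ((Real.continuous_mul_log.tendsto _).comp t2)) t3
    fun k => h (fk k) (hsm k) (hcs k)

end

noncomputable section

/-- `Ent_μ(g) = E (g log g) - (E g) log (E g)` on an arbitrary measure space. -/
def entropyFun {α : Type*} [MeasurableSpace α] (μ : Measure α) (g : α → ℝ) : ℝ :=
  ∫ x, g x * Real.log (g x) ∂μ - (∫ x, g x ∂μ) * Real.log (∫ x, g x ∂μ)

end

section Entropy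

variable {α β : Type*} [MeasurableSpace α] [MeasurableSpace β] {μ : Measure α} {ν : Measure β}
  [IsProbabilityMeasure μ] [IsProbabilityMeasure ν] {a B : ℝ}

theorem integrable_of_mem_Icc {g : α → ℝ} (hg : AEStronglyMeasurable g μ)
    (h : ∀ x, g x ∈ Set.Icc a B) : Integrable g μ :=
  Integrable.of_mem_Icc a B hg.aemeasurable (ae_of_all _ h)

theorem integral_mem_Icc {g : α → ℝ} (hg : AEStronglyMeasurable g μ)
    (h : ∀ x, g x ∈ Set.Icc a B) : ∫ x, g x ∂μ ∈ Set.Icc a B := by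
  have hi := integrable_of_mem_Icc hg h
  constructor
  · simpa using integral_mono (integrable_const a) hi fun x => (h x).1
  · simpa using integral_mono hi (integrable_const B) fun x => (h x).2

theorem integrable_mul_log {g h : α → ℝ} (ha : 0 < a) (hg : AEStronglyMeasurable g μ)
    (hh : AEStronglyMeasurable h μ) (hgb : ∀ x, g x ∈ Set.Icc a B) (hhb : ∀ x, h x ∈ Set.Icc a B) :
    Integrable (fun x => g x * Real.log (h x)) μ := by
  have h1 : Integrable (fun x => Real.log (h x)) μ := by
    refine integrable_of_mem_Icc (a := Real.log a) (B := Real.log B)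
      hh.aemeasurable.log.aestronglyMeasurable fun x => ⟨?_, ?_⟩
    · exact Real.log_le_log ha (hhb x).1
    · exact Real.log_le_log (ha.trans_le (hhb x).1) (hhb x).2
  refine h1.bdd_mul (c := B) hg (ae_of_all _ fun x => ?_)
  rw [Real.norm_of_nonneg (ha.le.trans (hgb x).1)]
  exact (hgb x).2

/-- Variational (Gibbs) lower bound for the entropy, from `log z ≤ z - 1` at `z = m h / (g M)`.
Bounds away from `0` and `∞` make every term integrable. -/
theorem integral_mul_log_le_entropyFun {g h : α → ℝ} (ha : 0 < a)
    (hg : AEStronglyMeasurable g μ) (hh : AEStronglyMeasurable h μ)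
    (hgb : ∀ x, g x ∈ Set.Icc a B) (hhb : ∀ x, h x ∈ Set.Icc a B) :
    ∫ x, g x * Real.log (h x) ∂μ - (∫ x, g x ∂μ) * Real.log (∫ x, h x ∂μ) ≤ entropyFun μ g := by
  set m := ∫ x, g x ∂μ with hm
  set M := ∫ x, h x ∂μ with hM
  have hm0 : 0 < m := ha.trans_le (integral_mem_Icc hg hgb).1
  have hM0 : 0 < M := ha.trans_le (integral_mem_Icc hh hhb).1
  have hgi := integrable_of_mem_Icc hg hgb
  have hhi := integrable_of_mem_Icc hh hhb
  have i1 := integrable_mul_log ha hg hh hgb hhb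
  have i2 := integrable_mul_log ha hg hg hgb hgb
  have i3 : Integrable (fun x => g x - m / M * h x) μ := hgi.sub (hhi.const_mul _)
  have key : ∫ x, (g x * Real.log (h x) + (g x - m / M * h x)) ∂μ ≤
      ∫ x, (g x * Real.log (g x) + g x * (Real.log M - Real.log m)) ∂μ := by
    refine integral_mono (i1.add i3) (i2.add (hgi.mul_const _)) fun x => ?_
    have hgx : 0 < g x := ha.trans_le (hgb x).1
    have hhx : 0 < h x := ha.trans_le (hhb x).1
    have h1 := Real.log_le_sub_one_of_pos (x := m * h x / (g x * M)) (by positivity)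
    rw [Real.log_div (by positivity) (by positivity), Real.log_mul hm0.ne' hhx.ne',
      Real.log_mul hgx.ne' hM0.ne'] at h1
    have h2 := mul_le_mul_of_nonneg_left h1 hgx.le
    have h3 : g x * (m * h x / (g x * M) - 1) = m / M * h x - g x := by
      field_simp
    rw [h3] at h2
    simp only
    linarith
  rw [integral_add i1 i3, integral_sub hgi (hhi.const_mul _),
    integral_const_mul, integral_add i2 (hgi.mul_const _), integral_mul_const, ← hm, ← hM,
    div_mul_cancel₀ _ hM0.ne'] at key
  unfold entropyFun
  rw [← hm]
  linarith

theorem integrable_entropyFun_prod {g : α × β → ℝ} (ha : 0 < a) (hg : StronglyMeasurable g)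
    (hgb : ∀ x, g x ∈ Set.Icc a B) :
    Integrable (fun y => entropyFun μ fun x => g (x, y)) ν := by
  have hl : Integrable (fun p => g p * Real.log (g p)) (μ.prod ν) :=
    integrable_mul_log ha hg.aestronglyMeasurable hg.aestronglyMeasurable hgb hgb
  have hG : StronglyMeasurable fun y => ∫ x, g (x, y) ∂μ := hg.integral_prod_left'
  have hGb : ∀ y, ∫ x, g (x, y) ∂μ ∈ Set.Icc a B := fun y =>
    integral_mem_Icc (hg.comp_measurable measurable_prodMk_right).aestronglyMeasurable
      fun x => hgb _
  exact hl.integral_prod_right.sub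
    (integrable_mul_log ha hG.aestronglyMeasurable hG.aestronglyMeasurable hGb hGb)

/-- Subadditivity of entropy for product measures. -/
theorem entropyFun_prod_le {g : α × β → ℝ} (ha : 0 < a) (hg : StronglyMeasurable g)
    (hgb : ∀ x, g x ∈ Set.Icc a B) :
    entropyFun (μ.prod ν) g ≤ ∫ y, entropyFun μ (fun x => g (x, y)) ∂ν +
      ∫ x, entropyFun ν (fun y => g (x, y)) ∂μ := by
  have hl : Integrable (fun p => g p * Real.log (g p)) (μ.prod ν) :=
    integrable_mul_log ha hg.aestronglyMeasurable hg.aestronglyMeasurable hgb hgb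
  have hgi : Integrable g (μ.prod ν) := integrable_of_mem_Icc hg.aestronglyMeasurable hgb
  set G : β → ℝ := fun y => ∫ x, g (x, y) ∂μ with hGdef
  have hG : StronglyMeasurable G := hg.integral_prod_left'
  have hGb : ∀ y, G y ∈ Set.Icc a B := fun y =>
    integral_mem_Icc (hg.comp_measurable measurable_prodMk_right).aestronglyMeasurable
      fun x => hgb _
  have iG := integrable_mul_log (μ := ν) ha hG.aestronglyMeasurable hG.aestronglyMeasurable hGb hGb
  have eM : ∫ p, g p ∂(μ.prod ν) = ∫ y, G y ∂ν := integral_prod_symm _ hgi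
  have e1 : ∫ y, entropyFun μ (fun x => g (x, y)) ∂ν =
      ∫ p, g p * Real.log (g p) ∂(μ.prod ν) - ∫ y, G y * Real.log (G y) ∂ν := by
    rw [integral_prod_symm _ hl]
    exact integral_sub hl.integral_prod_right iG
  -- The entropy of the marginal is at most the mean entropy of the slices: the variational bound is
  -- used on each slice with the marginal `G` as test function.
  have e2 : entropyFun ν G ≤ ∫ x, entropyFun ν (fun y => g (x, y)) ∂μ := by
    set M := ∫ y, G y ∂ν with hM
    have hvar : ∀ x, ∫ y, g (x, y) * Real.log (G y) ∂ν - (∫ y, g (x, y) ∂ν) * Real.log M ≤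
        entropyFun ν (fun y => g (x, y)) := fun x =>
      integral_mul_log_le_entropyFun ha
        (hg.comp_measurable measurable_prodMk_left).aestronglyMeasurable hG.aestronglyMeasurable
        (fun y => hgb _) hGb
    have iL : Integrable (fun p : α × β => g p * Real.log (G p.2)) (μ.prod ν) :=
      integrable_mul_log ha hg.aestronglyMeasurable
        (hG.comp_measurable measurable_snd).aestronglyMeasurable hgb fun p => hGb p.2
    have hsw : Integrable (fun x => entropyFun ν fun y => g (x, y)) μ :=
      integrable_entropyFun_prod (g := fun p : β × α => g (p.2, p.1)) ha
        (hg.comp_measurable measurable_swap) fun p => hgb _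
    have := integral_mono (iL.integral_prod_left.sub (hgi.integral_prod_left.mul_const _)) hsw hvar
    rw [integral_sub' iL.integral_prod_left (hgi.integral_prod_left.mul_const _),
      integral_mul_const, ← integral_prod _ iL, ← integral_prod _ hgi, integral_prod_symm _ iL,
      eM] at this
    refine le_trans (le_of_eq ?_) this
    unfold entropyFun
    congr 1
    refine integral_congr_ae (ae_of_all _ fun y => ?_)
    simp only
    rw [integral_mul_const]
  rw [e1]
  unfold entropyFun at e2 ⊢
  rw [eM]
  linarith

end Entropy

section

variable {ν : Measure ℝ} [IsProbabilityMeasure ν]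

theorem integral_pi_fin_succ_eq_prod {N : ℕ} {f : (Fin (N + 1) → ℝ) → ℝ} (hf : Continuous f) :
    ∫ x, f x ∂(Measure.pi fun _ => ν) =
      ∫ p : ℝ × (Fin N → ℝ), f (Fin.cons p.1 p.2) ∂(ν.prod (Measure.pi fun _ => ν)) := by
  have h := measurePreserving_fin_cons ν N
  rw [← h.map_eq, integral_map h.measurable.aemeasurable hf.aestronglyMeasurable]

theorem hasDerivAt_fin_cons {N : ℕ} (t : ℝ) (y : Fin N → ℝ) :
    HasDerivAt (fun s : ℝ => (Fin.cons s y : Fin (N + 1) → ℝ)) (Pi.single 0 1) t := by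
  rw [hasDerivAt_pi]
  refine Fin.cases ?_ fun j => ?_
  · simpa using! hasDerivAt_id t
  · simpa using! hasDerivAt_const t (y j)

theorem hasFDerivAt_comp_fin_cons {N : ℕ} {f : (Fin (N + 1) → ℝ) → ℝ} (hf : Differentiable ℝ f)
    (t : ℝ) (y : Fin N → ℝ) (j : Fin N) :
    fderiv ℝ (fun z : Fin N → ℝ => f (Fin.cons t z)) y (Pi.single j 1) =
      fderiv ℝ f (Fin.cons t y) (Pi.single j.succ 1) := by
  let A : (Fin N → ℝ) →L[ℝ] (Fin (N + 1) → ℝ) :=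
    ContinuousLinearMap.pi (Fin.cons 0 fun j => ContinuousLinearMap.proj j)
  have hA : ∀ z, A z = Fin.cons 0 z := by
    intro z
    ext i
    refine Fin.cases ?_ (fun k => ?_) i <;> simp [A]
  have h1 : HasFDerivAt (fun z : Fin N → ℝ => (Fin.cons t z : Fin (N + 1) → ℝ)) A y := by
    have h2 : (fun z : Fin N → ℝ => (Fin.cons t z : Fin (N + 1) → ℝ)) =
        fun z => (Fin.cons t 0 : Fin (N + 1) → ℝ) + A z := by
      ext z i
      rw [hA]
      refine Fin.cases ?_ (fun k => ?_) i <;> simp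
    rw [h2]
    exact A.hasFDerivAt.const_add _
  have h3 := (hf (Fin.cons t y)).hasFDerivAt.comp y h1
  have h4 : fderiv ℝ (fun z : Fin N → ℝ => f (Fin.cons t z)) y =
      (fderiv ℝ f (Fin.cons t y)).comp A := h3.fderiv
  rw [h4, ContinuousLinearMap.comp_apply, hA]
  congr 1
  ext i
  refine Fin.cases ?_ (fun k => ?_) i
  · simp
  · simp [Pi.single_apply]

/-- The logarithmic Sobolev inequality tensorises. -/
theorem SatisfiesLogSobolev.entropyFun_pi_le {C : ℝ} (hν : SatisfiesLogSobolev ν C) :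
    ∀ (N : ℕ) (f : (Fin N → ℝ) → ℝ) (a B D : ℝ), ContDiff ℝ (⊤ : ℕ∞) f → 0 < a →
      (∀ x, f x ∈ Set.Icc a B) → (∀ x i, |fderiv ℝ f x (Pi.single i 1)| ≤ D) →
      entropyFun (Measure.pi fun _ => ν) (fun x => f x ^ 2) ≤
        C * ∫ x, ∑ i, (fderiv ℝ f x (Pi.single i 1)) ^ 2 ∂(Measure.pi fun _ => ν) := by
  intro N
  induction N with
  | zero =>
    intro f a B D _ _ _ _
    have h1 : ∀ x : Fin 0 → ℝ, x = 0 := fun x => Subsingleton.elim _ _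
    have h2 : f = fun _ => f 0 := by ext x; rw [h1 x]
    rw [h2]
    simp [entropyFun]
  | succ N ih =>
    intro f a B D hf ha hfb hD
    have hdf : Differentiable ℝ f := hf.differentiable (by simp)
    have hP : ∀ i, Continuous fun x => fderiv ℝ f x (Pi.single i 1) := fun i =>
      (hf.continuous_fderiv (by simp)).clm_apply continuous_const
    have hcc := continuous_fin_cons N
    have hg : Continuous fun p : ℝ × (Fin N → ℝ) => f (Fin.cons p.1 p.2) ^ 2 :=
      (hf.continuous.comp hcc).pow 2
    have hgb : ∀ p : ℝ × (Fin N → ℝ), f (Fin.cons p.1 p.2) ^ 2 ∈ Set.Icc (a ^ 2) (B ^ 2) :=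
      fun p => ⟨pow_le_pow_left₀ ha.le (hfb _).1 2,
        pow_le_pow_left₀ (ha.le.trans (hfb _).1) (hfb _).2 2⟩
    have hsq : ∀ (i : Fin (N + 1)) x, (fderiv ℝ f x (Pi.single i 1)) ^ 2 ∈ Set.Icc 0 (D ^ 2) :=
      fun i x => ⟨sq_nonneg _, by
        rw [← sq_abs]; exact pow_le_pow_left₀ (abs_nonneg _) (hD x i) 2⟩
    have e0 : entropyFun (Measure.pi fun _ => ν) (fun x => f x ^ 2) =
        entropyFun (ν.prod (Measure.pi fun _ : Fin N => ν))
          (fun p => f (Fin.cons p.1 p.2) ^ 2) := by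
      unfold entropyFun
      have hc : Continuous fun x => f x ^ 2 := hf.continuous.pow 2
      rw [integral_pi_fin_succ_eq_prod hc,
        integral_pi_fin_succ_eq_prod (f := fun x => f x ^ 2 * Real.log (f x ^ 2))
          (Real.continuous_mul_log.comp hc)]
    have hi0 : Integrable (fun p : ℝ × (Fin N → ℝ) =>
        (fderiv ℝ f (Fin.cons p.1 p.2) (Pi.single 0 1)) ^ 2)
        (ν.prod (Measure.pi fun _ : Fin N => ν)) :=
      integrable_of_mem_Icc (((hP 0).comp hcc).pow 2).aestronglyMeasurable fun p => hsq 0 _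
    have hi1 : Integrable (fun p : ℝ × (Fin N → ℝ) =>
        ∑ j : Fin N, (fderiv ℝ f (Fin.cons p.1 p.2) (Pi.single j.succ 1)) ^ 2)
        (ν.prod (Measure.pi fun _ : Fin N => ν)) :=
      integrable_finsetSum _ fun j _ =>
        integrable_of_mem_Icc (((hP j.succ).comp hcc).pow 2).aestronglyMeasurable fun p => hsq _ _
    have b1 : ∀ y : Fin N → ℝ, entropyFun ν (fun t => f (Fin.cons t y) ^ 2) ≤
        C * ∫ t, (fderiv ℝ f (Fin.cons t y) (Pi.single 0 1)) ^ 2 ∂ν := by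
      intro y
      have hcd : ContDiff ℝ (⊤ : ℕ∞) fun t : ℝ => (Fin.cons t y : Fin (N + 1) → ℝ) := by
        rw [contDiff_pi]
        refine Fin.cases ?_ fun j => ?_
        · simpa using! contDiff_id
        · simpa using contDiff_const
      have hder : ∀ t, deriv (fun t : ℝ => f (Fin.cons t y)) t =
          fderiv ℝ f (Fin.cons t y) (Pi.single 0 1) := fun t =>
        ((hdf (Fin.cons t y)).hasFDerivAt.comp_hasDerivAt t (hasDerivAt_fin_cons t y)).deriv
      have := hν.entropyOf_sq_le (f := fun t => f (Fin.cons t y)) (B := B) (D := D) (hf.comp hcd)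
        (fun t => by
          rw [abs_of_nonneg (ha.le.trans (hfb _).1)]; exact (hfb _).2)
        (fun t => by rw [hder]; exact hD _ _)
      simp only [hder, sq_abs] at this
      exact this
    have b2 : ∀ t : ℝ, entropyFun (Measure.pi fun _ => ν) (fun y : Fin N → ℝ =>
        f (Fin.cons t y) ^ 2) ≤
        C * ∫ y, ∑ j : Fin N, (fderiv ℝ f (Fin.cons t y) (Pi.single j.succ 1)) ^ 2
          ∂(Measure.pi fun _ => ν) := by
      intro t
      have hcd : ContDiff ℝ (⊤ : ℕ∞) fun y : Fin N → ℝ => (Fin.cons t y : Fin (N + 1) → ℝ) := by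
        rw [contDiff_pi]
        refine Fin.cases ?_ fun j => ?_
        · simpa using contDiff_const
        · simpa using contDiff_apply ℝ ℝ j
      have := ih (fun y => f (Fin.cons t y)) a B D (hf.comp hcd) ha (fun y => hfb _)
        (fun y j => by rw [hasFDerivAt_comp_fin_cons hdf]; exact hD _ _)
      simpa only [hasFDerivAt_comp_fin_cons hdf] using this
    have hgc : Continuous fun x => ∑ i, (fderiv ℝ f x (Pi.single i 1)) ^ 2 :=
      continuous_finsetSum _ fun i _ => (hP i).pow 2
    rw [e0, integral_pi_fin_succ_eq_prod hgc]
    refine (entropyFun_prod_le (pow_pos ha 2) hg.stronglyMeasurable hgb).trans ?_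
    have c1 := integral_mono (integrable_entropyFun_prod (μ := ν)
      (ν := Measure.pi fun _ : Fin N => ν) (pow_pos ha 2) hg.stronglyMeasurable hgb)
      (hi0.integral_prod_right.const_mul C) b1
    have c2 := integral_mono (integrable_entropyFun_prod (ν := ν)
      (μ := Measure.pi fun _ : Fin N => ν) (g := fun p => f (Fin.cons p.2 p.1) ^ 2)
      (pow_pos ha 2) (hg.comp continuous_swap).stronglyMeasurable fun p => hgb p.swap)
      (hi1.integral_prod_left.const_mul C) b2
    rw [integral_const_mul, ← integral_prod_symm _ hi0] at c1
    rw [integral_const_mul, ← integral_prod _ hi1] at c2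
    simp only [Fin.sum_univ_succ]
    rw [integral_add hi0 hi1, mul_add]
    exact add_le_add c1 c2

/-- Along the gradient direction `F` grows at rate `S = |∇F|^2`, whereas the Lipschitz bound allows
at most `L √S`. The norm of `Fin N → ℝ` is the sup norm, so the Euclidean gradient is handled by
hand. -/
theorem sum_sq_fderiv_le {N : ℕ} {F : (Fin N → ℝ) → ℝ} (hF : Differentiable ℝ F) {L : ℝ}
    (hL : 0 ≤ L) (hLip : ∀ x y, |F x - F y| ≤ L * √(∑ i, (x i - y i) ^ 2)) (x : Fin N → ℝ) :
    ∑ i, (fderiv ℝ F x (Pi.single i 1)) ^ 2 ≤ L ^ 2 := by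
  set v : Fin N → ℝ := fun i => fderiv ℝ F x (Pi.single i 1) with hv
  set S := ∑ i, v i ^ 2 with hS
  have hS0 : 0 ≤ S := Finset.sum_nonneg fun i _ => sq_nonneg _
  have hdir : fderiv ℝ F x v = S := by
    have : v = ∑ i, v i • (Pi.single i (1 : ℝ) : Fin N → ℝ) := by
      ext j
      simp [Finset.sum_apply, Pi.single_apply]
    conv_lhs => rw [this]
    rw [map_sum, hS]
    refine Finset.sum_congr rfl fun i _ => ?_
    rw [map_smul, smul_eq_mul, sq]
  have hd : HasDerivAt (fun s : ℝ => F (x + s • v)) S 0 := by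
    have h1 : HasDerivAt (fun s : ℝ => x + s • v) v 0 := by
      simpa using ((hasDerivAt_id (0 : ℝ)).smul_const v).const_add x
    have h2 : HasFDerivAt F (fderiv ℝ F x) (x + (0 : ℝ) • v) := by
      simpa using (hF x).hasFDerivAt
    have := h2.comp_hasDerivAt 0 h1
    rwa [hdir] at this
  have hlip : LipschitzWith (Real.toNNReal (L * √S)) (fun s : ℝ => F (x + s • v)) := by
    refine LipschitzWith.of_dist_le_mul fun s s' => ?_
    rw [Real.coe_toNNReal _ (by positivity), Real.dist_eq, Real.dist_eq]
    refine (hLip _ _).trans (le_of_eq ?_)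
    have : ∑ i, ((x + s • v) i - (x + s' • v) i) ^ 2 = (s - s') ^ 2 * S := by
      rw [hS, Finset.mul_sum]
      refine Finset.sum_congr rfl fun i _ => ?_
      simp only [Pi.add_apply, Pi.smul_apply, smul_eq_mul]
      ring
    rw [this, Real.sqrt_mul (sq_nonneg _), Real.sqrt_sq_eq_abs]
    ring
  have h := norm_deriv_le_of_lipschitz (x₀ := 0) hlip
  rw [hd.deriv, Real.coe_toNNReal _ (by positivity), Real.norm_of_nonneg hS0] at h
  have h2 : √S ≤ L := by
    by_contra hcon
    push Not at hcon
    have h3 : 0 < √S := hL.trans_lt hcon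
    have h4 : S = √S * √S := (Real.mul_self_sqrt hS0).symm
    nlinarith
  calc S = √S ^ 2 := (Real.sq_sqrt hS0).symm
    _ ≤ L ^ 2 := pow_le_pow_left₀ (Real.sqrt_nonneg _) h2 2

open Filter Topology in
/-- The Herbst argument: a differential inequality for the log-Laplace transform. -/
theorem cgf_le_of_mul_deriv_sub_le {Ω : Type*} [MeasurableSpace Ω] {μ : Measure Ω}
    [IsProbabilityMeasure μ] {X : Ω → ℝ} (hX : ∀ t, Integrable (fun ω => Real.exp (t * X ω)) μ)
    {K : ℝ} (h : ∀ t, 0 < t → t * deriv (cgf X μ) t - cgf X μ t ≤ K * t ^ 2) {t : ℝ} (ht : 0 < t) :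
    cgf X μ t ≤ t * μ[X] + K * t ^ 2 := by
  have huniv : integrableExpSet X μ = Set.univ := by
    ext t; simpa [integrableExpSet] using hX t
  have hint : ∀ t, t ∈ interior (integrableExpSet X μ) := fun t => by rw [huniv]; simp
  have hdiff : ∀ t, HasDerivAt (cgf X μ) (deriv (cgf X μ) t) t := by
    intro t
    have h1 : DifferentiableAt ℝ (mgf X μ) t := (hasDerivAt_mgf (hint t)).differentiableAt
    have h2 : DifferentiableAt ℝ (cgf X μ) t :=
      h1.log (mgf_pos (hX t)).ne'
    exact h2.hasDerivAt
  -- The hypothesis says exactly that `φ' ≤ 0` on `(0, ∞)`, and `φ` tends at `0⁺` to the derivative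
  -- of the cumulant generating function, which is the mean.
  set φ : ℝ → ℝ := fun s => cgf X μ s / s - K * s with hφ
  have hφd : ∀ s, 0 < s → HasDerivAt φ ((deriv (cgf X μ) s * s - cgf X μ s * 1) / s ^ 2 - K * 1) s :=
    fun s hs => ((hdiff s).div (hasDerivAt_id s) hs.ne').sub ((hasDerivAt_id s).const_mul K)
  have hanti : AntitoneOn φ (Set.Ioi 0) := by
    refine antitoneOn_of_deriv_nonpos (convex_Ioi 0)
      (fun s hs => (hφd s hs).continuousAt.continuousWithinAt)
      (fun s hs => ?_) (fun s hs => ?_)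
    · rw [interior_Ioi] at hs
      exact (hφd s hs).differentiableAt.differentiableWithinAt
    · rw [interior_Ioi] at hs
      have hs' : 0 < s := hs
      rw [(hφd s hs).deriv, mul_one, mul_one, sub_nonpos, div_le_iff₀ (by positivity)]
      linarith [h s hs, mul_comm s (deriv (cgf X μ) s)]
  have hlim : Tendsto φ (𝓝[>] 0) (𝓝 (μ[X])) := by
    have h1 : deriv (cgf X μ) 0 = μ[X] := by simp [deriv_cgf_zero (hint 0)]
    have h2 := hdiff 0
    rw [h1, hasDerivAt_iff_tendsto_slope] at h2
    have h3 := h2.mono_left (nhdsWithin_mono (0 : ℝ) (fun s (hs : 0 < s) => hs.ne') :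
      𝓝[>] (0 : ℝ) ≤ 𝓝[≠] 0)
    have h4 : Tendsto (fun s : ℝ => K * s) (𝓝[>] 0) (𝓝 (K * 0)) :=
      (tendsto_nhdsWithin_of_tendsto_nhds tendsto_id).const_mul K
    have h5 := h3.sub h4
    rw [mul_zero, sub_zero] at h5
    refine h5.congr fun s => ?_
    simp [hφ, slope_def_field]
  have hle : φ t ≤ μ[X] := by
    refine ge_of_tendsto hlim ?_
    filter_upwards [Ioo_mem_nhdsGT ht] with s hs
    exact hanti hs.1 ht hs.2.le
  simp only [hφ] at hle
  rw [sub_le_iff_le_add, div_le_iff₀ ht] at hle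
  linarith

/-- Herbst's bound for bounded smooth Lipschitz functions. -/
theorem SatisfiesLogSobolev.integral_exp_le_of_contDiff {C : ℝ} (hC : 0 ≤ C)
    (hν : SatisfiesLogSobolev ν C) {N : ℕ} {F : (Fin N → ℝ) → ℝ} (hF : ContDiff ℝ (⊤ : ℕ∞) F)
    {R : ℝ} (hR : ∀ x, |F x| ≤ R) {L : ℝ} (hL : 0 ≤ L)
    (hLip : ∀ x y, |F x - F y| ≤ L * √(∑ i, (x i - y i) ^ 2)) {lam : ℝ} (hlam : 0 < lam) :
    ∫ x, Real.exp (lam * F x) ∂(Measure.pi fun _ => ν) ≤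
      Real.exp (lam * ∫ x, F x ∂(Measure.pi fun _ => ν) + C * L ^ 2 / 4 * lam ^ 2) := by
  set μ : Measure (Fin N → ℝ) := Measure.pi fun _ => ν with hμ
  have hdF : Differentiable ℝ F := hF.differentiable (by simp)
  have hgrad := sum_sq_fderiv_le hdF hL hLip
  have hX : ∀ t, Integrable (fun x => Real.exp (t * F x)) μ := fun t => by
    refine integrable_of_mem_Icc (a := 0) (B := Real.exp (|t| * R))
      (Real.continuous_exp.comp (continuous_const.mul hF.continuous)).aestronglyMeasurable
      fun x => ⟨Real.exp_nonneg _, Real.exp_le_exp.2 ?_⟩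
    refine (le_abs_self _).trans ?_
    rw [abs_mul]
    exact mul_le_mul_of_nonneg_left (hR x) (abs_nonneg _)
  have hkey : ∀ t, 0 < t → t * deriv (cgf F μ) t - cgf F μ t ≤ C * L ^ 2 / 4 * t ^ 2 := by
    intro t ht
    have huniv : integrableExpSet F μ = Set.univ := by
      ext t; simpa [integrableExpSet] using hX t
    rw [deriv_cgf (by rw [huniv]; simp)]
    -- With `f^2 = exp (t F)` one has `|∇f|^2 = (t^2 / 4) f^2 |∇F|^2`, and the entropy of `f^2` is
    -- `t` times the derivative of the moment generating function minus its `x log x`.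
    set f : (Fin N → ℝ) → ℝ := fun x => Real.exp (t / 2 * F x) with hf
    have hfs : ContDiff ℝ (⊤ : ℕ∞) f := Real.contDiff_exp.comp (contDiff_const.mul hF)
    have hfsq : ∀ x, f x ^ 2 = Real.exp (t * F x) := fun x => by
      rw [hf, ← Real.exp_nat_mul]; congr 1; push_cast; ring
    have hR0 : 0 ≤ R := (abs_nonneg _).trans (hR 0)
    have hfd : ∀ x i, fderiv ℝ f x (Pi.single i 1) =
        f x * (t / 2 * fderiv ℝ F x (Pi.single i 1)) := by
      intro x i
      have h1 : HasFDerivAt f _ x := ((hdF x).hasFDerivAt.const_mul (t / 2)).exp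
      rw [h1.fderiv]
      simp [hf]
    have hfb : ∀ x, f x ∈ Set.Icc (Real.exp (-(t / 2 * R))) (Real.exp (t / 2 * R)) := by
      intro x
      have h1 := abs_le.1 (hR x)
      constructor
      · refine Real.exp_le_exp.2 ?_
        nlinarith
      · refine Real.exp_le_exp.2 ?_
        nlinarith
    have hsingle : ∀ x i, (fderiv ℝ F x (Pi.single i 1)) ^ 2 ≤ L ^ 2 := fun x i =>
      (Finset.single_le_sum (f := fun i => (fderiv ℝ F x (Pi.single i 1)) ^ 2)
        (fun i _ => sq_nonneg _) (Finset.mem_univ i)).trans (hgrad x)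
    have hD : ∀ x i, |fderiv ℝ f x (Pi.single i 1)| ≤ Real.exp (t / 2 * R) * (t / 2 * L) := by
      intro x i
      rw [hfd, abs_mul, abs_mul, abs_of_pos (Real.exp_pos _), abs_of_pos (by positivity : 0 < t / 2)]
      refine mul_le_mul (hfb x).2 ?_ (by positivity) (Real.exp_nonneg _)
      exact mul_le_mul_of_nonneg_left (abs_le_of_sq_le_sq (hsingle x i) hL) (by positivity)
    have hent := hν.entropyFun_pi_le N f _ _ _ hfs (Real.exp_pos _) hfb hD
    have hgr : ∫ x, ∑ i, (fderiv ℝ f x (Pi.single i 1)) ^ 2 ∂μ ≤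
        ∫ x, t ^ 2 / 4 * L ^ 2 * Real.exp (t * F x) ∂μ := by
      refine integral_mono_of_nonneg (ae_of_all _ fun x => Finset.sum_nonneg fun i _ => sq_nonneg _)
        ((hX t).const_mul _) (ae_of_all _ fun x => ?_)
      simp only [hfd, mul_pow, ← Finset.mul_sum, hfsq]
      have h1 := mul_le_mul_of_nonneg_left (hgrad x)
        (by positivity : 0 ≤ Real.exp (t * F x) * (t / 2) ^ 2)
      linarith
    rw [integral_const_mul] at hgr
    have hent2 := hent.trans (mul_le_mul_of_nonneg_left hgr hC)
    unfold entropyFun at hent2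
    simp only [hfsq, Real.log_exp] at hent2
    have hpos : 0 < mgf F μ t := mgf_pos (hX t)
    have e1 : ∫ x, Real.exp (t * F x) * (t * F x) ∂μ = t * ∫ x, F x * Real.exp (t * F x) ∂μ := by
      rw [← integral_const_mul]
      refine integral_congr_ae (ae_of_all _ fun x => ?_)
      simp only
      ring
    rw [e1] at hent2
    change t * _ - mgf F μ t * Real.log (mgf F μ t) ≤ C * (t ^ 2 / 4 * L ^ 2 * mgf F μ t) at hent2
    rw [cgf, ← mul_div_assoc, div_sub' hpos.ne', div_le_iff₀ hpos]
    linarith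
  have := cgf_le_of_mul_deriv_sub_le hX hkey hlam
  rw [cgf, ← Real.exp_le_exp, Real.exp_log (mgf_pos (hX lam))] at this
  exact this

end

section

variable {ν : Measure ℝ} [IsProbabilityMeasure ν]

theorem sqrt_sum_sq_le_mul_dist {ι : Type*} [Fintype ι] (x y : ι → ℝ) :
    √(∑ i, (x i - y i) ^ 2) ≤ √(Fintype.card ι) * dist x y := by
  rw [← Real.sqrt_sq (dist_nonneg (x := x) (y := y)), ← Real.sqrt_mul (Nat.cast_nonneg _)]
  refine Real.sqrt_le_sqrt ?_
  calc ∑ i, (x i - y i) ^ 2 ≤ ∑ _i : ι, dist x y ^ 2 := by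
        refine Finset.sum_le_sum fun i _ => ?_
        rw [← sq_abs, ← Real.dist_eq]
        exact pow_le_pow_left₀ dist_nonneg (dist_le_pi_dist x y i) 2
    _ = Fintype.card ι * dist x y ^ 2 := by simp

theorem lipschitzWith_of_l2 {ι : Type*} [Fintype ι] {F : (ι → ℝ) → ℝ} {L : ℝ} (hL : 0 ≤ L)
    (hLip : ∀ x y, |F x - F y| ≤ L * √(∑ i, (x i - y i) ^ 2)) :
    LipschitzWith (Real.toNNReal (L * √(Fintype.card ι))) F := by
  refine LipschitzWith.of_dist_le_mul fun x y => ?_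
  rw [Real.coe_toNNReal _ (by positivity), Real.dist_eq, mul_assoc]
  exact (hLip x y).trans (mul_le_mul_of_nonneg_left (sqrt_sum_sq_le_mul_dist x y) hL)

/-- Mollification of bounded Lipschitz functions. -/
theorem exists_contDiff_approx {N : ℕ} {F : (Fin N → ℝ) → ℝ} {L R : ℝ} (hL : 0 ≤ L)
    (hLip : ∀ x y, |F x - F y| ≤ L * √(∑ i, (x i - y i) ^ 2)) (hR : ∀ x, |F x| ≤ R)
    {δ : ℝ} (hδ : 0 < δ) :
    ∃ G : (Fin N → ℝ) → ℝ, ContDiff ℝ (⊤ : ℕ∞) G ∧ (∀ x, |G x| ≤ R) ∧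
      (∀ x y, |G x - G y| ≤ L * √(∑ i, (x i - y i) ^ 2)) ∧ ∀ x, |G x - F x| ≤ δ := by
  have hFL := lipschitzWith_of_l2 hL hLip
  have hFc : Continuous F := hFL.continuous
  set K := L * √(Fintype.card (Fin N)) with hK
  have hK0 : 0 ≤ K := by positivity
  -- The mollification radius: `F` varies by at most `K ρ ≤ δ` over it. The `+ 1` allows `K = 0`.
  set ρ := δ / (K + 1) with hρ
  have hρ0 : 0 < ρ := by positivity
  let φ : ContDiffBump (0 : Fin N → ℝ) := ⟨ρ / 2, ρ, by positivity, by linarith⟩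
  set w := φ.normed volume with hw
  have hwi : Integrable w := φ.integrable_normed
  have hw1 : ∫ t, w t = 1 := φ.integral_normed
  have hw0 : ∀ t, 0 ≤ w t := φ.nonneg_normed
  have hint : ∀ x, Integrable fun t => w t * F (x - t) := fun x =>
    hwi.mul_bdd (c := R) (hFc.comp (by fun_prop)).aestronglyMeasurable
      (ae_of_all _ fun t => hR _)
  set G := convolution w F (ContinuousLinearMap.lsmul ℝ ℝ) volume with hG
  have hGx : ∀ x, G x = ∫ t, w t * F (x - t) := fun x => rfl
  refine ⟨G, ?_, fun x => ?_, fun x y => ?_, fun x => ?_⟩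
  · exact φ.hasCompactSupport_normed.contDiff_convolution_left
      (ContinuousLinearMap.lsmul ℝ ℝ) φ.contDiff_normed
      hFc.locallyIntegrable
  · rw [hGx, ← Real.norm_eq_abs]
    refine (norm_integral_le_of_norm_le (hwi.mul_const R) (ae_of_all _ fun t => ?_)).trans ?_
    · rw [norm_mul, Real.norm_of_nonneg (hw0 t)]
      exact mul_le_mul_of_nonneg_left (hR _) (hw0 t)
    · rw [integral_mul_const, hw1, one_mul]
  · rw [hGx, hGx, ← integral_sub (hint x) (hint y), ← Real.norm_eq_abs]
    refine (norm_integral_le_of_norm_le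
      (hwi.mul_const (L * √(∑ i, (x i - y i) ^ 2))) (ae_of_all _ fun t => ?_)).trans ?_
    · rw [← mul_sub, norm_mul, Real.norm_of_nonneg (hw0 t)]
      refine mul_le_mul_of_nonneg_left ?_ (hw0 t)
      simpa using hLip (x - t) (y - t)
    · rw [integral_mul_const, hw1, one_mul]
  · refine φ.dist_normed_convolution_le (μ := volume) hFc.aestronglyMeasurable fun y hy => ?_
    refine (hFL.dist_le_mul y x).trans ?_
    rw [Real.coe_toNNReal _ hK0]
    have h1 : dist y x < ρ := hy
    calc K * dist y x ≤ (K + 1) * ρ :=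
          mul_le_mul (by linarith) h1.le dist_nonneg (by positivity)
      _ = δ := by rw [hρ]; field_simp

/-- Removes smoothness: a mollification within `ε / (2 lam)` of `F` changes the exponent by `ε / 2`
in the integral and by `ε / 2` through the mean, with `ε` arbitrary. -/
theorem SatisfiesLogSobolev.integral_exp_le_of_bounded {C : ℝ} (hC : 0 ≤ C)
    (hν : SatisfiesLogSobolev ν C) {N : ℕ} {F : (Fin N → ℝ) → ℝ}
    {R : ℝ} (hR : ∀ x, |F x| ≤ R) {L : ℝ} (hL : 0 ≤ L)
    (hLip : ∀ x y, |F x - F y| ≤ L * √(∑ i, (x i - y i) ^ 2)) {lam : ℝ} (hlam : 0 < lam) :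
    ∫ x, Real.exp (lam * F x) ∂(Measure.pi fun _ => ν) ≤
      Real.exp (lam * ∫ x, F x ∂(Measure.pi fun _ => ν) + C * L ^ 2 / 4 * lam ^ 2) := by
  have hcont : ∀ G : (Fin N → ℝ) → ℝ, Continuous G → (∀ x, |G x| ≤ R) →
      Integrable (fun x => Real.exp (lam * G x)) (Measure.pi fun _ => ν) ∧
      Integrable G (Measure.pi fun _ => ν) := by
    intro G hG hGR
    constructor
    · refine integrable_of_mem_Icc (a := 0) (B := Real.exp (lam * R))
        (by fun_prop) fun x => ⟨Real.exp_nonneg _, Real.exp_le_exp.2 ?_⟩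
      exact mul_le_mul_of_nonneg_left ((le_abs_self _).trans (hGR x)) hlam.le
    · exact integrable_of_mem_Icc hG.aestronglyMeasurable fun x => abs_le.1 (hGR x)
  have hFc : Continuous F := (lipschitzWith_of_l2 hL hLip).continuous
  obtain ⟨i1, i2⟩ := hcont F hFc hR
  rw [← Real.log_le_iff_le_exp (integral_exp_pos i1)]
  refine le_of_forall_pos_le_add fun ε hε => ?_
  obtain ⟨G, hG, hGR, hGL, hGF⟩ := exists_contDiff_approx hL hLip hR
    (δ := ε / (2 * lam)) (by positivity)
  obtain ⟨j1, j2⟩ := hcont G hG.continuous hGR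
  have h1 := hν.integral_exp_le_of_contDiff hC hG hGR hL hGL hlam
  have h2 : ∫ x, G x ∂(Measure.pi fun _ => ν) ≤ ∫ x, F x ∂(Measure.pi fun _ => ν)
      + ε / (2 * lam) := by
    have := integral_mono j2 (i2.add (integrable_const (ε / (2 * lam)))) fun x => by
      have := (abs_le.1 (hGF x)).2
      change G x ≤ F x + ε / (2 * lam)
      linarith
    rwa [integral_add' i2 (integrable_const _), integral_const, probReal_univ, one_smul] at this
  have h3 : ∫ x, Real.exp (lam * F x) ∂(Measure.pi fun _ => ν) ≤
      ∫ x, Real.exp (lam * G x) * Real.exp (ε / 2) ∂(Measure.pi fun _ => ν) := by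
    refine integral_mono i1 (j1.mul_const _) fun x => ?_
    simp only [← Real.exp_add]
    refine Real.exp_le_exp.2 ?_
    have := (abs_le.1 (hGF x)).1
    have h4 : lam * (F x) ≤ lam * (G x + ε / (2 * lam)) :=
      mul_le_mul_of_nonneg_left (by linarith) hlam.le
    have h5 : lam * (ε / (2 * lam)) = ε / 2 := by field_simp
    linarith
  rw [Real.log_le_iff_le_exp (integral_exp_pos i1)]
  rw [integral_mul_const] at h3
  refine (h3.trans (mul_le_mul_of_nonneg_right h1 (Real.exp_nonneg _))).trans ?_
  rw [← Real.exp_add]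
  refine Real.exp_le_exp.2 ?_
  have h5 : lam * (ε / (2 * lam)) = ε / 2 := by field_simp
  have h6 := mul_le_mul_of_nonneg_left h2 hlam.le
  linarith

theorem integrable_of_l2_lipschitz (h2 : MemLp (fun x : ℝ => x) 2 ν) {ι : Type*} [Fintype ι]
    {F : (ι → ℝ) → ℝ} {L : ℝ} (hL : 0 ≤ L)
    (hLip : ∀ x y, |F x - F y| ≤ L * √(∑ i, (x i - y i) ^ 2)) :
    Integrable F (Measure.pi fun _ => ν) := by
  have hFc : Continuous F := (lipschitzWith_of_l2 hL hLip).continuous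
  have hi : ∀ i, Integrable (fun x : ι → ℝ => |x i|) (Measure.pi fun _ => ν) := fun i => by
    have h1 : Integrable (fun x : ℝ => |x|) ν := (h2.integrable one_le_two).abs
    exact (measurePreserving_eval (fun _ : ι => ν) i).integrable_comp_of_integrable h1
  have hs : Integrable (fun x : ι → ℝ => |F 0| + L * ∑ i, |x i|) (Measure.pi fun _ => ν) :=
    (integrable_const _).add ((integrable_finsetSum _ fun i _ => hi i).const_mul L)
  refine hs.mono' hFc.aestronglyMeasurable (ae_of_all _ fun x => ?_)
  have h3 := hLip x 0
  have h4 : √(∑ i, (x i - (0 : ι → ℝ) i) ^ 2) ≤ ∑ i, |x i| := by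
    simp only [Pi.zero_apply, sub_zero]
    rw [Real.sqrt_le_left (Finset.sum_nonneg fun i _ => abs_nonneg _)]
    simp_rw [← sq_abs (x _)]
    exact Finset.sum_sq_le_sq_sum_of_nonneg fun i _ => abs_nonneg _
  rw [Real.norm_eq_abs]
  have h5 := mul_le_mul_of_nonneg_left h4 hL
  have h6 := abs_sub_abs_le_abs_sub (F x) (F 0)
  linarith

open Filter Topology in
-- Removes boundedness: truncating `F` at height `k` keeps the Lipschitz constant, and Fatou's lemma
-- gives integrability of the exponential together with the bound.
theorem SatisfiesLogSobolev.integral_exp_sub_integral_le_of_pos {C : ℝ} (hC : 0 ≤ C)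
    (hν : SatisfiesLogSobolev ν C) (h2 : MemLp (fun x : ℝ => x) 2 ν) {N : ℕ}
    {F : (Fin N → ℝ) → ℝ} {L : ℝ} (hL : 0 ≤ L)
    (hLip : ∀ x y, |F x - F y| ≤ L * √(∑ i, (x i - y i) ^ 2)) {lam : ℝ} (hlam : 0 < lam) :
    Integrable (fun x => Real.exp (lam * F x)) (Measure.pi fun _ => ν) ∧
    ∫ x, Real.exp (lam * (F x - ∫ y, F y ∂(Measure.pi fun _ => ν))) ∂(Measure.pi fun _ => ν) ≤
      Real.exp (C / 4 * lam ^ 2 * L ^ 2) := by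
  set μ : Measure (Fin N → ℝ) := Measure.pi fun _ => ν with hμ
  have hFc : Continuous F := (lipschitzWith_of_l2 hL hLip).continuous
  have hFi : Integrable F μ := integrable_of_l2_lipschitz h2 hL hLip
  set T : ℕ → (Fin N → ℝ) → ℝ := fun k x => max (min (F x) k) (-k) with hT
  have hTc : ∀ k, Continuous (T k) := fun k => by fun_prop
  have hTR : ∀ k x, |T k x| ≤ k := fun k x => by
    have hk : (0 : ℝ) ≤ k := Nat.cast_nonneg k
    exact abs_le.2 ⟨le_max_right _ _, max_le (min_le_right _ _) (by linarith)⟩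
  have hTL : ∀ k x y, |T k x - T k y| ≤ L * √(∑ i, (x i - y i) ^ 2) := fun k x y => by
    refine le_trans ?_ (hLip x y)
    refine (abs_max_sub_max_le_abs _ _ _).trans ?_
    have h1 := abs_min_sub_min_le_max (F x) k (F y) k
    simpa using h1
  have hTF : ∀ k x, |T k x| ≤ |F x| := fun k x => by
    have hk : (0 : ℝ) ≤ k := Nat.cast_nonneg k
    rcases le_total 0 (F x) with h | h
    · have h1 : T k x = min (F x) k := max_eq_left ((neg_nonpos.2 hk).trans (le_min h hk))
      rw [h1, abs_of_nonneg (le_min h hk), abs_of_nonneg h]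
      exact min_le_left _ _
    · have h1 : T k x = max (F x) (-k) := by
        simp only [hT]; rw [min_eq_left (h.trans hk)]
      rw [h1, abs_of_nonpos (max_le h (by linarith)), abs_of_nonpos h]
      exact neg_le_neg (le_max_left _ _)
  have hTt : ∀ x, Tendsto (fun k => T k x) atTop (𝓝 (F x)) := by
    intro x
    obtain ⟨m, hm⟩ := exists_nat_ge |F x|
    refine tendsto_const_nhds.congr' ?_
    filter_upwards [eventually_ge_atTop m] with k hk
    have hk' : (m : ℝ) ≤ k := Nat.cast_le.2 hk
    have := abs_le.1 (hm.trans hk')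
    simp only [hT]
    rw [min_eq_left this.2, max_eq_left this.1]
  have hTm : Tendsto (fun k => ∫ x, T k x ∂μ) atTop (𝓝 (∫ x, F x ∂μ)) :=
    tendsto_integral_of_dominated_convergence (fun x => |F x|)
      (fun k => (hTc k).aestronglyMeasurable) hFi.abs (fun k => ae_of_all _ (hTF k))
      (ae_of_all _ hTt)
  set m := ∫ x, F x ∂μ with hm
  set B := Real.exp (C / 4 * lam ^ 2 * L ^ 2) with hB
  have hTi : ∀ k, Integrable (fun x => Real.exp (lam * (T k x - ∫ x, T k x ∂μ))) μ := fun k => by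
    refine integrable_of_mem_Icc (a := 0) (B := Real.exp (lam * (k - ∫ x, T k x ∂μ)))
      (by have := hTc k; fun_prop) fun x => ⟨Real.exp_nonneg _, Real.exp_le_exp.2 ?_⟩
    exact mul_le_mul_of_nonneg_left (sub_le_sub_right ((le_abs_self _).trans (hTR k x)) _) hlam.le
  have hTb : ∀ k, ∫ x, Real.exp (lam * (T k x - ∫ x, T k x ∂μ)) ∂μ ≤ B := by
    intro k
    have h1 := hν.integral_exp_le_of_bounded hC (hTR k) hL (hTL k) hlam
    simp_rw [mul_sub, Real.exp_sub]
    rw [integral_div, div_le_iff₀ (Real.exp_pos _), hB, ← Real.exp_add]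
    refine h1.trans (Real.exp_le_exp.2 (le_of_eq ?_))
    ring
  have hlin : ∫⁻ x, ENNReal.ofReal (Real.exp (lam * (F x - m))) ∂μ ≤ ENNReal.ofReal B := by
    have hlim : ∀ x, liminf (fun k => ENNReal.ofReal
        (Real.exp (lam * (T k x - ∫ x, T k x ∂μ)))) atTop =
        ENNReal.ofReal (Real.exp (lam * (F x - m))) := fun x => by
      refine Tendsto.liminf_eq ?_
      refine (ENNReal.continuous_ofReal.tendsto _).comp ?_
      exact (Real.continuous_exp.tendsto _).comp (((hTt x).sub hTm).const_mul lam)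
    simp_rw [← hlim]
    refine (lintegral_liminf_le fun k => ?_).trans ?_
    · have := hTc k
      exact (ENNReal.continuous_ofReal.comp (by fun_prop : Continuous fun x =>
        Real.exp (lam * (T k x - ∫ x, T k x ∂μ)))).measurable
    · refine liminf_le_of_frequently_le' (Frequently.of_forall fun k => ?_)
      rw [← ofReal_integral_eq_lintegral_ofReal (hTi k) (ae_of_all _ fun x => Real.exp_nonneg _)]
      exact ENNReal.ofReal_le_ofReal (hTb k)
  have hcE : Continuous fun x => Real.exp (lam * (F x - m)) := by fun_prop
  have hi : Integrable (fun x => Real.exp (lam * (F x - m))) μ := by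
    refine ⟨hcE.aestronglyMeasurable, ?_⟩
    rw [hasFiniteIntegral_iff_ofReal (ae_of_all _ fun x => Real.exp_nonneg _)]
    exact hlin.trans_lt ENNReal.ofReal_lt_top
  constructor
  · have h3 : (fun x => Real.exp (lam * F x)) =
        fun x => Real.exp (lam * (F x - m)) * Real.exp (lam * m) := by
      ext x
      rw [← Real.exp_add]
      congr 1
      ring
    rw [h3]
    exact hi.mul_const _
  · rw [← ENNReal.ofReal_le_ofReal_iff (Real.exp_nonneg _),
      ofReal_integral_eq_lintegral_ofReal hi (ae_of_all _ fun x => Real.exp_nonneg _)]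
    exact hlin

theorem SatisfiesLogSobolev.integral_exp_sub_integral_le {C : ℝ} (hC : 0 ≤ C)
    (hν : SatisfiesLogSobolev ν C) (h2 : MemLp (fun x : ℝ => x) 2 ν) {N : ℕ}
    {F : (Fin N → ℝ) → ℝ} {L : ℝ} (hL : 0 ≤ L)
    (hLip : ∀ x y, |F x - F y| ≤ L * √(∑ i, (x i - y i) ^ 2)) (lam : ℝ) :
    Integrable (fun x => Real.exp (lam * F x)) (Measure.pi fun _ => ν) ∧
    ∫ x, Real.exp (lam * (F x - ∫ y, F y ∂(Measure.pi fun _ => ν))) ∂(Measure.pi fun _ => ν) ≤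
      Real.exp (C / 4 * lam ^ 2 * L ^ 2) := by
  rcases lt_trichotomy lam 0 with h | h | h
  · have hLip' : ∀ x y, |(-F x) - (-F y)| ≤ L * √(∑ i, (x i - y i) ^ 2) := fun x y => by
      rw [neg_sub_neg, abs_sub_comm]; exact hLip x y
    have := hν.integral_exp_sub_integral_le_of_pos hC h2 hL hLip' (neg_pos.2 h)
    rw [integral_neg, neg_sq] at this
    have e1 : ∀ x m : ℝ, -lam * (-x - -m) = lam * (x - m) := fun x m => by ring
    simp only [e1, neg_mul_neg] at this
    exact this
  · subst h
    simp
  · exact hν.integral_exp_sub_integral_le_of_pos hC h2 hL hLip h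

end

/-! ### The concentration property common to both assumptions on the law. -/

/-- The law `ν` has dimension-free sub-Gaussian concentration for convex Lipschitz functions. -/
def ConvexConcentration (ν : Measure ℝ) (K : ℝ) : Prop :=
  ∀ (ι : Type) [Fintype ι] (F : (ι → ℝ) → ℝ) (L : ℝ), 0 ≤ L → ConvexOn ℝ Set.univ F →
    (∀ x y, |F x - F y| ≤ L * √(∑ i, (x i - y i) ^ 2)) → ∀ lam : ℝ,
    Integrable (fun x => Real.exp (lam * F x)) (Measure.pi fun _ => ν) ∧
    ∫ x, Real.exp (lam * (F x - ∫ y, F y ∂(Measure.pi fun _ => ν))) ∂(Measure.pi fun _ => ν) ≤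
      Real.exp (K * lam ^ 2 * L ^ 2)

theorem convexConcentration_of_fin {ν : Measure ℝ} [IsProbabilityMeasure ν] {K : ℝ}
    (h : ∀ (N : ℕ) (F : (Fin N → ℝ) → ℝ) (L : ℝ), 0 ≤ L → ConvexOn ℝ Set.univ F →
    (∀ x y, |F x - F y| ≤ L * √(∑ i, (x i - y i) ^ 2)) → ∀ lam : ℝ,
    Integrable (fun x => Real.exp (lam * F x)) (Measure.pi fun _ => ν) ∧
    ∫ x, Real.exp (lam * (F x - ∫ y, F y ∂(Measure.pi fun _ => ν))) ∂(Measure.pi fun _ => ν) ≤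
      Real.exp (K * lam ^ 2 * L ^ 2)) : ConvexConcentration ν K := by
  intro ι _ F L hL hF hLip lam
  let e := (Fintype.equivFin ι).symm
  have hmp : MeasurePreserving (MeasurableEquiv.piCongrLeft (fun _ : ι => ℝ) e)
      (Measure.pi fun _ => ν) (Measure.pi fun _ => ν) :=
    measurePreserving_piCongrLeft (α := fun _ : ι => ℝ) (fun _ => ν) e
  have hE : ∀ x : Fin (Fintype.card ι) → ℝ, MeasurableEquiv.piCongrLeft (fun _ : ι => ℝ) e x =
      fun i => x (e.symm i) := by
    intro x
    ext i
    conv_lhs => rw [← e.apply_symm_apply i]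
    exact MeasurableEquiv.piCongrLeft_apply_apply e (β := fun _ : ι => ℝ) x (e.symm i)
  have hcv : ConvexOn ℝ Set.univ fun x : Fin (Fintype.card ι) → ℝ =>
      F (MeasurableEquiv.piCongrLeft (fun _ : ι => ℝ) e x) := by
    refine ⟨convex_univ, fun x _ y _ a b ha hb hab => ?_⟩
    have := hF.2 (Set.mem_univ (fun i => x (e.symm i))) (Set.mem_univ (fun i => y (e.symm i)))
      ha hb hab
    simp only [hE]
    exact this
  have hl : ∀ x y : Fin (Fintype.card ι) → ℝ,
      |F (MeasurableEquiv.piCongrLeft (fun _ : ι => ℝ) e x) -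
        F (MeasurableEquiv.piCongrLeft (fun _ : ι => ℝ) e y)| ≤ L * √(∑ i, (x i - y i) ^ 2) := by
    intro x y
    refine (hLip _ _).trans (le_of_eq ?_)
    simp only [hE]
    rw [Equiv.sum_comp e.symm fun i => (x i - y i) ^ 2]
  obtain ⟨h1, h2⟩ := h _ _ L hL hcv hl lam
  rw [hmp.integral_comp' (g := F),
    hmp.integral_comp' (g := fun z => Real.exp (lam * (F z - ∫ y, F y ∂(Measure.pi fun _ => ν))))]
    at h2
  exact ⟨(hmp.integrable_comp_emb (MeasurableEquiv.measurableEmbedding _)).1 h1, h2⟩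

theorem exists_convexConcentration {C₀ : ℝ} (hC₀ : 0 < C₀) : ∃ K : ℝ, 0 < K ∧
    ∀ (ν : Measure ℝ) [IsProbabilityMeasure ν], MemLp (fun x : ℝ => x) 2 ν →
      ((∀ᵐ x ∂ν, |x| ≤ C₀) ∨ SatisfiesLogSobolev ν C₀) → ConvexConcentration ν K := by
  -- The constants of the two alternatives are added, so that one `K` serves both.
  refine ⟨8 * C₀ ^ 2 + C₀ / 4, by positivity, fun ν _ h2 h => convexConcentration_of_fin ?_⟩
  intro N F L hL hF hLip lam
  rcases h with h | h
  · obtain ⟨h3, h4⟩ := integral_exp_sub_integral_le_of_bounded hC₀ h hF hL hLip lam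
    refine ⟨h3, h4.trans (Real.exp_le_exp.2 ?_)⟩
    have : 0 ≤ C₀ / 4 * (lam ^ 2 * L ^ 2) := by positivity
    linarith
  · obtain ⟨h3, h4⟩ := h.integral_exp_sub_integral_le hC₀.le h2 hL hLip lam
    refine ⟨h3, h4.trans (Real.exp_le_exp.2 ?_)⟩
    have : 0 ≤ 8 * C₀ ^ 2 * (lam ^ 2 * L ^ 2) := by positivity
    linarith

/-! ### Many roots force small values or large derivatives. -/

section RootsAndDerivatives

/-- Iterated Rolle theorem. -/
theorem exists_iteratedDeriv_eq_zero_of_card {u v : ℝ} : ∀ (m : ℕ) (h : ℝ → ℝ) (Z : Finset ℝ),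
    ContDiff ℝ (⊤ : ℕ∞) h → Z.card = m + 1 → (∀ z ∈ Z, z ∈ Set.Icc u v ∧ h z = 0) →
    ∃ ξ ∈ Set.Icc u v, iteratedDeriv m h ξ = 0 := by
  intro m
  induction m with
  | zero =>
    intro h Z _ hcard hZ
    obtain ⟨z, hz⟩ := Finset.card_pos.1 (by omega : 0 < Z.card)
    exact ⟨z, (hZ z hz).1, by simpa using (hZ z hz).2⟩
  | succ m ih =>
    intro h Z hh hcard hZ
    let e := Z.orderEmbOfFin hcard
    have hmem : ∀ i, e i ∈ Z := fun i => Z.orderEmbOfFin_mem hcard i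
    have hlt : ∀ i : Fin (m + 1), e i.castSucc < e i.succ := fun i =>
      e.strictMono Fin.castSucc_lt_succ
    have hex : ∀ i : Fin (m + 1), ∃ c ∈ Set.Ioo (e i.castSucc) (e i.succ), deriv h c = 0 :=
      fun i => exists_deriv_eq_zero (hlt i) hh.continuous.continuousOn
        (by rw [(hZ _ (hmem _)).2, (hZ _ (hmem _)).2])
    choose c hc hc0 using hex
    have hmono : StrictMono c := by
      rw [Fin.strictMono_iff_lt_succ]
      intro i
      calc c i.castSucc < e i.castSucc.succ := (hc _).2
        _ = e i.succ.castSucc := by rw [Fin.succ_castSucc]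
        _ < c i.succ := (hc _).1
    obtain ⟨ξ, hξ, hξ0⟩ := ih (deriv h) (Finset.univ.image c) (contDiff_infty_iff_deriv.1 hh).2
      (by rw [Finset.card_image_of_injective _ hmono.injective]; simp) (by
        intro z hz
        obtain ⟨i, -, rfl⟩ := Finset.mem_image.1 hz
        exact ⟨⟨(hZ _ (hmem _)).1.1.trans (hc i).1.le, (hc i).2.le.trans (hZ _ (hmem _)).1.2⟩,
          hc0 i⟩)
    exact ⟨ξ, hξ, by rw [iteratedDeriv_succ']; exact hξ0⟩

theorem iteratedDeriv_polynomial_eval (p : Polynomial ℝ) (m : ℕ) :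
    iteratedDeriv m (fun x => p.eval x) = fun x => (Polynomial.derivative^[m] p).eval x := by
  induction m generalizing p with
  | zero => simp
  | succ m ih =>
    rw [iteratedDeriv_succ', Function.iterate_succ_apply]
    have : deriv (fun x => p.eval x) = fun x => (Polynomial.derivative p).eval x := by
      ext x; simp
    rw [this, ih]

theorem iteratedDeriv_prod_sub (Z : Finset ℝ) (x : ℝ) :
    iteratedDeriv Z.card (fun t => ∏ z ∈ Z, (t - z)) x = Z.card.factorial := by
  have h1 : (fun t : ℝ => ∏ z ∈ Z, (t - z)) =
      fun t => (∏ z ∈ Z, (Polynomial.X - Polynomial.C z)).eval t := by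
    ext t; simp [Polynomial.eval_prod]
  rw [h1, iteratedDeriv_polynomial_eval, Polynomial.iterate_derivative_prod_X_sub_C le_rfl]
  simp

/-- Lagrange interpolation error at a function with many zeros. -/
theorem abs_le_of_many_zeros {f : ℝ → ℝ} (hf : ContDiff ℝ (⊤ : ℕ∞) f) {u v S : ℝ}
    {Z : Finset ℝ} (hZ : ∀ z ∈ Z, z ∈ Set.Icc u v ∧ f z = 0)
    (hS : ∀ x ∈ Set.Icc u v, |iteratedDeriv Z.card f x| ≤ S) {x : ℝ} (hx : x ∈ Set.Icc u v) :
    |f x| ≤ (v - u) ^ Z.card / Z.card.factorial * S := by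
  have hS0 : 0 ≤ S := (abs_nonneg _).trans (hS x hx)
  have huv : 0 ≤ v - u := by linarith [hx.1, hx.2]
  by_cases hxZ : x ∈ Z
  · rw [(hZ x hxZ).2, abs_zero]
    positivity
  set w : ℝ → ℝ := fun t => ∏ z ∈ Z, (t - z) with hw
  have hwx : w x ≠ 0 := by
    refine Finset.prod_ne_zero_iff.2 fun z hz => sub_ne_zero.2 ?_
    rintro rfl
    exact hxZ hz
  have hws : ContDiff ℝ (⊤ : ℕ∞) w := by
    refine contDiff_prod fun z _ => ?_
    exact contDiff_id.sub contDiff_const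
  -- This `k` makes `f - k w` vanish at `x` besides all of `Z`. Iterated Rolle then gives a zero of
  -- its derivative of order `Z.card`, where the contribution of `w` is a factorial.
  set k := f x / w x with hk
  have hcard : (insert x Z).card = Z.card + 1 := Finset.card_insert_of_notMem hxZ
  obtain ⟨ξ, hξ, hξ0⟩ := exists_iteratedDeriv_eq_zero_of_card Z.card (fun t => f t - k * w t)
    (insert x Z) (hf.sub (contDiff_const.mul hws)) hcard (by
      intro z hz
      rcases Finset.mem_insert.1 hz with rfl | hz
      · exact ⟨hx, by rw [hk]; field_simp; simp⟩
      · refine ⟨(hZ z hz).1, ?_⟩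
        have : w z = 0 := Finset.prod_eq_zero hz (sub_self z)
        simp [this, (hZ z hz).2])
  have h1 : iteratedDeriv Z.card (fun t => f t - k * w t) ξ =
      iteratedDeriv Z.card f ξ - k * Z.card.factorial := by
    rw [iteratedDeriv_fun_sub ((hf.of_le (by exact_mod_cast le_top)).contDiffAt)
      ((contDiff_const.mul (hws.of_le (by exact_mod_cast le_top))).contDiffAt),
      iteratedDeriv_const_mul_field, iteratedDeriv_prod_sub]
  rw [h1, sub_eq_zero] at hξ0
  have h2 : |k| * Z.card.factorial ≤ S := by
    have := hS ξ hξ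
    rwa [hξ0, abs_mul, Nat.abs_cast] at this
  have h3 : |w x| ≤ (v - u) ^ Z.card := by
    rw [hw, Finset.abs_prod, ← Finset.prod_const]
    refine Finset.prod_le_prod (fun _ _ => abs_nonneg _) fun z hz => ?_
    have := (hZ z hz).1
    rw [abs_le]
    constructor <;> linarith [this.1, this.2, hx.1, hx.2]
  have h4 : f x = k * w x := by rw [hk]; field_simp
  have hfac : (0 : ℝ) < Z.card.factorial := by positivity
  rw [h4, abs_mul]
  calc |k| * |w x| ≤ (S / Z.card.factorial) * (v - u) ^ Z.card := by
        refine mul_le_mul ?_ h3 (abs_nonneg _) (by positivity)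
        rwa [le_div_iff₀ hfac]
    _ = _ := by ring

/-- One-dimensional Sobolev inequality on intervals of length at least one. -/
theorem abs_le_integral_abs_add_deriv {g : ℝ → ℝ} (hg : ContDiff ℝ 1 g) {u v : ℝ}
    (huv : 1 ≤ v - u) {x : ℝ} (hx : x ∈ Set.Icc u v) :
    |g x| ≤ ∫ y in u..v, (|g y| + |deriv g y|) := by
  have hgc : Continuous g := hg.continuous
  have hdc : Continuous (deriv g) := hg.continuous_deriv le_rfl
  have hle : u ≤ v := by linarith
  set I := ∫ y in u..v, |deriv g y| with hI
  have hI0 : 0 ≤ I := intervalIntegral.integral_nonneg hle fun _ _ => abs_nonneg _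
  have hA0 : 0 ≤ ∫ y in u..v, |g y| := intervalIntegral.integral_nonneg hle fun _ _ => abs_nonneg _
  rw [intervalIntegral.integral_add (hgc.abs.intervalIntegrable _ _)
    (hdc.abs.intervalIntegrable _ _), ← hI]
  have h1 : ∀ z ∈ Set.Icc u v, |g x| - I ≤ |g z| := by
    intro z hz
    have e1 : ∫ y in z..x, deriv g y = g x - g z :=
      intervalIntegral.integral_deriv_eq_sub (fun y _ => hg.differentiable one_ne_zero y)
        (hdc.intervalIntegrable _ _)
    have e2 : |∫ y in z..x, deriv g y| ≤ I := by
      rw [← Real.norm_eq_abs]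
      refine (intervalIntegral.norm_integral_le_abs_integral_norm).trans ?_
      rw [← abs_of_nonneg hI0, hI]
      refine intervalIntegral.abs_integral_mono_interval ?_ (ae_of_all _ fun _ => norm_nonneg _)
        (hdc.norm.intervalIntegrable _ _)
      exact Set.uIoc_subset_uIoc_of_uIcc_subset_uIcc (by
        rw [Set.uIcc_of_le hle]
        exact Set.uIcc_subset_Icc hz hx)
    rw [e1] at e2
    have := abs_sub_abs_le_abs_sub (g x) (g z)
    linarith
  rcases le_or_gt (|g x| - I) 0 with h | h
  · linarith
  have h2 : ∫ _y in u..v, (|g x| - I) ≤ ∫ y in u..v, |g y| :=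
    intervalIntegral.integral_mono_on hle (by simp) (hgc.abs.intervalIntegrable _ _) h1
  rw [intervalIntegral.integral_const, smul_eq_mul] at h2
  nlinarith

end RootsAndDerivatives

noncomputable section

/-- A weighted sum of the excesses of the derivatives of `f` over the threshold `s`. -/
def derivExcess (M : ℕ) (s : ℝ) (f : ℝ → ℝ) (y : ℝ) : ℝ :=
  ∑ m ∈ Finset.range (M + 1), (1 / 2 : ℝ) ^ m * max (|iteratedDeriv m f y| - s) 0

end

section

variable {f : ℝ → ℝ} {M : ℕ} {s : ℝ}

theorem derivExcess_nonneg (y : ℝ) : 0 ≤ derivExcess M s f y :=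
  Finset.sum_nonneg fun m _ => mul_nonneg (by positivity) (le_max_right _ _)

theorem continuous_derivExcess (hf : ContDiff ℝ (⊤ : ℕ∞) f) : Continuous (derivExcess M s f) := by
  unfold derivExcess
  refine continuous_finsetSum _ fun m _ => ?_
  have := hf.continuous_iteratedDeriv m (by exact_mod_cast le_top)
  fun_prop

theorem abs_iteratedDeriv_le_add {m : ℕ} (hm : m ≤ M) (y : ℝ) :
    |iteratedDeriv m f y| ≤ s + 2 ^ m * derivExcess M s f y := by
  have h1 : (1 / 2 : ℝ) ^ m * max (|iteratedDeriv m f y| - s) 0 ≤ derivExcess M s f y :=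
    Finset.single_le_sum (f := fun m => (1 / 2 : ℝ) ^ m * max (|iteratedDeriv m f y| - s) 0)
      (fun i _ => mul_nonneg (by positivity) (le_max_right _ _))
      (Finset.mem_range.2 (Nat.lt_succ_of_le hm))
  have h2 := mul_le_mul_of_nonneg_left h1 (by positivity : (0 : ℝ) ≤ 2 ^ m)
  rw [← mul_assoc, ← mul_pow] at h2
  norm_num at h2
  linarith [le_max_left (|iteratedDeriv m f y| - s) 0]

/-- The Sobolev inequality trades a pointwise bound at order `m` for integrals at orders `m` and `m
+ 1`, which explains `m + 1 ≤ M`; the weights combine through `2^m + 2^(m+1) ≤ 2^(m+2)`. -/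
theorem abs_iteratedDeriv_le (hf : ContDiff ℝ (⊤ : ℕ∞) f) {m : ℕ} (hm : m + 1 ≤ M)
    {u v : ℝ} (huv : 1 ≤ v - u) {x : ℝ} (hx : x ∈ Set.Icc u v) :
    |iteratedDeriv m f x| ≤
      2 * s * (v - u) + 2 ^ (m + 2) * ∫ y in u..v, derivExcess M s f y := by
  have h1 : ContDiff ℝ 1 (iteratedDeriv m f) := by
    rw [iteratedDeriv_eq_iterate]
    exact ContDiff.iterate_deriv' 1 m (hf.of_le (by exact_mod_cast le_top))
  have hG := continuous_derivExcess (M := M) (s := s) hf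
  have h2 := abs_le_integral_abs_add_deriv h1 huv hx
  have h3 : ∫ y in u..v, (|iteratedDeriv m f y| + |deriv (iteratedDeriv m f) y|) ≤
      ∫ y in u..v, (2 * s + 2 ^ (m + 2) * derivExcess M s f y) := by
    refine intervalIntegral.integral_mono_on (by linarith) ?_ ?_ fun y _ => ?_
    · exact ((h1.continuous.abs).add (h1.continuous_deriv le_rfl).abs).intervalIntegrable _ _
    · exact (by fun_prop : Continuous fun y =>
        2 * s + 2 ^ (m + 2) * derivExcess M s f y).intervalIntegrable _ _
    · have e1 := abs_iteratedDeriv_le_add (f := f) (s := s) (by omega : m ≤ M) y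
      have e2 := abs_iteratedDeriv_le_add (f := f) (s := s) hm y
      rw [iteratedDeriv_succ] at e2
      have e3 : 0 ≤ 2 ^ m * derivExcess M s f y :=
        mul_nonneg (by positivity) (derivExcess_nonneg y)
      rw [pow_succ] at e2
      rw [pow_add]
      linarith
  rw [intervalIntegral.integral_add (by simp) ((hG.const_mul _).intervalIntegrable _ _),
    intervalIntegral.integral_const, intervalIntegral.integral_const_mul, smul_eq_mul] at h3
  linarith

/-- The density threshold 32 comes from here: `m ≥ 32 L` gives `L^m / m! ≤ (e / 32)^m ≤ 8^(-m)`,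
while the bracket is at most `6 · 4^m`. -/
theorem pow_div_factorial_mul_le {L s : ℝ} {m : ℕ} (hL : 0 ≤ L) (hm : 32 * L ≤ m)
    (hs : 0 ≤ s) (hsm : s ≤ m) :
    L ^ m / m.factorial * (2 * s * L + 2 ^ (m + 2) * L) ≤ 6 * (1 / 2 : ℝ) ^ m := by
  have hm2 : (m : ℝ) ≤ 2 ^ m := by exact_mod_cast Nat.lt_two_pow_self.le
  have h1 : L ^ m / m.factorial ≤ (1 / 8 : ℝ) ^ m := by
    have e1 : L ^ m ≤ (m / 32 : ℝ) ^ m := pow_le_pow_left₀ hL (by linarith) m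
    have e2 := Real.pow_div_factorial_le_exp (m : ℝ) (Nat.cast_nonneg m) m
    have e3 : Real.exp m ≤ 4 ^ m := by
      rw [← mul_one (m : ℝ), Real.exp_nat_mul]
      exact pow_le_pow_left₀ (Real.exp_nonneg _) (by linarith [Real.exp_one_lt_d9]) m
    calc L ^ m / m.factorial ≤ (m / 32 : ℝ) ^ m / m.factorial :=
          div_le_div_of_nonneg_right e1 (by positivity)
      _ = (1 / 32) ^ m * ((m : ℝ) ^ m / m.factorial) := by rw [div_pow, one_div, inv_pow]; ring
      _ ≤ (1 / 32) ^ m * 4 ^ m := mul_le_mul_of_nonneg_left (e2.trans e3) (by positivity)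
      _ = _ := by rw [← mul_pow]; norm_num
  have h2 : 2 * s * L + 2 ^ (m + 2) * L ≤ 6 * 4 ^ m := by
    have e1 : L ≤ 2 ^ m := by linarith
    have e2 : 2 * s + 2 ^ (m + 2) ≤ 6 * 2 ^ m := by rw [pow_add]; linarith
    calc 2 * s * L + 2 ^ (m + 2) * L = (2 * s + 2 ^ (m + 2)) * L := by ring
      _ ≤ (6 * 2 ^ m) * 2 ^ m := mul_le_mul e2 e1 hL (by positivity)
      _ = 6 * 4 ^ m := by rw [mul_assoc, ← mul_pow]; norm_num
  calc L ^ m / m.factorial * (2 * s * L + 2 ^ (m + 2) * L) ≤ (1 / 8 : ℝ) ^ m * (6 * 4 ^ m) :=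
        mul_le_mul h1 h2 (by positivity) (by positivity)
    _ = 6 * ((1 / 8) ^ m * 4 ^ m) := by ring
    _ = _ := by rw [← mul_pow]; norm_num

/-- An interval with many roots is charged either to the derivative excess, or to the set where
`f` is small. -/
theorem length_le_of_many_roots (hf : ContDiff ℝ (⊤ : ℕ∞) f) {b r : ℝ} (hb : 1 ≤ b)
    (hs : 0 ≤ s) (hsb : s ≤ b) (hr : ∀ m : ℕ, b ≤ m → 6 * (1 / 2 : ℝ) ^ m ≤ r)
    {Z : Finset ℝ} (hZM : Z.card + 1 ≤ M) (hZ : ∀ z ∈ Z, f z = 0) {α : ℝ → ℝ} (hα : Continuous α)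
    (hα0 : ∀ y, 0 ≤ α y) (hα1 : ∀ y, |f y| ≤ r → 1 ≤ α y) {u v : ℝ} (hL : b ≤ v - u)
    (hcard : 32 * (v - u) ≤ (Z.filter fun z => u ≤ z ∧ z < v).card) :
    v - u ≤ ∫ y in u..v, (derivExcess M s f y + α y) := by
  have hG := continuous_derivExcess (M := M) (s := s) hf
  have huv : u ≤ v := by linarith
  rw [intervalIntegral.integral_add (hG.intervalIntegrable _ _) (hα.intervalIntegrable _ _)]
  have hA : 0 ≤ ∫ y in u..v, α y := intervalIntegral.integral_nonneg huv fun y _ => hα0 y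
  have hE : 0 ≤ ∫ y in u..v, derivExcess M s f y :=
    intervalIntegral.integral_nonneg huv fun y _ => derivExcess_nonneg y
  -- If the excess integral is below the length, the derivative of order `Y.card` is bounded on the
  -- interval, and interpolation at the roots yields `|f| ≤ 6 · 2^(-Y.card) ≤ r` on all of it.
  rcases le_or_gt (v - u) (∫ y in u..v, derivExcess M s f y) with h | h
  · linarith
  set Y := Z.filter fun z => u ≤ z ∧ z < v with hY
  have hYZ : Y.card ≤ Z.card := Finset.card_filter_le _ _
  have hYz : ∀ z ∈ Y, z ∈ Set.Icc u v ∧ f z = 0 := fun z hz => by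
    rw [hY, Finset.mem_filter] at hz
    exact ⟨⟨hz.2.1, hz.2.2.le⟩, hZ z hz.1⟩
  have hsmall : ∀ x ∈ Set.Icc u v, |f x| ≤ r := by
    intro x hx
    have h1 := abs_le_of_many_zeros hf hYz (S := 2 * s * (v - u) + 2 ^ (Y.card + 2) * (v - u))
      (fun y hy => (abs_iteratedDeriv_le hf (by omega : Y.card + 1 ≤ M) (by linarith) hy).trans
        (by gcongr)) hx
    refine h1.trans ((pow_div_factorial_mul_le (by linarith) hcard hs ?_).trans
      (hr _ ?_)) <;> linarith
  have h2 : ∫ _y in u..v, (1 : ℝ) ≤ ∫ y in u..v, α y :=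
    intervalIntegral.integral_mono_on huv (by simp) (hα.intervalIntegrable _ _)
      fun y hy => hα1 y (hsmall y hy)
  rw [intervalIntegral.integral_const, smul_eq_mul, mul_one] at h2
  linarith

/-- A dyadic stopping-time decomposition of a finite set of points on the line. -/
theorem exists_dyadic_decomposition {Z : Finset ℝ} {H : ℝ → ℝ} (hH : Continuous H)
    (hH0 : ∀ y, 0 ≤ H y) {b : ℝ} (hb : 0 < b)
    (hheavy : ∀ u v, b ≤ v - u → 32 * (v - u) ≤ (Z.filter fun z => u ≤ z ∧ z < v).card →
      v - u ≤ ∫ y in u..v, H y) : ∀ (k : ℕ) (u : ℝ),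
    ((Z.filter fun z => u ≤ z ∧ z < u + b * 2 ^ k).card : ℝ) < 64 * (b * 2 ^ k) →
    ∃ Z' ⊆ Z.filter fun z => u ≤ z ∧ z < u + b * 2 ^ k,
      (Z'.card : ℝ) ≤ 64 * ∫ y in u..(u + b * 2 ^ k), H y ∧
      ∀ i : ℕ, i < 2 ^ k →
        (((Z \ Z').filter fun z => u + i * b ≤ z ∧ z < u + (i + 1) * b).card : ℝ) ≤ 32 * b := by
  intro k
  induction k with
  | zero =>
    intro u hcard
    simp only [pow_zero, mul_one] at hcard ⊢
    by_cases h : 32 * b ≤ (Z.filter fun z => u ≤ z ∧ z < u + b).card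
    · refine ⟨_, subset_rfl, ?_, fun i hi => ?_⟩
      · have := hheavy u (u + b) (by linarith) (by simpa using h)
        linarith
      · have hi0 : i = 0 := by omega
        subst hi0
        have : ((Z \ Z.filter fun z => u ≤ z ∧ z < u + b).filter fun z =>
            u + (0 : ℕ) * b ≤ z ∧ z < u + ((0 : ℕ) + 1) * b) = ∅ := by
          rw [Finset.filter_eq_empty_iff]
          intro z hz
          simp only [Finset.mem_sdiff, Finset.mem_filter, not_and] at hz
          simp only [Nat.cast_zero, zero_mul, add_zero, zero_add, one_mul, not_and]
          exact fun h1 => hz.2 hz.1 h1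
        rw [this]
        simp only [Finset.card_empty, Nat.cast_zero]
        positivity
    · push Not at h
      refine ⟨∅, Finset.empty_subset _, ?_, fun i hi => ?_⟩
      · simp only [Finset.card_empty, Nat.cast_zero]
        have : 0 ≤ ∫ y in u..(u + b), H y :=
          intervalIntegral.integral_nonneg (by linarith) fun y _ => hH0 y
        linarith
      · have hi0 : i = 0 := by omega
        subst hi0
        simpa using h.le
  | succ k ih =>
    intro u hcard
    set w := b * 2 ^ k with hw
    have hw0 : 0 < w := by positivity
    have hbw : b ≤ w := by
      rw [hw]; exact le_mul_of_one_le_right hb.le (one_le_pow₀ one_le_two)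
    have hw2 : b * 2 ^ (k + 1) = w + w := by rw [hw, pow_succ]; ring
    rw [hw2] at hcard ⊢
    -- At a heavy interval the recursion stops and removes every point: there are fewer than 64
    -- times the length, and the length is at most the integral of `H`. A light interval has fewer
    -- than `32 · 2w = 64 w` points, so both halves inherit the counting hypothesis.
    by_cases h : 32 * (w + w) ≤ (Z.filter fun z => u ≤ z ∧ z < u + (w + w)).card
    · refine ⟨_, subset_rfl, ?_, fun i hi => ?_⟩
      · have := hheavy u (u + (w + w)) (by linarith) (by simpa using h)
        linarith
      · have hi' : (i : ℝ) + 1 ≤ 2 ^ (k + 1) := by exact_mod_cast hi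
        have : ((Z \ Z.filter fun z => u ≤ z ∧ z < u + (w + w)).filter fun z =>
            u + i * b ≤ z ∧ z < u + (i + 1) * b) = ∅ := by
          rw [Finset.filter_eq_empty_iff]
          intro z hz
          simp only [Finset.mem_sdiff, Finset.mem_filter, not_and] at hz
          rintro ⟨h1, h2⟩
          have h3 : (0 : ℝ) ≤ i * b := by positivity
          have h4 : ((i : ℝ) + 1) * b ≤ w + w := by
            rw [← hw2, mul_comm b]; exact mul_le_mul_of_nonneg_right hi' hb.le
          exact hz.2 hz.1 (by linarith) (by linarith)
        rw [this]
        simp only [Finset.card_empty, Nat.cast_zero]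
        positivity
    · push Not at h
      have hsub : ∀ u' v', u ≤ u' → v' ≤ u + (w + w) →
          ((Z.filter fun z => u' ≤ z ∧ z < v').card : ℝ) < 64 * w := by
        intro u' v' h1 h2
        refine lt_of_le_of_lt (Nat.cast_le.2 (Finset.card_le_card ?_)) (by linarith : _ < 64 * w)
        intro z hz
        rw [Finset.mem_filter] at hz ⊢
        exact ⟨hz.1, h1.trans hz.2.1, hz.2.2.trans_le h2⟩
      obtain ⟨Z₁, hs₁, hc₁, hi₁⟩ := ih u (hsub _ _ le_rfl (by linarith))
      obtain ⟨Z₂, hs₂, hc₂, hi₂⟩ := ih (u + w) (hsub _ _ (by linarith) (by linarith))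
      refine ⟨Z₁ ∪ Z₂, ?_, ?_, fun i hi => ?_⟩
      · refine Finset.union_subset (hs₁.trans ?_) (hs₂.trans ?_)
        · intro z hz
          rw [Finset.mem_filter] at hz ⊢
          exact ⟨hz.1, hz.2.1, by linarith [hz.2.2]⟩
        · intro z hz
          rw [Finset.mem_filter] at hz ⊢
          exact ⟨hz.1, by linarith [hz.2.1], by linarith [hz.2.2]⟩
      · have h1 : ((Z₁ ∪ Z₂).card : ℝ) ≤ Z₁.card + Z₂.card := by
          exact_mod_cast Finset.card_union_le _ _
        have h2 := intervalIntegral.integral_add_adjacent_intervals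
          (hH.intervalIntegrable (μ := volume) u (u + w))
          (hH.intervalIntegrable (μ := volume) (u + w) (u + w + w))
        rw [← add_assoc, ← h2]
        linarith
      · rcases lt_or_ge i (2 ^ k) with h1 | h1
        · refine le_trans (Nat.cast_le.2 (Finset.card_le_card ?_)) (hi₁ i h1)
          refine Finset.filter_subset_filter _ (Finset.sdiff_subset_sdiff subset_rfl ?_)
          exact Finset.subset_union_left
        · obtain ⟨j, rfl⟩ := Nat.exists_eq_add_of_le h1
          have hj : j < 2 ^ k := by rw [pow_succ] at hi; omega
          have e1 : u + ((2 ^ k + j : ℕ) : ℝ) * b = u + w + j * b := by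
            rw [hw]; push_cast; ring
          have e2 : u + (((2 ^ k + j : ℕ) : ℝ) + 1) * b = u + w + (j + 1) * b := by
            rw [hw]; push_cast; ring
          rw [e1, e2]
          refine le_trans (Nat.cast_le.2 (Finset.card_le_card ?_)) (hi₂ j hj)
          refine Finset.filter_subset_filter _ (Finset.sdiff_subset_sdiff subset_rfl ?_)
          exact Finset.subset_union_right

end

/-! ### Window counts, sign changes and the deterministic comparison. -/

noncomputable section

/-- Number of points of `S` in the window `[y, y + η)`. -/
def windowCount (S : Finset ℝ) (η y : ℝ) : ℝ := ((S.filter fun z => y ≤ z ∧ z < y + η).card : ℝ)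

/-- Truncation to `[-1, 1]`. -/
def clampUnit (x : ℝ) : ℝ := max (-1) (min 1 x)

/-- A smoothed indicator that `u` and `v` have opposite signs. -/
def signChange (r u v : ℝ) : ℝ := |clampUnit (u / r) - clampUnit (v / r)| / 2

end

section

theorem windowCount_nonneg (S : Finset ℝ) (η y : ℝ) : 0 ≤ windowCount S η y := Nat.cast_nonneg _

theorem windowCount_le_card (S : Finset ℝ) (η y : ℝ) : windowCount S η y ≤ S.card :=
  Nat.cast_le.2 (Finset.card_filter_le _ _)

theorem windowCount_eq_sum (S : Finset ℝ) (η y : ℝ) :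
    windowCount S η y = ∑ z ∈ S, (Set.Ioc (z - η) z).indicator (fun _ => (1 : ℝ)) y := by
  unfold windowCount
  rw [Finset.card_filter, Nat.cast_sum]
  refine Finset.sum_congr rfl fun z _ => ?_
  by_cases h : y ≤ z ∧ z < y + η
  · have hy : y ∈ Set.Ioc (z - η) z := ⟨by linarith, h.1⟩
    rw [if_pos h, Set.indicator_of_mem hy, Nat.cast_one]
  · rw [if_neg h, Set.indicator_of_notMem, Nat.cast_zero]
    rintro ⟨h1, h2⟩
    exact h ⟨h2, by linarith⟩

theorem measurable_windowCount (S : Finset ℝ) (η : ℝ) : Measurable (windowCount S η) := by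
  have : windowCount S η = fun y => ∑ z ∈ S, (Set.Ioc (z - η) z).indicator (fun _ => (1 : ℝ)) y :=
    funext fun y => windowCount_eq_sum S η y
  rw [this]
  exact Finset.measurable_sum _ fun z _ => measurable_const.indicator measurableSet_Ioc

theorem intervalIntegrable_windowCount_mul (S : Finset ℝ) (η : ℝ) {g : ℝ → ℝ} (hg : Continuous g)
    (a b : ℝ) : IntervalIntegrable (fun y => windowCount S η y * g y) volume a b := by
  have h := hg.intervalIntegrable (μ := volume) a b
  rw [intervalIntegrable_iff] at h ⊢
  refine h.bdd_mul (c := S.card) (measurable_windowCount S η).aestronglyMeasurable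
    (ae_of_all _ fun y => ?_)
  rw [Real.norm_of_nonneg (windowCount_nonneg _ _ _)]
  exact windowCount_le_card S η y

theorem intervalIntegrable_windowCount (S : Finset ℝ) (η a b : ℝ) :
    IntervalIntegrable (windowCount S η) volume a b := by
  simpa using intervalIntegrable_windowCount_mul S η (continuous_const (y := (1 : ℝ))) a b

/-- Double counting: each point is seen by the windows starting in an interval of length `η`.
Starting the integral at `p - η` leaves no such interval cut off. -/
theorem integral_windowCount {S : Finset ℝ} {η p q : ℝ} (hη : 0 ≤ η)
    (hS : ∀ z ∈ S, p ≤ z ∧ z ≤ q) (hpq : p ≤ q) :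
    ∫ y in (p - η)..q, windowCount S η y = η * S.card := by
  simp_rw [windowCount_eq_sum]
  have hi : ∀ z, IntegrableOn ((Set.Ioc (z - η) z).indicator (fun _ => (1 : ℝ)))
      (Set.Ioc (p - η) q) := fun z =>
    (integrable_indicator_iff measurableSet_Ioc).2 (by simp) |>.integrableOn
  rw [intervalIntegral.integral_of_le (by linarith), integral_finsetSum _ fun z _ => hi z]
  rw [Finset.sum_congr rfl (g := fun _ => η), Finset.sum_const, nsmul_eq_mul, mul_comm]
  intro z hz
  rw [setIntegral_indicator measurableSet_Ioc, setIntegral_const, smul_eq_mul, mul_one,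
    Set.inter_eq_right.2]
  · simp [measureReal_def, hη]
  · exact Set.Ioc_subset_Ioc (by linarith [(hS z hz).1]) (hS z hz).2

/-- Only windows starting near the cell `[u, u + b)` see points of `S`, so the weight `α` is
integrated over a bounded enlargement of that cell. -/
theorem windowCount_mul_integral_le {S : Finset ℝ} {η u b B p q : ℝ} (hηb : η ≤ b)
    (hS : ∀ z ∈ S, u ≤ z ∧ z < u + b) (hcard : (S.card : ℝ) ≤ B) (hpq : p ≤ q)
    (hb : 0 ≤ b) {α : ℝ → ℝ} (hα : Continuous α) (hα0 : ∀ y, 0 ≤ α y) :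
    ∫ y in p..q, windowCount S η y * α y ≤ B * ∫ y in (u - b)..(u + 2 * b), α y := by
  have hB : 0 ≤ B := (Nat.cast_nonneg _).trans hcard
  have h1 : IntegrableOn (fun y => B * α y) (Set.Ioc (u - b) (u + 2 * b)) :=
    ((hα.const_mul B).intervalIntegrable (μ := volume) (u - b) (u + 2 * b)).1
  have h2 : Integrable ((Set.Ioc (u - b) (u + 2 * b)).indicator fun y => B * α y) :=
    (integrable_indicator_iff measurableSet_Ioc).2 h1
  have h3 : ∀ y, windowCount S η y * α y ≤
      (Set.Ioc (u - b) (u + 2 * b)).indicator (fun y => B * α y) y := by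
    intro y
    by_cases hy : y ∈ Set.Ioc (u - b) (u + 2 * b)
    · rw [Set.indicator_of_mem hy]
      exact mul_le_mul_of_nonneg_right ((windowCount_le_card S η y).trans hcard) (hα0 y)
    · rw [Set.indicator_of_notMem hy]
      have : (S.filter fun z => y ≤ z ∧ z < y + η) = ∅ := by
        rw [Finset.filter_eq_empty_iff]
        rintro z hz ⟨h4, h5⟩
        obtain ⟨h6, h7⟩ := hS z hz
        exact hy ⟨by linarith, by linarith⟩
      simp [windowCount, this]
  calc ∫ y in p..q, windowCount S η y * α y
      ≤ ∫ y in p..q, (Set.Ioc (u - b) (u + 2 * b)).indicator (fun y => B * α y) y :=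
        intervalIntegral.integral_mono_on hpq (intervalIntegrable_windowCount_mul S η hα p q)
          h2.intervalIntegrable fun y _ => h3 y
    _ ≤ ∫ y, (Set.Ioc (u - b) (u + 2 * b)).indicator (fun y => B * α y) y := by
        rw [intervalIntegral.integral_of_le hpq]
        refine setIntegral_le_integral h2 (ae_of_all _ fun y => ?_)
        exact Set.indicator_nonneg (fun y _ => mul_nonneg hB (hα0 y)) y
    _ = B * ∫ y in (u - b)..(u + 2 * b), α y := by
        rw [integral_indicator measurableSet_Ioc, integral_const_mul,
          intervalIntegral.integral_of_le (by linarith)]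

theorem sum_integral_grid {H : ℝ → ℝ} (hH : Continuous H) (c b : ℝ) (n : ℕ) :
    ∑ i ∈ Finset.range n, ∫ y in (c + i * b)..(c + (i + 1) * b), H y =
      ∫ y in c..(c + n * b), H y := by
  have := intervalIntegral.sum_integral_adjacent_intervals (f := H) (μ := volume)
    (a := fun i : ℕ => c + i * b) (n := n) fun k _ => hH.intervalIntegrable _ _
  simpa using this

/-- Each interval of length `3b` splits into three cells of length `b`, and each of the three
resulting families tiles an interval once. -/
theorem sum_integral_overlapping_le {H : ℝ → ℝ} (hH : Continuous H) (hH0 : ∀ y, 0 ≤ H y)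
    {b : ℝ} (hb : 0 ≤ b) (p : ℝ) (n : ℕ) :
    ∑ i ∈ Finset.range n, ∫ y in (p + i * b - b)..(p + i * b + 2 * b), H y ≤
      3 * ∫ y in (p - b)..(p + n * b + b), H y := by
  have hi : ∀ u v, IntervalIntegrable H volume u v := fun u v => hH.intervalIntegrable u v
  have h1 : ∀ i : ℕ, ∫ y in (p + i * b - b)..(p + i * b + 2 * b), H y =
      (∫ y in (p - b + i * b)..(p - b + (i + 1) * b), H y) +
      (∫ y in (p + i * b)..(p + (i + 1) * b), H y) +
      ∫ y in (p + b + i * b)..(p + b + (i + 1) * b), H y := by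
    intro i
    have e1 : p - b + i * b = p + i * b - b := by ring
    have e2 : p - b + (i + 1) * b = p + i * b := by ring
    have e3 : p + b + i * b = p + (i + 1) * b := by ring
    have e4 : p + b + (i + 1) * b = p + i * b + 2 * b := by ring
    rw [e1, e2, e3, e4, intervalIntegral.integral_add_adjacent_intervals (hi _ _) (hi _ _),
      intervalIntegral.integral_add_adjacent_intervals (hi _ _) (hi _ _)]
  simp_rw [h1]
  rw [Finset.sum_add_distrib, Finset.sum_add_distrib, sum_integral_grid hH, sum_integral_grid hH,
    sum_integral_grid hH]
  have hn : 0 ≤ n * b := by positivity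
  have hm : ∀ u v, p - b ≤ u → u ≤ v → v ≤ p + n * b + b →
      ∫ y in u..v, H y ≤ ∫ y in (p - b)..(p + n * b + b), H y := fun u v h2 h3 h4 =>
    intervalIntegral.integral_mono_interval h2 h3 h4 (ae_of_all _ hH0) (hi _ _)
  have := hm (p - b) (p - b + n * b) le_rfl (by linarith) (by linarith)
  have := hm p (p + n * b) (by linarith) (by linarith) (by linarith)
  have := hm (p + b) (p + b + n * b) (by linarith) (by linarith) (by linarith)
  linarith

theorem clampUnit_mem (x : ℝ) : -1 ≤ clampUnit x ∧ clampUnit x ≤ 1 :=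
  ⟨le_max_left _ _, max_le (by norm_num) (min_le_left _ _)⟩

theorem clampUnit_of_one_le {x : ℝ} (h : 1 ≤ x) : clampUnit x = 1 := by
  unfold clampUnit; rw [min_eq_left h]; norm_num

theorem clampUnit_of_le_neg_one {x : ℝ} (h : x ≤ -1) : clampUnit x = -1 := by
  unfold clampUnit; rw [min_eq_right (by linarith), max_eq_left h]

theorem signChange_nonneg (r u v : ℝ) : 0 ≤ signChange r u v := by
  unfold signChange; positivity

theorem signChange_le_one (r u v : ℝ) : signChange r u v ≤ 1 := by
  unfold signChange
  have h1 := clampUnit_mem (u / r)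
  have h2 := clampUnit_mem (v / r)
  rw [div_le_one (by norm_num), abs_le]
  constructor <;> linarith [h1.1, h1.2, h2.1, h2.2]

theorem continuous_clampUnit : Continuous clampUnit := by
  unfold clampUnit; fun_prop

theorem signChange_of_lt_of_lt {r u v : ℝ} (hr : 0 < r) (hu : r < |u|) (hv : r < |v|) :
    (0 < u * v ∧ signChange r u v = 0) ∨ (u * v < 0 ∧ signChange r u v = 1) := by
  have key : ∀ x : ℝ, r < |x| → (0 < x ∧ clampUnit (x / r) = 1) ∨
      (x < 0 ∧ clampUnit (x / r) = -1) := by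
    intro x hx
    rcases lt_abs.1 hx with h | h
    · exact Or.inl ⟨hr.trans h, clampUnit_of_one_le ((one_le_div hr).2 h.le)⟩
    · refine Or.inr ⟨by linarith, clampUnit_of_le_neg_one ?_⟩
      rw [div_le_iff₀ hr]; linarith
  unfold signChange
  rcases key u hu with ⟨h1, h2⟩ | ⟨h1, h2⟩ <;> rcases key v hv with ⟨h3, h4⟩ | ⟨h3, h4⟩ <;>
    rw [h2, h4]
  · exact Or.inl ⟨mul_pos h1 h3, by norm_num⟩
  · exact Or.inr ⟨mul_neg_of_pos_of_neg h1 h3, by norm_num⟩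
  · exact Or.inr ⟨mul_neg_of_neg_of_pos h1 h3, by norm_num⟩
  · exact Or.inl ⟨mul_pos_of_neg_of_neg h1 h3, by norm_num⟩

end

section

variable {f : ℝ → ℝ}

/-- Integrating `f''` from the critical point gives `|f'| ≤ T η` in the window; integrating `f'`
from the root gives `|f| ≤ T η^2`. -/
theorem abs_le_of_root_of_critical (hf : ContDiff ℝ (⊤ : ℕ∞) f) {η y z c T r : ℝ}
    (hz : z ∈ Set.Icc y (y + η)) (hfz : f z = 0) (hc : c ∈ Set.Icc y (y + η)) (hfc : deriv f c = 0)
    (hT : ∀ x ∈ Set.Icc y (y + η), |iteratedDeriv 2 f x| ≤ T) (hr : η ^ 2 * T ≤ r) :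
    |f y| ≤ r := by
  have hη : 0 ≤ η := by linarith [hz.1, hz.2]
  have hy : y ∈ Set.Icc y (y + η) := ⟨le_rfl, by linarith⟩
  have hT0 : 0 ≤ T := (abs_nonneg _).trans (hT y hy)
  have hd : Differentiable ℝ f := hf.differentiable (by simp)
  have hd2 : Differentiable ℝ (deriv f) :=
    (contDiff_infty_iff_deriv.1 hf).2.differentiable (by simp)
  have hdist : ∀ x ∈ Set.Icc y (y + η), ∀ x' ∈ Set.Icc y (y + η), |x - x'| ≤ η := by
    intro x hx x' hx'
    rw [abs_le]; constructor <;> linarith [hx.1, hx.2, hx'.1, hx'.2]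
  have h1 : ∀ x ∈ Set.Icc y (y + η), |deriv f x| ≤ T * η := by
    intro x hx
    have := (convex_Icc y (y + η)).norm_image_sub_le_of_norm_deriv_le (f := deriv f) (C := T)
      (fun w _ => hd2 w) (fun w hw => by
        have := hT w hw
        rwa [iteratedDeriv_succ, iteratedDeriv_one] at this) hc hx
    rw [hfc, sub_zero] at this
    exact this.trans (mul_le_mul_of_nonneg_left (hdist x hx c hc) hT0)
  have h2 := (convex_Icc y (y + η)).norm_image_sub_le_of_norm_deriv_le (f := f) (C := T * η)
      (fun w _ => hd w) h1 hz hy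
  rw [hfz, sub_zero] at h2
  calc |f y| ≤ T * η * |y - z| := h2
    _ ≤ T * η * η := mul_le_mul_of_nonneg_left (hdist y hy z hz) (by positivity)
    _ = η ^ 2 * T := by ring
    _ ≤ r := hr

/-- If `|f| ≤ r` at the left end, the last term pays for every root. Otherwise a window with a root
has no critical point: by Rolle it has a single root, and equal signs beyond `±r` at the ends would
force an interior extremum. So the root is seen as a sign change, unless `|f| ≤ r` at the right end.
-/
theorem windowCount_le_of_tame (hf : ContDiff ℝ (⊤ : ℕ∞) f) {η T r y : ℝ} (hr0 : 0 < r)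
    (hr : η ^ 2 * T ≤ r) {S : Finset ℝ} (hS : ∀ z ∈ S, f z = 0)
    (hT : ∀ z ∈ S, y ≤ z → z < y + η → ∀ x ∈ Set.Icc y (y + η), |iteratedDeriv 2 f x| ≤ T)
    {α : ℝ → ℝ} (hα0 : ∀ y, 0 ≤ α y) (hα1 : ∀ y, |f y| ≤ r → 1 ≤ α y) :
    windowCount S η y ≤ signChange r (f y) (f (y + η)) + α y + α (y + η) +
      windowCount S η y * α y := by
  have hψ := signChange_nonneg r (f y) (f (y + η))
  have hw := windowCount_nonneg S η y
  have ha := hα0 y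
  have ha' := hα0 (y + η)
  rcases le_or_gt |f y| r with h1 | h1
  · have := mul_le_mul_of_nonneg_left (hα1 y h1) hw
    linarith
  have hwa := mul_nonneg hw ha
  rcases Finset.eq_empty_or_nonempty (S.filter fun z => y ≤ z ∧ z < y + η) with he | ⟨z, hz⟩
  · have : windowCount S η y = 0 := by simp [windowCount, he]
    rw [this] at hwa ⊢
    linarith
  have hzS := (Finset.mem_filter.1 hz).1
  have hzy := (Finset.mem_filter.1 hz).2
  have hTy := hT z hzS hzy.1 hzy.2
  have hnocrit : ∀ c ∈ Set.Icc y (y + η), deriv f c ≠ 0 := fun c hc hfc =>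
    absurd (abs_le_of_root_of_critical hf ⟨hzy.1, hzy.2.le⟩ (hS z hzS) hc hfc hTy hr) (not_le.2 h1)
  have hle1 : windowCount S η y ≤ 1 := by
    unfold windowCount
    have : (S.filter fun z => y ≤ z ∧ z < y + η).card ≤ 1 := by
      rw [Finset.card_le_one]
      intro z₁ hz₁ z₂ hz₂
      by_contra hne
      wlog hlt : z₁ < z₂ generalizing z₁ z₂
      · exact this z₂ hz₂ z₁ hz₁ (Ne.symm hne) (lt_of_le_of_ne (not_lt.1 hlt) (Ne.symm hne))
      rw [Finset.mem_filter] at hz₁ hz₂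
      obtain ⟨c, hc, hc0⟩ := exists_deriv_eq_zero hlt hf.continuous.continuousOn
        (by rw [hS _ hz₁.1, hS _ hz₂.1])
      exact hnocrit c ⟨hz₁.2.1.trans hc.1.le, (hc.2.trans hz₂.2.2).le⟩ hc0
    exact_mod_cast this
  rcases le_or_gt |f (y + η)| r with h2 | h2
  · have := hα1 _ h2
    linarith
  rcases signChange_of_lt_of_lt hr0 h1 h2 with ⟨h3, -⟩ | ⟨-, h4⟩
  · exfalso
    have hyz : y < z := lt_of_le_of_ne hzy.1 (by
      rintro rfl
      rw [hS _ hzS, abs_zero] at h1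
      linarith)
    obtain ⟨c, hc, hc0⟩ : ∃ c ∈ Set.Ioo y (y + η), deriv f c = 0 := by
      have hlt : y < y + η := hyz.trans hzy.2
      have hcont : ContinuousOn f (Set.Icc y (y + η)) := hf.continuous.continuousOn
      have hfz := hS z hzS
      rcases pos_and_pos_or_neg_and_neg_of_mul_pos h3 with ⟨h5, h6⟩ | ⟨h5, h6⟩
      · obtain ⟨c, hc, hmin⟩ := isCompact_Icc.exists_isMinOn (Set.nonempty_Icc.2 hlt.le) hcont
        have hcz : f c ≤ 0 := hfz ▸ hmin ⟨hyz.le, hzy.2.le⟩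
        have hc' : c ∈ Set.Ioo y (y + η) :=
          ⟨lt_of_le_of_ne hc.1 (by rintro rfl; linarith),
            lt_of_le_of_ne hc.2 (by rintro rfl; linarith)⟩
        exact ⟨c, hc', (hmin.isLocalMin (Icc_mem_nhds hc'.1 hc'.2)).deriv_eq_zero⟩
      · obtain ⟨c, hc, hmax⟩ := isCompact_Icc.exists_isMaxOn (Set.nonempty_Icc.2 hlt.le) hcont
        have hcz : 0 ≤ f c := hfz ▸ hmax ⟨hyz.le, hzy.2.le⟩
        have hc' : c ∈ Set.Ioo y (y + η) :=
          ⟨lt_of_le_of_ne hc.1 (by rintro rfl; linarith),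
            lt_of_le_of_ne hc.2 (by rintro rfl; linarith)⟩
        exact ⟨c, hc', (hmax.isLocalMax (Icc_mem_nhds hc'.1 hc'.2)).deriv_eq_zero⟩
    exact hnocrit c ⟨hc.1.le, hc.2.le⟩ hc0
  · linarith

/-- Converse comparison: opposite signs beyond `±r` produce a root by the intermediate value
theorem, and near-zero ends are paid by `α`. -/
theorem signChange_le_windowCount (hf : Continuous f) {η r y : ℝ} (hη : 0 < η) (hr0 : 0 < r)
    {S : Finset ℝ} (hS : ∀ z, y ≤ z → z < y + η → f z = 0 → z ∈ S)
    {α : ℝ → ℝ} (hα0 : ∀ y, 0 ≤ α y) (hα1 : ∀ y, |f y| ≤ r → 1 ≤ α y) :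
    signChange r (f y) (f (y + η)) ≤ windowCount S η y + α y + α (y + η) := by
  have hψ := signChange_le_one r (f y) (f (y + η))
  have hw := windowCount_nonneg S η y
  have ha := hα0 y
  have ha' := hα0 (y + η)
  rcases le_or_gt |f y| r with h1 | h1
  · linarith [hα1 y h1]
  rcases le_or_gt |f (y + η)| r with h2 | h2
  · linarith [hα1 _ h2]
  rcases signChange_of_lt_of_lt hr0 h1 h2 with ⟨-, h4⟩ | ⟨h3, -⟩
  · linarith
  have hex : ∃ z ∈ Set.Icc y (y + η), f z = 0 := by
    have hle : y ≤ y + η := by linarith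
    rcases mul_neg_iff.1 h3 with ⟨h5, h6⟩ | ⟨h5, h6⟩
    · exact intermediate_value_Icc' hle hf.continuousOn ⟨h6.le, h5.le⟩
    · exact intermediate_value_Icc hle hf.continuousOn ⟨h5.le, h6.le⟩
  obtain ⟨z, hz, hfz⟩ := hex
  have hz' : z < y + η := lt_of_le_of_ne hz.2 (by
    rintro rfl
    rw [hfz, abs_zero] at h2
    linarith)
  have : 1 ≤ windowCount S η y := by
    unfold windowCount
    have : 0 < (S.filter fun z => y ≤ z ∧ z < y + η).card :=
      Finset.card_pos.2 ⟨z, Finset.mem_filter.2 ⟨hS z hz.1 hz' hfz, hz.1, hz'⟩⟩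
    exact_mod_cast this
  linarith

end

section

variable {f : ℝ → ℝ} {M : ℕ} {s b r η p q : ℝ} {k : ℕ} {Z : Finset ℝ} {α : ℝ → ℝ}

theorem exists_index_of_mem_Ico (hb : 0 < b) {n : ℕ} {z : ℝ} (hz : p ≤ z ∧ z < p + b * n) :
    ∃ i < n, p + (i : ℝ) * b ≤ z ∧ z < p + ((i : ℝ) + 1) * b := by
  have h0 : 0 ≤ (z - p) / b := div_nonneg (by linarith [hz.1]) hb.le
  have h1 := Nat.floor_le h0
  have h2 := Nat.lt_floor_add_one ((z - p) / b)
  rw [le_div_iff₀ hb] at h1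
  rw [div_lt_iff₀ hb] at h2
  refine ⟨⌊(z - p) / b⌋₊, ?_, by linarith, by linarith⟩
  rw [Nat.floor_lt h0, div_lt_iff₀ hb]
  linarith [hz.2, mul_comm b n]

/-- The roots split into three groups: those in dense stretches, paid by the dyadic decomposition;
those in cells where the derivative excess is above one, at most `32 b` per cell; and the rest, to
which the tame window estimate applies. -/
theorem mul_card_le_integral_signChange (hf : ContDiff ℝ (⊤ : ℕ∞) f) (hb : 1 ≤ b)
    (hs : 0 ≤ s) (hsb : s ≤ b) (hr0 : 0 < r) (hr : ∀ m : ℕ, b ≤ m → 6 * (1 / 2 : ℝ) ^ m ≤ r)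
    (hη : 0 < η) (hη1 : η ≤ 1) (hηr : η ^ 2 * (6 * s * b + 16) ≤ r) (hM : 3 ≤ M)
    (hZM : Z.card + 1 ≤ M) (hq : q = p + b * 2 ^ k)
    (hZ : ∀ z ∈ Z, (p ≤ z ∧ z < q) ∧ f z = 0) (hcard : (Z.card : ℝ) < 64 * (b * 2 ^ k))
    (hα : Continuous α) (hα0 : ∀ y, 0 ≤ α y) (hα1 : ∀ y, |f y| ≤ r → 1 ≤ α y) :
    η * Z.card ≤ (∫ y in p..q, signChange r (f y) (f (y + η))) + η +
      162 * b * (∫ y in (p - b)..(q + b), α y) +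
      160 * η * b * ∫ y in (p - b)..(q + b), derivExcess M s f y := by
  have hb0 : 0 < b := by linarith
  have hE := continuous_derivExcess (M := M) (s := s) hf
  have hE0 : ∀ y, 0 ≤ derivExcess M s f y := derivExcess_nonneg
  set n := 2 ^ k with hn
  have hpow : (1 : ℝ) ≤ 2 ^ k := one_le_pow₀ one_le_two
  have hnR : (n : ℝ) = 2 ^ k := by rw [hn]; push_cast; rfl
  have hqn : p + n * b = q := by rw [hq, hnR]; ring
  have hpq : p + b ≤ q := by
    rw [hq]; have := le_mul_of_one_le_right hb0.le hpow; linarith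
  have hfilt : (Z.filter fun z => p ≤ z ∧ z < p + b * 2 ^ k) = Z := by
    rw [Finset.filter_eq_self]
    intro z hz
    rw [← hq]; exact (hZ z hz).1
  obtain ⟨Z', hZ'Z, hZ'c, hZ'i⟩ := exists_dyadic_decomposition (Z := Z) (hE.add hα)
    (fun y => add_nonneg (hE0 y) (hα0 y)) hb0
    (fun u v h1 h2 => length_le_of_many_roots hf hb hs hsb hr hZM (fun z hz => (hZ z hz).2)
      hα hα0 hα1 h1 h2) k p (by rw [hfilt]; exact hcard)
  rw [hfilt] at hZ'Z
  rw [← hq] at hZ'c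
  set R : ℕ → Finset ℝ := fun i =>
    (Z \ Z').filter fun z => p + i * b ≤ z ∧ z < p + (i + 1) * b with hR
  set IE : ℕ → ℝ := fun i => ∫ y in (p + i * b - b)..(p + i * b + 2 * b), derivExcess M s f y
    with hIE
  have hIE0 : ∀ i, 0 ≤ IE i := fun i =>
    intervalIntegral.integral_nonneg (by linarith) fun y _ => hE0 y
  -- `W` collects the wild cells, `V` the tame ones. In a tame cell `IE i ≤ 1` on the enlarged
  -- interval of length `3b` gives `|f''| ≤ 2 s (3b) + 2^4 = 6 s b + 16`, the bound required in
  -- `hηr`.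
  set W := (Finset.range n).filter fun i => 1 < IE i with hW
  set V := (Finset.range n).filter fun i => ¬ 1 < IE i with hV
  have hRZ : ∀ i, ∀ z ∈ R i, z ∈ Z := fun i z hz =>
    (Finset.mem_sdiff.1 (Finset.mem_filter.1 hz).1).1
  have hRu : ∀ i, ∀ z ∈ R i, p + i * b ≤ z ∧ z < p + i * b + b := fun i z hz => by
    have := (Finset.mem_filter.1 hz).2
    exact ⟨this.1, by linarith [this.2]⟩
  have hcover : Z ⊆ (Z' ∪ W.biUnion R) ∪ V.biUnion R := by
    intro z hz
    by_cases hz' : z ∈ Z'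
    · exact Finset.mem_union_left _ (Finset.mem_union_left _ hz')
    obtain ⟨i, hi, h1⟩ := exists_index_of_mem_Ico (p := p) (n := n) hb0 (z := z) (by
      rw [mul_comm, hqn]; exact (hZ z hz).1)
    have hzR : z ∈ R i := Finset.mem_filter.2 ⟨Finset.mem_sdiff.2 ⟨hz, hz'⟩, h1⟩
    by_cases hw : 1 < IE i
    · refine Finset.mem_union_left _ (Finset.mem_union_right _ (Finset.mem_biUnion.2 ⟨i, ?_, hzR⟩))
      exact Finset.mem_filter.2 ⟨Finset.mem_range.2 hi, hw⟩
    · refine Finset.mem_union_right _ (Finset.mem_biUnion.2 ⟨i, ?_, hzR⟩)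
      exact Finset.mem_filter.2 ⟨Finset.mem_range.2 hi, hw⟩
  have hwc_union : ∀ (A B : Finset ℝ) (y : ℝ), windowCount (A ∪ B) η y ≤
      windowCount A η y + windowCount B η y := fun A B y => by
    unfold windowCount
    rw [Finset.filter_union]
    exact_mod_cast Finset.card_union_le _ _
  have hwc_bi : ∀ (A : Finset ℕ) (y : ℝ), windowCount (A.biUnion R) η y ≤
      ∑ i ∈ A, windowCount (R i) η y := fun A y => by
    unfold windowCount
    rw [Finset.filter_biUnion]
    exact_mod_cast Finset.card_biUnion_le
  have hwc_mono : ∀ (A B : Finset ℝ) (y : ℝ), A ⊆ B → windowCount A η y ≤ windowCount B η y :=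
    fun A B y h => Nat.cast_le.2 (Finset.card_le_card (Finset.filter_subset_filter _ h))
  have htame : ∀ y, windowCount (V.biUnion R) η y ≤
      signChange r (f y) (f (y + η)) + α y + α (y + η) +
        windowCount (V.biUnion R) η y * α y := by
    intro y
    refine windowCount_le_of_tame hf hr0 hηr (fun z hz => ?_) (fun z hz h1 h2 x hx => ?_) hα0 hα1
    · obtain ⟨i, -, hi⟩ := Finset.mem_biUnion.1 hz
      exact (hZ z (hRZ i z hi)).2
    · obtain ⟨i, hiV, hi⟩ := Finset.mem_biUnion.1 hz
      have hI : IE i ≤ 1 := not_lt.1 (Finset.mem_filter.1 hiV).2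
      have hzu := hRu i z hi
      have := abs_iteratedDeriv_le (s := s) (M := M) hf (m := 2) hM
        (u := p + i * b - b) (v := p + i * b + 2 * b) (by linarith) (x := x)
        ⟨by linarith [hx.1], by linarith [hx.2]⟩
      have e : p + i * b + 2 * b - (p + i * b - b) = 3 * b := by ring
      rw [e] at this
      change |iteratedDeriv 2 f x| ≤ 2 * s * (3 * b) + 2 ^ (2 + 2) * IE i at this
      norm_num at this
      linarith
  have hpt : ∀ y, windowCount Z η y ≤ windowCount Z' η y + (∑ i ∈ W, windowCount (R i) η y) +
      (signChange r (f y) (f (y + η)) + α y + α (y + η) +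
        ∑ i ∈ Finset.range n, windowCount (R i) η y * α y) := by
    intro y
    have h1 := (hwc_mono _ _ y hcover).trans (hwc_union _ _ y)
    have h2 := hwc_union Z' (W.biUnion R) y
    have h3 := hwc_bi W y
    have h4 := htame y
    have h5 : windowCount (V.biUnion R) η y * α y ≤
        ∑ i ∈ Finset.range n, windowCount (R i) η y * α y := by
      rw [← Finset.sum_mul]
      refine mul_le_mul_of_nonneg_right ((hwc_bi V y).trans ?_) (hα0 y)
      exact Finset.sum_le_sum_of_subset_of_nonneg (Finset.filter_subset _ _)
        fun i _ _ => windowCount_nonneg _ _ _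
    linarith
  have hpq' : p ≤ q := by linarith
  have hpη : p - η ≤ q := by linarith
  have hψc : Continuous fun y => signChange r (f y) (f (y + η)) := by
    have := hf.continuous
    have := continuous_clampUnit
    unfold signChange
    fun_prop
  have hαη : Continuous fun y => α (y + η) := hα.comp (by fun_prop)
  have hint := intervalIntegral.integral_mono_on (μ := volume) hpη
    (intervalIntegrable_windowCount Z η _ _)
    (((intervalIntegrable_windowCount Z' η _ _).add
      (IntervalIntegrable.sum W fun i _ => intervalIntegrable_windowCount (R i) η _ _)).add
      ((((hψc.intervalIntegrable _ _).add (hα.intervalIntegrable _ _)).add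
        (hαη.intervalIntegrable _ _)).add
      (IntervalIntegrable.sum (Finset.range n) fun i _ =>
        intervalIntegrable_windowCount_mul (R i) η hα _ _)))
    (fun y _ => by simpa using hpt y)
  have hIα : 0 ≤ ∫ y in (p - b)..(q + b), α y :=
    intervalIntegral.integral_nonneg (by linarith) fun y _ => hα0 y
  have hIE' : 0 ≤ ∫ y in (p - b)..(q + b), derivExcess M s f y :=
    intervalIntegral.integral_nonneg (by linarith) fun y _ => hE0 y
  rw [integral_windowCount hη.le (fun z hz => ⟨(hZ z hz).1.1, (hZ z hz).1.2.le⟩) hpq'] at hint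
  refine hint.trans ?_
  have iW := IntervalIntegrable.sum (μ := volume) (a := p - η) (b := q) W
    (fun i _ => intervalIntegrable_windowCount (R i) η _ _)
  have iR := IntervalIntegrable.sum (μ := volume) (a := p - η) (b := q) (Finset.range n)
    (fun i _ => intervalIntegrable_windowCount_mul (R i) η hα _ _)
  have i1 := intervalIntegrable_windowCount Z' η (p - η) q
  have i2 := hψc.intervalIntegrable (μ := volume) (p - η) q
  have i3 := hα.intervalIntegrable (μ := volume) (p - η) q
  have i4 := hαη.intervalIntegrable (μ := volume) (p - η) q
  rw [intervalIntegral.integral_add (i1.add iW) (((i2.add i3).add i4).add iR),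
    intervalIntegral.integral_add i1 iW, intervalIntegral.integral_add ((i2.add i3).add i4) iR,
    intervalIntegral.integral_add (i2.add i3) i4, intervalIntegral.integral_add i2 i3]
  have b1 : ∫ y in (p - η)..q, windowCount Z' η y ≤
      η * (64 * ((∫ y in (p - b)..(q + b), derivExcess M s f y) +
        ∫ y in (p - b)..(q + b), α y)) := by
    rw [integral_windowCount hη.le
      (fun z hz => ⟨(hZ z (hZ'Z hz)).1.1, (hZ z (hZ'Z hz)).1.2.le⟩) hpq']
    refine mul_le_mul_of_nonneg_left (hZ'c.trans ?_) hη.le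
    rw [← intervalIntegral.integral_add (hE.intervalIntegrable _ _) (hα.intervalIntegrable _ _)]
    refine mul_le_mul_of_nonneg_left ?_ (by norm_num)
    exact intervalIntegral.integral_mono_interval (by linarith) hpq' (by linarith)
      (ae_of_all _ fun y => add_nonneg (hE0 y) (hα0 y)) ((hE.add hα).intervalIntegrable _ _)
  have hover := sum_integral_overlapping_le hE hE0 hb0.le p n
  have hoverα := sum_integral_overlapping_le hα hα0 hb0.le p n
  rw [hqn] at hover hoverα
  have hRc : ∀ i, i < n → ((R i).card : ℝ) ≤ 32 * b := fun i hi => hZ'i i hi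
  have b2 : ∫ y in (p - η)..q, (∑ i ∈ W, fun y => windowCount (R i) η y) y ≤
      η * (32 * b * (3 * ∫ y in (p - b)..(q + b), derivExcess M s f y)) := by
    simp only [Finset.sum_apply]
    rw [intervalIntegral.integral_finsetSum fun i _ => intervalIntegrable_windowCount (R i) η _ _]
    calc ∑ i ∈ W, ∫ y in (p - η)..q, windowCount (R i) η y
        ≤ ∑ i ∈ W, η * (32 * b * IE i) := by
          refine Finset.sum_le_sum fun i hi => ?_
          have hi' := Finset.mem_filter.1 hi
          rw [integral_windowCount hη.le (fun z hz =>
            ⟨(hZ z (hRZ i z hz)).1.1, (hZ z (hRZ i z hz)).1.2.le⟩) hpq']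
          refine mul_le_mul_of_nonneg_left ?_ hη.le
          refine (hRc i (Finset.mem_range.1 hi'.1)).trans ?_
          exact le_mul_of_one_le_right (by positivity) hi'.2.le
      _ ≤ ∑ i ∈ Finset.range n, η * (32 * b * IE i) :=
          Finset.sum_le_sum_of_subset_of_nonneg (Finset.filter_subset _ _) fun i _ _ => by
            have := hIE0 i
            positivity
      _ = η * (32 * b * ∑ i ∈ Finset.range n, IE i) := by rw [Finset.mul_sum, Finset.mul_sum]
      _ ≤ _ := by gcongr
  have b3 : ∫ y in (p - η)..q, (∑ i ∈ Finset.range n, fun y => windowCount (R i) η y * α y) y ≤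
      32 * b * (3 * ∫ y in (p - b)..(q + b), α y) := by
    simp only [Finset.sum_apply]
    rw [intervalIntegral.integral_finsetSum fun i _ =>
      intervalIntegrable_windowCount_mul (R i) η hα _ _]
    calc ∑ i ∈ Finset.range n, ∫ y in (p - η)..q, windowCount (R i) η y * α y
        ≤ ∑ i ∈ Finset.range n, 32 * b *
            ∫ y in (p + i * b - b)..(p + i * b + 2 * b), α y := by
          refine Finset.sum_le_sum fun i hi => ?_
          exact windowCount_mul_integral_le (by linarith) (hRu i) (hRc i (Finset.mem_range.1 hi))
            hpη hb0.le hα hα0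
      _ = 32 * b * ∑ i ∈ Finset.range n, ∫ y in (p + i * b - b)..(p + i * b + 2 * b), α y := by
          rw [Finset.mul_sum]
      _ ≤ _ := by gcongr
  have b4 : ∫ y in (p - η)..q, α y ≤ ∫ y in (p - b)..(q + b), α y :=
    intervalIntegral.integral_mono_interval (by linarith) hpη (by linarith) (ae_of_all _ hα0)
      (hα.intervalIntegrable _ _)
  have b5 : ∫ y in (p - η)..q, α (y + η) ≤ ∫ y in (p - b)..(q + b), α y := by
    rw [intervalIntegral.integral_comp_add_right (fun y => α y), sub_add_cancel]
    exact intervalIntegral.integral_mono_interval (by linarith) (by linarith) (by linarith)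
      (ae_of_all _ hα0) (hα.intervalIntegrable _ _)
  have b6 : ∫ y in (p - η)..q, signChange r (f y) (f (y + η)) ≤
      η + ∫ y in p..q, signChange r (f y) (f (y + η)) := by
    rw [← intervalIntegral.integral_add_adjacent_intervals (hψc.intervalIntegrable (p - η) p)
      (hψc.intervalIntegrable p q)]
    have : ∫ y in (p - η)..p, signChange r (f y) (f (y + η)) ≤ ∫ _y in (p - η)..p, (1 : ℝ) :=
      intervalIntegral.integral_mono_on (by linarith) (hψc.intervalIntegrable _ _) (by simp)
        fun y _ => signChange_le_one _ _ _
    rw [intervalIntegral.integral_const, smul_eq_mul, mul_one] at this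
    linarith
  -- Final accounting: `162 = 64 + 96 + 2` for `α` and `160 = 64 + 96` for the derivative excess,
  -- where `96 = 32 · 3` comes from the overlapping cells.
  have c1 : η * (64 * ∫ y in (p - b)..(q + b), α y) ≤ 64 * b * ∫ y in (p - b)..(q + b), α y := by
    have : η * (64 * ∫ y in (p - b)..(q + b), α y) ≤ b * (64 * ∫ y in (p - b)..(q + b), α y) :=
      mul_le_mul_of_nonneg_right (by linarith) (by positivity)
    linarith
  have c2 : η * (64 * ∫ y in (p - b)..(q + b), derivExcess M s f y) ≤
      64 * η * b * ∫ y in (p - b)..(q + b), derivExcess M s f y := by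
    have := mul_le_mul_of_nonneg_right hb
      (by positivity : 0 ≤ η * (64 * ∫ y in (p - b)..(q + b), derivExcess M s f y))
    linarith
  have c3 : 2 * ∫ y in (p - b)..(q + b), α y ≤ 2 * b * ∫ y in (p - b)..(q + b), α y := by
    have := mul_le_mul_of_nonneg_right hb hIα
    linarith
  linarith

theorem integral_signChange_le_mul_card (hf : Continuous f) (hb : 1 ≤ b)
    (hr0 : 0 < r) (hη : 0 < η) (hη1 : η ≤ 1) (hpq : p + b ≤ q)
    (hZ : ∀ z ∈ Z, p ≤ z ∧ z < q) (hZ' : ∀ z, p ≤ z → z < q → f z = 0 → z ∈ Z)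
    (hα : Continuous α) (hα0 : ∀ y, 0 ≤ α y) (hα1 : ∀ y, |f y| ≤ r → 1 ≤ α y) :
    ∫ y in p..q, signChange r (f y) (f (y + η)) ≤ η * Z.card + η +
      2 * ∫ y in (p - b)..(q + b), α y := by
  have hψc : Continuous fun y => signChange r (f y) (f (y + η)) := by
    have := continuous_clampUnit
    unfold signChange
    fun_prop
  have hαη : Continuous fun y => α (y + η) := hα.comp (by fun_prop)
  -- The last stretch of length `η` is split off, because windows starting there leave `[p, q)`; it
  -- costs at most `η`.
  rw [← intervalIntegral.integral_add_adjacent_intervals (hψc.intervalIntegrable p (q - η))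
    (hψc.intervalIntegrable (q - η) q)]
  have h1 : ∫ y in (q - η)..q, signChange r (f y) (f (y + η)) ≤ ∫ _y in (q - η)..q, (1 : ℝ) :=
    intervalIntegral.integral_mono_on (by linarith) (hψc.intervalIntegrable _ _) (by simp)
      fun y _ => signChange_le_one _ _ _
  rw [intervalIntegral.integral_const, smul_eq_mul, mul_one] at h1
  have i1 := intervalIntegrable_windowCount Z η p (q - η)
  have i3 := hα.intervalIntegrable (μ := volume) p (q - η)
  have i4 := hαη.intervalIntegrable (μ := volume) p (q - η)
  have h2 := intervalIntegral.integral_mono_on (μ := volume) (by linarith : p ≤ q - η)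
    (hψc.intervalIntegrable _ _) ((i1.add i3).add i4)
    (fun y hy => signChange_le_windowCount hf hη hr0 (S := Z)
      (fun z hz1 hz2 => hZ' z (hy.1.trans hz1) (by linarith [hy.2])) hα0 hα1)
  rw [intervalIntegral.integral_add (i1.add i3) i4, intervalIntegral.integral_add i1 i3] at h2
  have h3 : ∫ y in p..(q - η), windowCount Z η y ≤ η * Z.card := by
    rw [← integral_windowCount hη.le (fun z hz => ⟨(hZ z hz).1, (hZ z hz).2.le⟩)
      (by linarith : p ≤ q)]
    exact intervalIntegral.integral_mono_interval (by linarith) (by linarith) (by linarith)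
      (ae_of_all _ fun y => windowCount_nonneg _ _ _) (intervalIntegrable_windowCount _ _ _ _)
  have b4 : ∫ y in p..(q - η), α y ≤ ∫ y in (p - b)..(q + b), α y :=
    intervalIntegral.integral_mono_interval (by linarith) (by linarith) (by linarith)
      (ae_of_all _ hα0) (hα.intervalIntegrable _ _)
  have b5 : ∫ y in p..(q - η), α (y + η) ≤ ∫ y in (p - b)..(q + b), α y := by
    rw [intervalIntegral.integral_comp_add_right (fun y => α y), sub_add_cancel]
    exact intervalIntegral.integral_mono_interval (by linarith) (by linarith) (by linarith)
      (ae_of_all _ hα0) (hα.intervalIntegrable _ _)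
  linarith

end

/-! ### The rescaled polynomial and Parseval's identity. -/

noncomputable section

/-- The `m`-th derivative of the rescaled trigonometric polynomial `y ↦ P_n(y / n)`, as a linear
form in the vector `v` of its coefficients. -/
def scaledDeriv (n m : ℕ) (v : Fin n ⊕ Fin n → ℝ) (y : ℝ) : ℝ :=
  (1 / √n) * ∑ j : Fin n, (((j : ℕ) + 1 : ℝ) / n) ^ m *
    (v (Sum.inl j) * Real.cos (((j : ℕ) + 1 : ℝ) / n * y + m * (Real.pi / 2)) +
      v (Sum.inr j) * Real.sin (((j : ℕ) + 1 : ℝ) / n * y + m * (Real.pi / 2)))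

end

section

variable {n : ℕ}

theorem trigPoly_div_eq_scaledDeriv (v : Fin n ⊕ Fin n → ℝ) (y : ℝ) :
    trigPoly n (fun j => v (Sum.inl j)) (fun j => v (Sum.inr j)) (y / n) = scaledDeriv n 0 v y := by
  simp only [trigPoly, scaledDeriv, pow_zero, one_mul, Nat.cast_zero, zero_mul, add_zero]
  refine congrArg _ (Finset.sum_congr rfl fun j _ => ?_)
  rw [show ((j : ℕ) + 1 : ℝ) * (y / n) = ((j : ℕ) + 1 : ℝ) / n * y by ring]

/-- Differentiation multiplies a mode by its frequency and advances its phase by `π / 2`; hence the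
single closed form for all orders. -/
theorem hasDerivAt_scaledDeriv (m : ℕ) (v : Fin n ⊕ Fin n → ℝ) (y : ℝ) :
    HasDerivAt (scaledDeriv n m v) (scaledDeriv n (m + 1) v y) y := by
  unfold scaledDeriv
  refine HasDerivAt.const_mul _ (HasDerivAt.fun_sum fun j _ => ?_)
  set ω := ((j : ℕ) + 1 : ℝ) / n
  have h1 : HasDerivAt (fun y => ω * y + m * (Real.pi / 2)) ω y := by
    simpa using! ((hasDerivAt_id y).const_mul ω).add_const (m * (Real.pi / 2))
  have h2 := (h1.cos.const_mul (v (Sum.inl j))).add (h1.sin.const_mul (v (Sum.inr j)))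
  have h3 := h2.const_mul (ω ^ m)
  convert! h3 using 1
  have e : ω * y + ((m + 1 : ℕ) : ℝ) * (Real.pi / 2) =
      (ω * y + m * (Real.pi / 2)) + Real.pi / 2 := by push_cast; ring
  rw [e, Real.cos_add_pi_div_two, Real.sin_add_pi_div_two, pow_succ]
  ring

theorem iteratedDeriv_scaledDeriv (m : ℕ) (v : Fin n ⊕ Fin n → ℝ) :
    iteratedDeriv m (scaledDeriv n 0 v) = scaledDeriv n m v := by
  induction m with
  | zero => simp
  | succ m ih =>
    rw [iteratedDeriv_succ, ih]
    ext y
    exact (hasDerivAt_scaledDeriv m v y).deriv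

theorem contDiff_scaledDeriv (m : ℕ) (v : Fin n ⊕ Fin n → ℝ) :
    ContDiff ℝ (⊤ : ℕ∞) (scaledDeriv n m v) := by
  unfold scaledDeriv
  fun_prop

theorem continuous_uncurry_scaledDeriv (m : ℕ) :
    Continuous fun p : (Fin n ⊕ Fin n → ℝ) × ℝ => scaledDeriv n m p.1 p.2 := by
  unfold scaledDeriv
  fun_prop

theorem scaledDeriv_add_smul (m : ℕ) (v w : Fin n ⊕ Fin n → ℝ) (s t : ℝ) (y : ℝ) :
    scaledDeriv n m (s • v + t • w) y = s * scaledDeriv n m v y + t * scaledDeriv n m w y := by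
  simp only [scaledDeriv, Finset.mul_sum, ← Finset.sum_add_distrib]
  refine Finset.sum_congr rfl fun j _ => ?_
  simp only [Pi.add_apply, Pi.smul_apply, smul_eq_mul]
  ring

theorem scaledDeriv_sub (m : ℕ) (v w : Fin n ⊕ Fin n → ℝ) (y : ℝ) :
    scaledDeriv n m (v - w) y = scaledDeriv n m v y - scaledDeriv n m w y := by
  have := scaledDeriv_add_smul m v w 1 (-1) y
  simp only [one_smul, neg_smul, one_mul, neg_mul] at this
  rw [sub_eq_add_neg, this, sub_eq_add_neg]

theorem integral_cos_mul_int (N : ℤ) :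
    ∫ x in (-(2 * Real.pi))..(2 * Real.pi), Real.cos (N * x) = if N = 0 then 4 * Real.pi else 0 := by
  split_ifs with h
  · subst h
    simp
    ring
  · have hN : (N : ℝ) ≠ 0 := Int.cast_ne_zero.2 h
    rw [intervalIntegral.integral_comp_mul_left (fun x => Real.cos x) hN, integral_cos]
    have e1 : (N : ℝ) * (2 * Real.pi) = ((2 * N : ℤ) : ℝ) * Real.pi := by push_cast; ring
    have e2 : (N : ℝ) * (-(2 * Real.pi)) = ((-(2 * N) : ℤ) : ℝ) * Real.pi := by push_cast; ring
    rw [e1, e2, Real.sin_int_mul_pi, Real.sin_int_mul_pi]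
    simp

theorem integral_sin_mul_int (N : ℤ) :
    ∫ x in (-(2 * Real.pi))..(2 * Real.pi), Real.sin (N * x) = 0 := by
  have h := intervalIntegral.integral_comp_neg (a := -(2 * Real.pi)) (b := 2 * Real.pi)
    (fun x => Real.sin (N * x))
  simp only [mul_neg, Real.sin_neg, neg_neg, intervalIntegral.integral_neg] at h
  linarith

theorem integral_trig_mul_trig (a b a' b' : ℝ) (p q : ℕ) (hpq : 0 < p + q) :
    ∫ x in (-(2 * Real.pi))..(2 * Real.pi), (a * Real.cos (p * x) + b * Real.sin (p * x)) *
      (a' * Real.cos (q * x) + b' * Real.sin (q * x)) =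
    if p = q then 2 * Real.pi * (a * a' + b * b') else 0 := by
  have e : ∀ x : ℝ, (a * Real.cos (p * x) + b * Real.sin (p * x)) *
      (a' * Real.cos (q * x) + b' * Real.sin (q * x)) =
      (a * a' + b * b') / 2 * Real.cos (((p - q : ℤ) : ℝ) * x) +
      (a * a' - b * b') / 2 * Real.cos (((p + q : ℤ) : ℝ) * x) +
      (a * b' + b * a') / 2 * Real.sin (((p + q : ℤ) : ℝ) * x) +
      (b * a' - a * b') / 2 * Real.sin (((p - q : ℤ) : ℝ) * x) := by
    intro x
    push_cast
    rw [sub_mul (p : ℝ) q x, add_mul (p : ℝ) q x, Real.cos_sub, Real.cos_add, Real.sin_add, Real.sin_sub]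
    ring
  simp_rw [e]
  have hi : ∀ (c : ℝ) (N : ℤ), IntervalIntegrable (fun x => c * Real.cos (N * x)) volume
      (-(2 * Real.pi)) (2 * Real.pi) := fun c N => (by fun_prop : Continuous fun x : ℝ =>
        c * Real.cos (N * x)).intervalIntegrable _ _
  have hi' : ∀ (c : ℝ) (N : ℤ), IntervalIntegrable (fun x => c * Real.sin (N * x)) volume
      (-(2 * Real.pi)) (2 * Real.pi) := fun c N => (by fun_prop : Continuous fun x : ℝ =>
        c * Real.sin (N * x)).intervalIntegrable _ _
  rw [intervalIntegral.integral_add (((hi _ _).add (hi _ _)).add (hi' _ _)) (hi' _ _),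
    intervalIntegral.integral_add ((hi _ _).add (hi _ _)) (hi' _ _),
    intervalIntegral.integral_add (hi _ _) (hi _ _)]
  simp only [intervalIntegral.integral_const_mul, integral_cos_mul_int, integral_sin_mul_int]
  have h1 : ((p : ℤ) + q) ≠ 0 := by omega
  rw [if_neg h1]
  by_cases h : p = q
  · have : (p : ℤ) - q = 0 := by omega
    rw [if_pos this, if_pos h]
    ring
  · have : (p : ℤ) - q ≠ 0 := by omega
    rw [if_neg this, if_neg h]
    ring

/-- Parseval's identity over two periods. -/
theorem integral_trigPoly_sq (a b : Fin n → ℝ) :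
    ∫ x in (-(2 * Real.pi))..(2 * Real.pi), trigPoly n a b x ^ 2 =
      2 * Real.pi / n * ∑ j, (a j ^ 2 + b j ^ 2) := by
  have e : ∀ x, trigPoly n a b x ^ 2 = 1 / n * ∑ i : Fin n, ∑ j : Fin n,
      (a i * Real.cos (((i + 1 : ℕ) : ℝ) * x) + b i * Real.sin (((i + 1 : ℕ) : ℝ) * x)) *
      (a j * Real.cos (((j + 1 : ℕ) : ℝ) * x) + b j * Real.sin (((j + 1 : ℕ) : ℝ) * x)) := by
    intro x
    simp only [trigPoly]
    rw [mul_pow, div_pow, one_pow, Real.sq_sqrt (Nat.cast_nonneg _), sq (∑ j : Fin n, _),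
      Finset.sum_mul_sum]
    push_cast
    rfl
  simp_rw [e]
  rw [intervalIntegral.integral_const_mul, intervalIntegral.integral_finsetSum]
  · have h2 : ∀ i : Fin n, ∫ x in (-(2 * Real.pi))..(2 * Real.pi), ∑ j : Fin n,
        (a i * Real.cos (((i + 1 : ℕ) : ℝ) * x) + b i * Real.sin (((i + 1 : ℕ) : ℝ) * x)) *
        (a j * Real.cos (((j + 1 : ℕ) : ℝ) * x) + b j * Real.sin (((j + 1 : ℕ) : ℝ) * x)) =
        2 * Real.pi * (a i ^ 2 + b i ^ 2) := by
      intro i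
      rw [intervalIntegral.integral_finsetSum]
      · rw [Finset.sum_congr rfl fun j _ => integral_trig_mul_trig _ _ _ _ _ _ (by omega)]
        have h3 : ∀ j : Fin n, ((i : ℕ) + 1 = (j : ℕ) + 1) ↔ i = j := fun j => by
          rw [Nat.add_right_cancel_iff, Fin.val_inj]
        simp_rw [h3]
        rw [Finset.sum_ite_eq Finset.univ i]
        simp
        ring
      · intro j _
        exact (by fun_prop : Continuous fun x : ℝ => (a i * Real.cos (((i + 1 : ℕ) : ℝ) * x) +
          b i * Real.sin (((i + 1 : ℕ) : ℝ) * x)) * (a j * Real.cos (((j + 1 : ℕ) : ℝ) * x) +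
          b j * Real.sin (((j + 1 : ℕ) : ℝ) * x))).intervalIntegrable _ _
    simp_rw [h2]
    rw [← Finset.mul_sum]
    ring
  · intro i _
    exact (by fun_prop : Continuous fun x : ℝ => ∑ j : Fin n,
      (a i * Real.cos (((i + 1 : ℕ) : ℝ) * x) +
      b i * Real.sin (((i + 1 : ℕ) : ℝ) * x)) * (a j * Real.cos (((j + 1 : ℕ) : ℝ) * x) +
      b j * Real.sin (((j + 1 : ℕ) : ℝ) * x))).intervalIntegrable _ _

theorem frequency_mem (hn : 0 < n) (j : Fin n) :
    0 ≤ ((j : ℕ) + 1 : ℝ) / n ∧ ((j : ℕ) + 1 : ℝ) / n ≤ 1 := by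
  have hn' : (0 : ℝ) < n := Nat.cast_pos.2 hn
  refine ⟨by positivity, (div_le_one hn').2 ?_⟩
  exact_mod_cast j.2

/-- The phase shift rotates each pair of coefficients and the factor `ω^m ≤ 1` contracts it, so
Parseval applies to the new coefficients. -/
theorem integral_scaledDeriv_sq_le (hn : 0 < n) (m : ℕ) (v : Fin n ⊕ Fin n → ℝ) :
    ∫ y in (-(2 * Real.pi * n))..(2 * Real.pi * n), scaledDeriv n m v y ^ 2 ≤
      2 * Real.pi * ∑ i, v i ^ 2 := by
  have hn' : (0 : ℝ) < n := Nat.cast_pos.2 hn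
  set φ := m * (Real.pi / 2)
  set ω : Fin n → ℝ := fun j => ((j : ℕ) + 1 : ℝ) / n with hω
  have e : ∀ y, scaledDeriv n m v y = trigPoly n
      (fun j => ω j ^ m * (v (Sum.inl j) * Real.cos φ + v (Sum.inr j) * Real.sin φ))
      (fun j => ω j ^ m * (v (Sum.inr j) * Real.cos φ - v (Sum.inl j) * Real.sin φ)) (y / n) := by
    intro y
    simp only [scaledDeriv, trigPoly, hω]
    congr 1
    refine Finset.sum_congr rfl fun j _ => ?_
    have : ((j : ℕ) + 1 : ℝ) * (y / n) = ((j : ℕ) + 1 : ℝ) / n * y := by ring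
    rw [this, Real.cos_add, Real.sin_add]
    ring
  simp_rw [e]
  rw [intervalIntegral.integral_comp_div (fun x => trigPoly n _ _ x ^ 2) hn'.ne']
  have e2 : -(2 * Real.pi * n) / n = -(2 * Real.pi) := by field_simp
  have e3 : 2 * Real.pi * n / n = 2 * Real.pi := by field_simp
  rw [e2, e3, integral_trigPoly_sq, smul_eq_mul, Fintype.sum_sum_type, ← Finset.sum_add_distrib]
  have e4 : ∀ S : ℝ, (n : ℝ) * (2 * Real.pi / n * S) = 2 * Real.pi * S := fun S => by field_simp
  rw [e4]
  refine mul_le_mul_of_nonneg_left (Finset.sum_le_sum fun j _ => ?_) (by positivity)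
  have h1 := frequency_mem hn j
  have h2 : (ω j ^ m) ^ 2 ≤ 1 := pow_le_one₀ (pow_nonneg h1.1 _) (pow_le_one₀ h1.1 h1.2)
  have h3 : (ω j ^ m * (v (Sum.inl j) * Real.cos φ + v (Sum.inr j) * Real.sin φ)) ^ 2 +
      (ω j ^ m * (v (Sum.inr j) * Real.cos φ - v (Sum.inl j) * Real.sin φ)) ^ 2 =
      (ω j ^ m) ^ 2 * (v (Sum.inl j) ^ 2 + v (Sum.inr j) ^ 2) := by
    linear_combination (ω j ^ m) ^ 2 * (v (Sum.inl j) ^ 2 + v (Sum.inr j) ^ 2) *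
      Real.sin_sq_add_cos_sq φ
  rw [h3]
  exact mul_le_of_le_one_left (by positivity) h2

/-- Cauchy–Schwarz on an interval of length `4πn`, with constant `2√2 π ≤ 9`. It is the source of
all the Lipschitz constants of order `√n`. -/
theorem integral_abs_scaledDeriv_le (hn : 0 < n) (m : ℕ) (v : Fin n ⊕ Fin n → ℝ) :
    ∫ y in (-(2 * Real.pi * n))..(2 * Real.pi * n), |scaledDeriv n m v y| ≤
      9 * √n * √(∑ i, v i ^ 2) := by
  have hn' : (0 : ℝ) < n := Nat.cast_pos.2 hn
  have hc : Continuous (scaledDeriv n m v) := (contDiff_scaledDeriv m v).continuous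
  have hle : -(2 * Real.pi * n) ≤ 2 * Real.pi * n := by
    have : 0 ≤ 2 * Real.pi * n := by positivity
    linarith
  set S := √(∑ i, v i ^ 2) with hS
  have hS2 : S ^ 2 = ∑ i, v i ^ 2 := Real.sq_sqrt (Finset.sum_nonneg fun i _ => sq_nonneg _)
  have hsq := integral_scaledDeriv_sq_le hn m v
  rw [← hS2] at hsq
  rcases (Real.sqrt_nonneg (∑ i, v i ^ 2)).eq_or_lt with h0 | h0
  · have hS0 : S = 0 := h0.symm
    have hv : v = 0 := by
      have h1 : ∑ i, v i ^ 2 = 0 := by rw [← hS2, hS0]; ring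
      ext i
      have := (Finset.sum_eq_zero_iff_of_nonneg (fun i _ => sq_nonneg (v i))).1 h1 i
        (Finset.mem_univ i)
      simpa using this
    rw [hS0, hv]
    simp [scaledDeriv]
  · have hS0 : 0 < S := h0
    -- `|g| ≤ g² / (2t) + t / 2` with the optimal constant `t`
    set t := S / √n with ht
    have hsn : 0 < √(n : ℝ) := Real.sqrt_pos.2 hn'
    have ht0 : 0 < t := by positivity
    have h1 : ∫ y in (-(2 * Real.pi * n))..(2 * Real.pi * n), |scaledDeriv n m v y| ≤
        ∫ y in (-(2 * Real.pi * n))..(2 * Real.pi * n),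
          (1 / (√2 * t) * scaledDeriv n m v y ^ 2 + √2 * t / 4) := by
      refine intervalIntegral.integral_mono_on hle (hc.abs.intervalIntegrable _ _)
        ((by fun_prop : Continuous fun y => 1 / (√2 * t) * scaledDeriv n m v y ^ 2 +
          √2 * t / 4).intervalIntegrable _ _) fun y _ => ?_
      have h2 : 0 < √2 * t := by positivity
      have h3 : 1 / (√2 * t) * scaledDeriv n m v y ^ 2 + √2 * t / 4 - |scaledDeriv n m v y| =
          (|scaledDeriv n m v y| - √2 * t / 2) ^ 2 / (√2 * t) := by
        rw [← sq_abs (scaledDeriv n m v y)]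
        field_simp
        ring
      have h4 : 0 ≤ (|scaledDeriv n m v y| - √2 * t / 2) ^ 2 / (√2 * t) := by positivity
      linarith
    refine h1.trans ?_
    rw [intervalIntegral.integral_add ((by fun_prop : Continuous fun y =>
      1 / (√2 * t) * scaledDeriv n m v y ^ 2).intervalIntegrable _ _) (by simp),
      intervalIntegral.integral_const_mul, intervalIntegral.integral_const, smul_eq_mul]
    have h5 := mul_le_mul_of_nonneg_left hsq (by positivity : 0 ≤ 1 / (√2 * t))
    have hsn2 : √(n : ℝ) ^ 2 = n := Real.sq_sqrt hn'.le
    have h6 : 1 / (√2 * t) * (2 * Real.pi * S ^ 2) +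
        (2 * Real.pi * n - -(2 * Real.pi * n)) * (√2 * t / 4) = 2 * √2 * Real.pi * (√n * S) := by
      have h2s : √2 ^ 2 = (2 : ℝ) := Real.sq_sqrt (by norm_num)
      rw [ht]
      field_simp
      rw [h2s, hsn2]
      ring
    have h7 : 2 * √2 * Real.pi ≤ 9 := by
      have h8 : √2 ≤ 1.4143 := by
        rw [Real.sqrt_le_left (by norm_num)]; norm_num
      have := Real.pi_lt_d2
      nlinarith [Real.pi_pos]
    have h9 : 2 * √2 * Real.pi * (√n * S) ≤ 9 * (√n * S) :=
      mul_le_mul_of_nonneg_right h7 (by positivity)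
    linarith

end

/-! ### Finiteness and measurability of the root count. -/

section

variable {n : ℕ}

/-- The algebraic polynomial `Q` of degree at most `2n` with
`Q (e^{ix}) = e^{inx} ∑ (a_k cos (k x) + b_k sin (k x))`. -/
theorem exists_polynomial_eval_exp (a b : Fin n → ℝ) :
    ∃ Q : Polynomial ℂ, Q.natDegree ≤ 2 * n ∧ ∀ x : ℝ,
      Q.eval (Complex.exp (x * Complex.I)) = Complex.exp (n * (x * Complex.I)) *
        ((∑ j : Fin n, (a j * Real.cos (((j : ℕ) + 1 : ℝ) * x) +
          b j * Real.sin (((j : ℕ) + 1 : ℝ) * x)) : ℝ) : ℂ) := by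
  refine ⟨∑ j : Fin n, (Polynomial.C (a j / 2 - b j / 2 * Complex.I) *
      Polynomial.X ^ (n + (j + 1)) +
    Polynomial.C (a j / 2 + b j / 2 * Complex.I) * Polynomial.X ^ (n - (j + 1))), ?_, fun x => ?_⟩
  · refine Polynomial.natDegree_sum_le_of_forall_le _ _ fun j _ =>
      (Polynomial.natDegree_add_le _ _).trans (max_le ?_ ?_)
    · exact (Polynomial.natDegree_C_mul_X_pow_le _ _).trans (by omega)
    · exact (Polynomial.natDegree_C_mul_X_pow_le _ _).trans (by omega)
  · rw [Polynomial.eval_finsetSum, Complex.ofReal_sum, Finset.mul_sum]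
    refine Finset.sum_congr rfl fun j _ => ?_
    simp only [Polynomial.eval_add, Polynomial.eval_mul, Polynomial.eval_C, Polynomial.eval_pow,
      Polynomial.eval_X]
    have hj : ((n - ((j : ℕ) + 1) : ℕ) : ℂ) = n - ((j : ℕ) + 1) := by
      rw [Nat.cast_sub j.2]; push_cast; rfl
    rw [← Complex.exp_nat_mul, ← Complex.exp_nat_mul, hj]
    push_cast
    rw [Complex.cos, Complex.sin, add_mul (n : ℂ), sub_mul (n : ℂ), Complex.exp_add,
      sub_eq_add_neg ((n : ℂ) * _), Complex.exp_add,
      show (((j : ℕ) : ℂ) + 1) * (x * Complex.I) = (((j : ℕ) : ℂ) + 1) * x * Complex.I by ring,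
      show -((((j : ℕ) : ℂ) + 1) * x * Complex.I) = -((((j : ℕ) : ℂ) + 1) * x) * Complex.I by ring]
    ring

/-- On a half-open period `x ↦ exp (i x)` is injective and sends roots to roots of an algebraic
polynomial of degree at most `2n`. -/
theorem trigPoly_eq_zero_or_card_le (a b : Fin n → ℝ) :
    (∀ x, trigPoly n a b x = 0) ∨ ∀ Z : Finset ℝ,
      (∀ z ∈ Z, z ∈ Set.Ico (-Real.pi) Real.pi ∧ trigPoly n a b z = 0) → Z.card ≤ 2 * n := by
  obtain ⟨Q, hQd, hQ⟩ := exists_polynomial_eval_exp a b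
  by_cases h0 : Q = 0
  · left
    intro x
    have h1 := hQ x
    rw [h0, Polynomial.eval_zero] at h1
    have h2 := (mul_eq_zero.1 h1.symm).resolve_left (Complex.exp_ne_zero _)
    rw [trigPoly, Complex.ofReal_eq_zero.1 h2, mul_zero]
  · right
    intro Z hZ
    rcases Nat.eq_zero_or_pos n with hn | hn
    · subst hn
      exfalso
      apply h0
      obtain ⟨c, rfl⟩ := Polynomial.natDegree_eq_zero.1 (Nat.le_zero.1 hQd)
      simpa using hQ 0
    have hinj : Set.InjOn (fun x : ℝ => Complex.exp (x * Complex.I)) Z := by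
      intro x hx y hy hxy
      have hx' := (hZ x hx).1
      have hy' := (hZ y hy).1
      -- The signs are reversed because injectivity is available on `(-π, π]`, whereas the roots lie
      -- in `[-π, π)`.
      have h1 : Complex.exp (-(x * Complex.I)) = Complex.exp (-(y * Complex.I)) := by
        rw [Complex.exp_neg, Complex.exp_neg]
        exact congrArg _ hxy
      have h2 := Complex.exp_inj_of_neg_pi_lt_of_le_pi (by simpa using hx'.2)
        (by simpa using neg_le.1 hx'.1) (by simpa using hy'.2) (by simpa using neg_le.1 hy'.1) h1
      have h3 := mul_right_cancel₀ Complex.I_ne_zero (neg_injective h2)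
      exact Complex.ofReal_injective h3
    rw [← Finset.card_image_of_injOn hinj]
    refine le_trans ?_ ((Polynomial.card_roots' Q).trans hQd)
    refine le_trans (Finset.card_le_card ?_) (Multiset.toFinset_card_le Q.roots)
    intro w hw
    obtain ⟨z, hz, rfl⟩ := Finset.mem_image.1 hw
    rw [Multiset.mem_toFinset, Polynomial.mem_roots h0, Polynomial.IsRoot, hQ]
    have h2 := (hZ z hz).2
    rw [trigPoly] at h2
    have h3 : (1 / √(n : ℝ)) ≠ 0 := by
      have : 0 < √(n : ℝ) := Real.sqrt_pos.2 (Nat.cast_pos.2 hn)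
      positivity
    rw [(mul_eq_zero.1 h2).resolve_left h3]
    simp

/-- The convention for the zero polynomial is realised by `ncard`, which is `0` on infinite sets. -/
theorem rootCount_eq_zero_of_forall (a b : Fin n → ℝ) (h : ∀ x, trigPoly n a b x = 0) :
    rootCount n a b = 0 := by
  rw [rootCount]
  refine Set.Infinite.ncard (Set.Infinite.mono (s := Set.Icc (-Real.pi) Real.pi)
    (fun x hx => ⟨hx, h x⟩) (Set.Icc_infinite ?_))
  linarith [Real.pi_pos]

/-- The roots in the half-open period form a finite set, which differs from the set counted by
`rootCount` by at most one point. -/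
theorem exists_finset_roots (a b : Fin n → ℝ) (h : ¬ ∀ x, trigPoly n a b x = 0) :
    ∃ Z : Finset ℝ, (∀ z, z ∈ Z ↔ z ∈ Set.Ico (-Real.pi) Real.pi ∧ trigPoly n a b z = 0) ∧
      Z.card ≤ 2 * n ∧ Z.card ≤ rootCount n a b ∧ rootCount n a b ≤ Z.card + 1 := by
  have hb := (trigPoly_eq_zero_or_card_le a b).resolve_left h
  set S := {z : ℝ | z ∈ Set.Ico (-Real.pi) Real.pi ∧ trigPoly n a b z = 0} with hS
  have hfin : S.Finite := by
    by_contra hinf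
    obtain ⟨Z, hZ, hc⟩ := Set.Infinite.exists_subset_card_eq hinf (2 * n + 1)
    have := hb Z fun z hz => hZ hz
    omega
  refine ⟨hfin.toFinset, fun z => by simp [hS], hb _ fun z hz => by simpa [hS] using hz, ?_, ?_⟩
  · rw [← Set.ncard_eq_toFinset_card S hfin, rootCount]
    refine Set.ncard_le_ncard (fun x hx => ⟨⟨hx.1.1, hx.1.2.le⟩, hx.2⟩) ?_
    refine (hfin.insert Real.pi).subset fun x hx => ?_
    rcases hx.1.2.eq_or_lt with h1 | h1
    · exact Or.inl h1
    · exact Or.inr ⟨⟨hx.1.1, h1⟩, hx.2⟩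
  · rw [← Set.ncard_eq_toFinset_card S hfin, rootCount]
    refine le_trans (Set.ncard_le_ncard (t := insert Real.pi S) (fun x hx => ?_)
      (hfin.insert Real.pi)) (Set.ncard_insert_le _ _)
    rcases hx.1.2.eq_or_lt with h1 | h1
    · exact Or.inl h1
    · exact Or.inr ⟨⟨hx.1.1, h1⟩, hx.2⟩

theorem rootCount_le (a b : Fin n → ℝ) : rootCount n a b ≤ 2 * n + 1 := by
  by_cases h : ∀ x, trigPoly n a b x = 0
  · rw [rootCount_eq_zero_of_forall a b h]
    omega
  · obtain ⟨Z, -, h1, -, h2⟩ := exists_finset_roots a b h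
    omega

end

section

/-- The number of zeros in a compact set of a function depending continuously on a parameter is a
measurable function of the parameter. -/
theorem measurable_ncard_zeros {V : Type*} [TopologicalSpace V] [MeasurableSpace V]
    [OpensMeasurableSpace V] {K : Set ℝ} (hK : IsCompact K) {F : V → ℝ → ℝ}
    (hF : Continuous fun p : V × ℝ => F p.1 p.2) :
    Measurable fun v => {x : ℝ | x ∈ K ∧ F v x = 0}.ncard := by
  set S : V → Set ℝ := fun v => {x : ℝ | x ∈ K ∧ F v x = 0} with hS
  have hmeas : ∀ k : ℕ, MeasurableSet {v | (k : ℕ∞) ≤ (S v).encard} := by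
    intro k
    have : CompactSpace K := isCompact_iff_compactSpace.1 hK
    -- Having `k` zeros means having `k` zeros at mutual distance at least `1 / (j + 1)` for some
    -- `j`. For fixed `j` this is a closed condition, and projecting along a compact factor keeps it
    -- closed.
    have e : {v | (k : ℕ∞) ≤ (S v).encard} = ⋃ j : ℕ, Prod.fst ''
        {p : V × (Fin k → K) | (∀ i, F p.1 (p.2 i) = 0) ∧
          ∀ i i', i ≠ i' → 1 / ((j : ℝ) + 1) ≤ |(p.2 i : ℝ) - p.2 i'|} := by
      ext v
      simp only [Set.mem_ofPred_eq, Set.mem_iUnion, Set.mem_image, Prod.exists,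
        exists_and_right, exists_eq_right]
      constructor
      · intro h
        obtain ⟨t, ht, htc⟩ := Set.exists_subset_encard_eq h
        have htf : t.Finite := Set.finite_of_encard_eq_coe htc
        have hcard : htf.toFinset.card = k := by
          rw [htf.encard_eq_coe_toFinset_card] at htc
          exact_mod_cast htc
        set z := htf.toFinset.equivFinOfCardEq hcard |>.symm with hz
        have hzt : ∀ i, (z i : ℝ) ∈ S v := fun i => ht (htf.mem_toFinset.1 (z i).2)
        obtain ⟨δ, hδ, hgap⟩ : ∃ δ > 0, ∀ i i', i ≠ i' → δ ≤ |(z i : ℝ) - z i'| := by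
          by_cases hne : ((Finset.univ : Finset (Fin k × Fin k)).filter
              fun p => p.1 ≠ p.2).Nonempty
          · obtain ⟨p, hp, hmin⟩ := Finset.exists_min_image _
              (fun p : Fin k × Fin k => |(z p.1 : ℝ) - z p.2|) hne
            refine ⟨|(z p.1 : ℝ) - z p.2|, ?_, fun i i' hii => hmin (i, i') (by simpa using hii)⟩
            rw [gt_iff_lt, abs_pos, sub_ne_zero]
            intro h1
            have h2 : p.1 ≠ p.2 := by simpa using hp
            exact h2 (z.injective (Subtype.ext h1))
          · refine ⟨1, one_pos, fun i i' hii => absurd ⟨(i, i'), by simpa using hii⟩ hne⟩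
        obtain ⟨j, hj⟩ := exists_nat_one_div_lt hδ
        exact ⟨j, fun i => ⟨z i, (hzt i).1⟩, fun i => (hzt i).2,
          fun i i' hii => hj.le.trans (hgap i i' hii)⟩
      · rintro ⟨j, z, h1, h2⟩
        have hinj : Function.Injective fun i => (z i : ℝ) := by
          intro i i' hii
          by_contra hne
          have h3 := h2 i i' hne
          have h4 : (z i : ℝ) = z i' := hii
          rw [h4, sub_self, abs_zero] at h3
          have : 0 < 1 / ((j : ℝ) + 1) := by positivity
          linarith
        have h5 : (Set.range fun i => (z i : ℝ)) ⊆ S v := by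
          rintro _ ⟨i, rfl⟩
          exact ⟨(z i).2, h1 i⟩
        refine le_trans ?_ (Set.encard_le_encard h5)
        rw [← Set.image_univ, hinj.encard_image]
        simp
    rw [e]
    refine MeasurableSet.iUnion fun j => IsClosed.measurableSet ?_
    refine isClosedMap_fst_of_compactSpace _ ?_
    have c1 : IsClosed {p : V × (Fin k → K) | ∀ i, F p.1 (p.2 i) = 0} := by
      rw [Set.ofPred_forall]
      refine isClosed_iInter fun i => isClosed_eq ?_ continuous_const
      exact hF.comp (by fun_prop : Continuous fun p : V × (Fin k → K) => (p.1, ((p.2 i : K) : ℝ)))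
    have c2 : IsClosed {p : V × (Fin k → K) |
        ∀ i i', i ≠ i' → 1 / ((j : ℝ) + 1) ≤ |(p.2 i : ℝ) - p.2 i'|} := by
      simp only [Set.ofPred_forall]
      exact isClosed_iInter fun i => isClosed_iInter fun i' => isClosed_iInter fun _ =>
        isClosed_le continuous_const (by fun_prop)
    exact c1.inter c2
  have hsucc : ∀ m : ℕ, MeasurableSet ((fun v => (S v).ncard) ⁻¹' {m + 1}) := by
    intro m
    have e : (fun v => (S v).ncard) ⁻¹' {m + 1} =
        {v | ((m + 1 : ℕ) : ℕ∞) ≤ (S v).encard} \ {v | ((m + 2 : ℕ) : ℕ∞) ≤ (S v).encard} := by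
      ext v
      simp only [Set.mem_preimage, Set.mem_singleton_iff, Set.mem_sdiff, Set.mem_ofPred_eq]
      by_cases hf : (S v).Finite
      · rw [← hf.cast_ncard_eq]
        norm_cast
        omega
      -- For infinitely many zeros `ncard` is `0` and `encard` is `⊤`, so neither side contains `v`.
      · rw [Set.Infinite.ncard hf, Set.Infinite.encard_eq hf]
        simp
    rw [e]
    exact (hmeas _).diff (hmeas _)
  refine measurable_to_countable' fun m => ?_
  rcases m with _ | m
  · have e : (fun v => (S v).ncard) ⁻¹' {0} = (⋃ m : ℕ, (fun v => (S v).ncard) ⁻¹' {m + 1})ᶜ := by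
      ext v
      simp only [Set.mem_preimage, Set.mem_singleton_iff, Set.mem_compl_iff, Set.mem_iUnion]
      constructor
      · intro h
        simp [h]
      · intro h
        by_contra h0
        exact h ⟨(S v).ncard - 1, by omega⟩
    rw [e]
    exact (MeasurableSet.iUnion hsucc).compl
  · exact hsucc m

theorem measurable_rootCount (n : ℕ) :
    Measurable fun v : Fin n ⊕ Fin n → ℝ =>
      rootCount n (fun j => v (Sum.inl j)) (fun j => v (Sum.inr j)) := by
  let F : (Fin n ⊕ Fin n → ℝ) → ℝ → ℝ := fun v x =>
    trigPoly n (fun j => v (Sum.inl j)) (fun j => v (Sum.inr j)) x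
  have hF : Continuous fun p : (Fin n ⊕ Fin n → ℝ) × ℝ => F p.1 p.2 := by
    simp only [F]
    unfold trigPoly
    fun_prop
  have h := measurable_ncard_zeros (V := Fin n ⊕ Fin n → ℝ)
    (isCompact_Icc (a := -Real.pi) (b := Real.pi)) hF
  simpa only [rootCount] using h

end

/-! ### Root count against the smoothed sign-change statistic. -/

noncomputable section

/-- A continuous function with `1[|x| ≤ 1] ≤ nearZero x ≤ 1[|x| ≤ 2]`. -/
def nearZero (x : ℝ) : ℝ := 1 + max (|x| - 2) 0 - max (|x| - 1) 0

end

section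

theorem continuous_nearZero : Continuous nearZero := by unfold nearZero; fun_prop

theorem nearZero_nonneg (x : ℝ) : 0 ≤ nearZero x := by
  unfold nearZero
  rcases max_cases (|x| - 2) 0 with h | h <;> rcases max_cases (|x| - 1) 0 with h' | h' <;> linarith

theorem nearZero_le_indicator (x : ℝ) : nearZero x ≤ Set.indicator {x : ℝ | |x| ≤ 2} 1 x := by
  unfold nearZero Set.indicator
  split_ifs with h <;> simp only [Set.mem_ofPred_eq, Pi.one_apply] at * <;>
  rcases max_cases (|x| - 2) 0 with h | h <;> rcases max_cases (|x| - 1) 0 with h' | h' <;> linarith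

theorem nearZero_of_abs_le_one {x : ℝ} (hx : |x| ≤ 1) : nearZero x = 1 := by
  unfold nearZero
  rw [max_eq_right (by linarith), max_eq_right (by linarith)]
  ring

/-- The upper and lower window comparisons are divided by `η`. The summand 2 covers one boundary
window and a possible root at the endpoint `π`; `hk` gives `b ≤ πn`, so the enlarged interval fits
into two periods. -/
theorem abs_rootCount_sub_le {n k : ℕ} (hn : 0 < n) (hk : 1 ≤ k) {b r s η : ℝ}
    (hbk : b * 2 ^ k = 2 * Real.pi * n) (hb : 1 ≤ b)
    (hs : 0 ≤ s) (hsb : s ≤ b) (hr0 : 0 < r) (hr : ∀ m : ℕ, b ≤ m → 6 * (1 / 2 : ℝ) ^ m ≤ r)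
    (hη : 0 < η) (hη1 : η ≤ 1) (hηr : η ^ 2 * (6 * s * b + 16) ≤ r) (v : Fin n ⊕ Fin n → ℝ) :
    |(rootCount n (fun j => v (Sum.inl j)) (fun j => v (Sum.inr j)) : ℝ) -
      η⁻¹ * ∫ y in (-(Real.pi * n))..(Real.pi * n),
        signChange r (scaledDeriv n 0 v y) (scaledDeriv n 0 v (y + η))| ≤
    2 + 162 * b / η * (∫ y in (-(2 * Real.pi * n))..(2 * Real.pi * n),
        nearZero (scaledDeriv n 0 v y / r)) +
      160 * b * ∫ y in (-(2 * Real.pi * n))..(2 * Real.pi * n),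
        derivExcess (2 * n + 3) s (scaledDeriv n 0 v) y := by
  have hn' : (0 : ℝ) < n := Nat.cast_pos.2 hn
  have hpn : 0 < Real.pi * n := by positivity
  set f := scaledDeriv n 0 v with hf
  have hfd : ContDiff ℝ (⊤ : ℕ∞) f := contDiff_scaledDeriv 0 v
  set α : ℝ → ℝ := fun y => nearZero (f y / r) with hα
  have hαc : Continuous α := continuous_nearZero.comp (hfd.continuous.div_const r)
  have hα0 : ∀ y, 0 ≤ α y := fun y => nearZero_nonneg _
  have hα1 : ∀ y, |f y| ≤ r → 1 ≤ α y := by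
    intro y hy
    refine (nearZero_of_abs_le_one ?_).ge
    rw [abs_div, abs_of_pos hr0]
    exact (div_le_one hr0).2 hy
  have hEc := continuous_derivExcess (M := 2 * n + 3) (s := s) hfd
  have hE0 : ∀ y, 0 ≤ derivExcess (2 * n + 3) s f y := derivExcess_nonneg
  have hb2 : b ≤ Real.pi * n := by
    have h1 : (2 : ℝ) ≤ 2 ^ k := by simpa using pow_le_pow_right₀ (one_le_two (α := ℝ)) hk
    nlinarith
  have hext : ∀ g : ℝ → ℝ, Continuous g → (∀ y, 0 ≤ g y) →
      ∫ y in (-(Real.pi * n) - b)..(Real.pi * n + b), g y ≤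
        ∫ y in (-(2 * Real.pi * n))..(2 * Real.pi * n), g y := by
    intro g hg hg0
    exact intervalIntegral.integral_mono_interval (by linarith) (by linarith) (by linarith)
      (Filter.Eventually.of_forall hg0) (hg.intervalIntegrable _ _)
  have hA := hext α hαc hα0
  have hD := hext _ hEc hE0
  have hA0 : 0 ≤ ∫ y in (-(Real.pi * n) - b)..(Real.pi * n + b), α y :=
    intervalIntegral.integral_nonneg (by linarith) fun y _ => hα0 y
  have hD0 : 0 ≤ ∫ y in (-(Real.pi * n) - b)..(Real.pi * n + b), derivExcess (2 * n + 3) s f y :=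
    intervalIntegral.integral_nonneg (by linarith) fun y _ => hE0 y
  set A := ∫ y in (-(2 * Real.pi * n))..(2 * Real.pi * n), α y
  set D := ∫ y in (-(2 * Real.pi * n))..(2 * Real.pi * n), derivExcess (2 * n + 3) s f y
  have hA' : 0 ≤ 162 * b / η * A := mul_nonneg (by positivity) (hA0.trans hA)
  have hD' : 0 ≤ 160 * b * D := mul_nonneg (by positivity) (hD0.trans hD)
  by_cases h0 : ∀ x, trigPoly n (fun j => v (Sum.inl j)) (fun j => v (Sum.inr j)) x = 0
  · have hf0 : ∀ y, f y = 0 := fun y => by rw [hf, ← trigPoly_div_eq_scaledDeriv, h0]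
    rw [rootCount_eq_zero_of_forall _ _ h0]
    simp only [hf0, signChange, sub_self, abs_zero, zero_div, intervalIntegral.integral_zero]
    simp only [mul_zero, Nat.cast_zero, sub_zero, abs_zero]
    positivity
  · obtain ⟨Z₀, hZ₀, hc, hlo, hhi⟩ := exists_finset_roots _ _ h0
    set Z := Z₀.image fun x : ℝ => x * (n : ℝ) with hZ
    have hcard : Z.card = Z₀.card :=
      Finset.card_image_of_injective _ (mul_left_injective₀ hn'.ne')
    have hmem : ∀ z, z ∈ Z ↔ (-(Real.pi * n) ≤ z ∧ z < Real.pi * n) ∧ f z = 0 := by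
      intro z
      rw [hZ, Finset.mem_image]
      constructor
      · rintro ⟨x, hx, rfl⟩
        obtain ⟨⟨h1, h2⟩, h3⟩ := (hZ₀ x).1 hx
        refine ⟨⟨by nlinarith, by nlinarith⟩, ?_⟩
        rw [hf, ← trigPoly_div_eq_scaledDeriv, mul_div_cancel_right₀ _ hn'.ne', h3]
      · rintro ⟨⟨h1, h2⟩, h3⟩
        refine ⟨z / n, (hZ₀ _).2 ⟨⟨?_, ?_⟩, ?_⟩, div_mul_cancel₀ _ hn'.ne'⟩
        · rw [le_div_iff₀ hn']; linarith
        · rw [div_lt_iff₀ hn']; linarith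
        · rw [trigPoly_div_eq_scaledDeriv]; exact h3
    have hcR : (Z₀.card : ℝ) ≤ 2 * n := by exact_mod_cast hc
    have hpi := Real.pi_gt_three
    -- There are at most `2n` roots, so derivatives up to order `2n + 3` suffice, and `2n < 64 ·
    -- 2πn` starts the dyadic decomposition.
    have up := mul_card_le_integral_signChange (Z := Z) (M := 2 * n + 3) (k := k)
      (p := -(Real.pi * n)) (q := Real.pi * n) hfd hb hs hsb hr0 hr hη hη1 hηr (by omega)
      (by omega) (by rw [hbk]; ring) (fun z hz => (hmem z).1 hz)
      (by rw [hcard, hbk]; nlinarith) hαc hα0 hα1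
    have lo := integral_signChange_le_mul_card (Z := Z) (p := -(Real.pi * n)) (q := Real.pi * n)
      hfd.continuous hb hr0 hη hη1 (by linarith) (fun z hz => ((hmem z).1 hz).1)
      (fun z h1 h2 h3 => (hmem z).2 ⟨⟨h1, h2⟩, h3⟩) hαc hα0 hα1
    rw [hcard] at up lo
    set I := ∫ y in (-(Real.pi * n))..(Real.pi * n), signChange r (f y) (f (y + η))
    have hlo' : (Z₀.card : ℝ) ≤ rootCount n (fun j => v (Sum.inl j)) (fun j => v (Sum.inr j)) := by
      exact_mod_cast hlo
    have hhi' : (rootCount n (fun j => v (Sum.inl j)) (fun j => v (Sum.inr j)) : ℝ) ≤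
        Z₀.card + 1 := by exact_mod_cast hhi
    set N := (rootCount n (fun j => v (Sum.inl j)) (fun j => v (Sum.inr j)) : ℝ)
    have e1 : η * (162 * b / η * A) = 162 * b * A := by field_simp
    have e2 : η * (η⁻¹ * I) = I := by field_simp
    have h162 : 162 * b * (∫ y in (-(Real.pi * n) - b)..(Real.pi * n + b), α y) ≤ 162 * b * A :=
      mul_le_mul_of_nonneg_left hA (by positivity)
    have h160 : 160 * η * b * (∫ y in (-(Real.pi * n) - b)..(Real.pi * n + b),
        derivExcess (2 * n + 3) s f y) ≤ 160 * η * b * D :=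
      mul_le_mul_of_nonneg_left hD (by positivity)
    have h2 : 2 * (∫ y in (-(Real.pi * n) - b)..(Real.pi * n + b), α y) ≤ 162 * b * A := by
      nlinarith
    rw [abs_le]
    constructor
    · refine le_of_mul_le_mul_left ?_ hη
      have : η * (160 * b * D) ≥ 0 := mul_nonneg hη.le hD'
      nlinarith
    · refine le_of_mul_le_mul_left ?_ hη
      nlinarith

end

/-! ### Tails, characteristic functions and the small-ball estimate. -/

section

variable {ν : Measure ℝ} [IsProbabilityMeasure ν] {K : ℝ}

theorem abs_sum_mul_sub_le {ι : Type*} [Fintype ι] {c : ι → ℝ} (hc : ∑ i, c i ^ 2 ≤ 1)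
    (x y : ι → ℝ) : |∑ i, c i * x i - ∑ i, c i * y i| ≤ 1 * √(∑ i, (x i - y i) ^ 2) := by
  rw [one_mul, ← Finset.sum_sub_distrib]
  refine Real.abs_le_sqrt ?_
  simp_rw [← mul_sub]
  refine (Finset.sum_mul_sq_le_sq_mul_sq _ _ _).trans (mul_le_of_le_one_left ?_ hc)
  exact Finset.sum_nonneg fun i _ => sq_nonneg _

theorem convexOn_sum_mul {ι : Type*} [Fintype ι] (c : ι → ℝ) :
    ConvexOn ℝ Set.univ fun x : ι → ℝ => ∑ i, c i * x i := by
  refine ⟨convex_univ, fun x _ y _ s t _ _ _ => le_of_eq ?_⟩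
  simp only [Pi.add_apply, Pi.smul_apply, smul_eq_mul, Finset.mul_sum, ← Finset.sum_add_distrib]
  exact Finset.sum_congr rfl fun i _ => by ring

theorem ConvexConcentration.integral_exp_abs_linear_le (hK : ConvexConcentration ν K)
    (h2 : MemLp (fun x : ℝ => x) 2 ν) (h0 : ∫ x, x ∂ν = 0) {ι : Type} [Fintype ι] {c : ι → ℝ}
    (hc : ∑ i, c i ^ 2 ≤ 1) :
    Integrable (fun x : ι → ℝ => Real.exp |∑ i, c i * x i|) (Measure.pi fun _ => ν) ∧
      ∫ x : ι → ℝ, Real.exp |∑ i, c i * x i| ∂(Measure.pi fun _ => ν) ≤ 2 * Real.exp K := by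
  have hmean : ∫ x : ι → ℝ, ∑ i, c i * x i ∂(Measure.pi fun _ => ν) = 0 := by
    rw [integral_finsetSum _ fun i _ => (integrable_comp_eval (i := i)
      (h2.integrable one_le_two)).const_mul (c i)]
    refine Finset.sum_eq_zero fun i _ => ?_
    have h3 : ∫ x : ι → ℝ, x i ∂(Measure.pi fun _ => ν) = 0 :=
      (integral_comp_eval (μ := fun _ : ι => ν) (f := fun x : ℝ => x)
        aestronglyMeasurable_id).trans h0
    rw [integral_const_mul, h3, mul_zero]
  have hcl := fun lam => hK ι (fun x => ∑ i, c i * x i) 1 zero_le_one (convexOn_sum_mul c)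
    (abs_sum_mul_sub_le hc) lam
  rw [hmean] at hcl
  obtain ⟨i1, b1⟩ := hcl 1
  obtain ⟨i2, b2⟩ := hcl (-1)
  simp only [one_mul, sub_zero, one_pow, mul_one, neg_mul, neg_sq] at i1 i2 b1 b2
  have hle : ∀ u : ℝ, Real.exp |u| ≤ Real.exp u + Real.exp (-u) := by
    intro u
    rcases abs_cases u with h | h <;> rw [h.1] <;> nlinarith [Real.exp_pos u, Real.exp_pos (-u)]
  have hint := i1.add i2
  have hi : Integrable (fun x : ι → ℝ => Real.exp |∑ i, c i * x i|) (Measure.pi fun _ => ν) := by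
    refine hint.mono' (by fun_prop : Continuous _).aestronglyMeasurable
      (Filter.Eventually.of_forall fun x => ?_)
    rw [Real.norm_eq_abs, Real.abs_exp]
    exact hle _
  refine ⟨hi, (integral_mono hi hint fun x => hle _).trans ?_⟩
  rw [integral_add' i1 i2]
  linarith

theorem ConvexConcentration.integral_exp_abs_le (hK : ConvexConcentration ν K)
    (h2 : MemLp (fun x : ℝ => x) 2 ν) (h0 : ∫ x, x ∂ν = 0) :
    Integrable (fun x : ℝ => Real.exp |x|) ν ∧ ∫ x, Real.exp |x| ∂ν ≤ 2 * Real.exp K := by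
  obtain ⟨h1, h3⟩ := hK.integral_exp_abs_linear_le h2 h0 (ι := Unit) (c := fun _ => 1) (by simp)
  simp only [Finset.univ_unique, PUnit.default_eq_unit, Finset.sum_singleton, one_mul] at h1 h3
  have hm : AEStronglyMeasurable (fun x : ℝ => Real.exp |x|) ν :=
    (by fun_prop : Continuous fun x : ℝ => Real.exp |x|).aestronglyMeasurable
  have h4 : ∫ x : Unit → ℝ, Real.exp |x ()| ∂(Measure.pi fun _ => ν) = ∫ x, Real.exp |x| ∂ν :=
    integral_comp_eval (μ := fun _ : Unit => ν) (f := fun x : ℝ => Real.exp |x|) hm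
  rw [h4] at h3
  exact ⟨((measurePreserving_eval (fun _ : Unit => ν) ()).integrable_comp hm).1 h1, h3⟩

theorem ConvexConcentration.integral_excess_linear_le (hK : ConvexConcentration ν K)
    (h2 : MemLp (fun x : ℝ => x) 2 ν) (h0 : ∫ x, x ∂ν = 0) {ι : Type} [Fintype ι] {c : ι → ℝ}
    (hc : ∑ i, c i ^ 2 ≤ 1) (s : ℝ) :
    ∫ x : ι → ℝ, max (|∑ i, c i * x i| - s) 0 ∂(Measure.pi fun _ => ν) ≤
      2 * Real.exp K * Real.exp (-s) := by
  obtain ⟨h1, h3⟩ := hK.integral_exp_abs_linear_le h2 h0 hc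
  have hle : ∀ u : ℝ, max (|u| - s) 0 ≤ Real.exp |u| * Real.exp (-s) := by
    intro u
    rw [← Real.exp_add]
    exact max_le (by linarith [Real.add_one_le_exp (|u| + -s)]) (Real.exp_pos _).le
  calc ∫ x : ι → ℝ, max (|∑ i, c i * x i| - s) 0 ∂(Measure.pi fun _ => ν)
      ≤ ∫ x : ι → ℝ, Real.exp |∑ i, c i * x i| * Real.exp (-s) ∂(Measure.pi fun _ => ν) :=
        integral_mono_of_nonneg (Filter.Eventually.of_forall fun x => le_max_right _ _)
          (h1.mul_const _) (Filter.Eventually.of_forall fun x => hle _)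
    _ ≤ _ := by
        rw [integral_mul_const]
        exact mul_le_mul_of_nonneg_right h3 (Real.exp_pos _).le

/-- Second-order Taylor bound for the characteristic function of a centered normalized law. -/
theorem ConvexConcentration.norm_charFun_sub_le (hK : ConvexConcentration ν K)
    (h2 : MemLp (fun x : ℝ => x) 2 ν) (h0 : ∫ x, x ∂ν = 0) (h1 : ∫ x, x ^ 2 ∂ν = 1) {t : ℝ}
    (ht : |t| ≤ 1 / 2) :
    ‖charFun ν t - ((1 - t ^ 2 / 2 : ℝ) : ℂ)‖ ≤ 96 * Real.exp K * |t| ^ 3 := by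
  obtain ⟨i1, b1⟩ := hK.integral_exp_abs_le h2 h0
  have ix : Integrable (fun x : ℝ => x) ν := h2.integrable one_le_two
  have ix2 : Integrable (fun x : ℝ => x ^ 2) ν := h2.integrable_sq
  have ie : Integrable (fun x : ℝ => Complex.exp (t * x * Complex.I)) ν := by
    refine Integrable.of_bound (C := 1)
      (by fun_prop : Continuous fun x : ℝ => Complex.exp (t * x * Complex.I)).aestronglyMeasurable
      (Filter.Eventually.of_forall fun x => ?_)
    rw [← Complex.ofReal_mul, Complex.norm_exp_ofReal_mul_I]
  have ixc : Integrable (fun x : ℝ => (t * Complex.I) * (x : ℂ)) ν := ix.ofReal.const_mul _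
  have ix2c : Integrable (fun x : ℝ => (-(t ^ 2 / 2) : ℂ) * ((x ^ 2 : ℝ) : ℂ)) ν :=
    ix2.ofReal.const_mul _
  have ip1 : Integrable (fun x : ℝ => (1 : ℂ) + (t * Complex.I) * (x : ℂ)) ν :=
    (integrable_const 1).add ixc
  have ip : Integrable (fun x : ℝ => (1 : ℂ) + (t * Complex.I) * (x : ℂ) +
      (-(t ^ 2 / 2) : ℂ) * ((x ^ 2 : ℝ) : ℂ)) ν := ip1.add ix2c
  have e : charFun ν t - ((1 - t ^ 2 / 2 : ℝ) : ℂ) = ∫ x : ℝ, (Complex.exp (t * x * Complex.I) -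
      ((1 : ℂ) + (t * Complex.I) * (x : ℂ) + (-(t ^ 2 / 2) : ℂ) * ((x ^ 2 : ℝ) : ℂ))) ∂ν := by
    rw [integral_sub ie ip, charFun_apply_real, integral_add ip1 ix2c,
      integral_add (integrable_const 1) ixc, integral_const_mul, integral_const_mul,
      integral_complex_ofReal, integral_complex_ofReal, h0, h1]
    simp
    ring
  rw [e]
  have hpt : ∀ x : ℝ, ‖Complex.exp (t * x * Complex.I) -
      ((1 : ℂ) + (t * Complex.I) * (x : ℂ) + (-(t ^ 2 / 2) : ℂ) * ((x ^ 2 : ℝ) : ℂ))‖ ≤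
      48 * |t| ^ 3 * Real.exp |x| := by
    intro x
    have h := Complex.norm_exp_sub_sum_le_norm_mul_exp (t * x * Complex.I) 3
    have e1 : ∑ m ∈ Finset.range 3, ((t : ℂ) * x * Complex.I) ^ m / (m.factorial : ℂ) =
        (1 : ℂ) + (t * Complex.I) * (x : ℂ) + (-(t ^ 2 / 2) : ℂ) * ((x ^ 2 : ℝ) : ℂ) := by
      simp only [Finset.sum_range_succ, Finset.sum_range_zero, Nat.factorial]
      push_cast
      linear_combination ((t : ℂ) ^ 2 * x ^ 2 / 2) * Complex.I_sq
    have e2 : ‖(t : ℂ) * x * Complex.I‖ = |t| * |x| := by simp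
    rw [e1, e2, mul_pow] at h
    refine h.trans ?_
    -- Half of the exponential moment absorbs `|x|^3`, the other half absorbs `exp (|t| |x|)`.
    have h3 := Real.pow_div_factorial_le_exp (|x| / 2) (by positivity) 3
    have h4 : |x| ^ 3 ≤ 48 * Real.exp (|x| / 2) := by
      have : (|x| / 2) ^ 3 / (Nat.factorial 3 : ℝ) = |x| ^ 3 / 48 := by
        norm_num [Nat.factorial]; ring
      rw [this] at h3
      linarith
    have h5 : Real.exp (|t| * |x|) ≤ Real.exp (|x| / 2) :=
      Real.exp_le_exp.2 (by nlinarith [abs_nonneg x])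
    calc |t| ^ 3 * |x| ^ 3 * Real.exp (|t| * |x|)
        ≤ |t| ^ 3 * (48 * Real.exp (|x| / 2)) * Real.exp (|x| / 2) := by gcongr
      _ = 48 * |t| ^ 3 * (Real.exp (|x| / 2) * Real.exp (|x| / 2)) := by ring
      _ = 48 * |t| ^ 3 * Real.exp |x| := by rw [← Real.exp_add]; ring_nf
  refine (norm_integral_le_of_norm_le (i1.const_mul _)
    (Filter.Eventually.of_forall hpt)).trans ?_
  rw [integral_const_mul]
  have : 0 ≤ 48 * |t| ^ 3 := by positivity
  nlinarith

/-- The threshold uses `384 = 4 · 96`: below it the cubic Taylor error is at most `t^2 / 4`, leaving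
`1 - t^2 / 4`. -/
theorem ConvexConcentration.norm_charFun_le (hK : ConvexConcentration ν K)
    (h2 : MemLp (fun x : ℝ => x) 2 ν) (h0 : ∫ x, x ∂ν = 0) (h1 : ∫ x, x ^ 2 ∂ν = 1) (hK0 : 0 ≤ K)
    {t : ℝ} (ht : |t| ≤ (384 * Real.exp K)⁻¹) : ‖charFun ν t‖ ≤ Real.exp (-(t ^ 2 / 4)) := by
  have hE : 1 ≤ Real.exp K := Real.one_le_exp hK0
  have ht2 : |t| ≤ 1 / 2 := ht.trans (by
    rw [inv_le_comm₀ (by positivity) (by norm_num)]; norm_num; linarith)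
  have h := hK.norm_charFun_sub_le h2 h0 h1 ht2
  have h3 : |t| * (384 * Real.exp K) ≤ 1 := by
    rwa [← le_div_iff₀ (by positivity), one_div]
  have h4 : 96 * Real.exp K * |t| ^ 3 ≤ t ^ 2 / 4 := by
    rw [← sq_abs t]
    nlinarith [sq_nonneg |t|]
  have h5 : ‖((1 - t ^ 2 / 2 : ℝ) : ℂ)‖ = 1 - t ^ 2 / 2 := by
    rw [Complex.norm_real, Real.norm_eq_abs, abs_of_nonneg]
    rw [← sq_abs t]
    nlinarith [abs_nonneg t]
  have h6 := norm_le_norm_add_norm_sub' (charFun ν t) ((1 - t ^ 2 / 2 : ℝ) : ℂ)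
  have h7 := Real.add_one_le_exp (-(t ^ 2 / 4))
  linarith

theorem integral_exp_linear_eq_prod_charFun {ι : Type*} [Fintype ι] (c : ι → ℝ) (t : ℝ) :
    ∫ x : ι → ℝ, Complex.exp (t * ((∑ i, c i * x i : ℝ) : ℂ) * Complex.I)
      ∂(Measure.pi fun _ => ν) = ∏ i, charFun ν (t * c i) := by
  have e : ∀ x : ι → ℝ, Complex.exp (t * ((∑ i, c i * x i : ℝ) : ℂ) * Complex.I) =
      ∏ i, Complex.exp (((t * c i : ℝ) : ℂ) * x i * Complex.I) := by
    intro x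
    rw [← Complex.exp_sum, ← Finset.sum_mul]
    push_cast
    rw [Finset.mul_sum]
    simp only [mul_assoc]
  simp_rw [e]
  rw [integral_fintype_prod_eq_prod (fun i (y : ℝ) =>
    Complex.exp (((t * c i : ℝ) : ℂ) * y * Complex.I))]
  simp only [charFun_apply_real]

/-- When `|t| δ` is below the threshold, every factor has Gaussian decay and the product gives `exp
(-(t^2 / 4))`. Otherwise the second term is at least one and the bound is trivial. -/
theorem ConvexConcentration.norm_integral_exp_linear_le (hK : ConvexConcentration ν K)
    (h2 : MemLp (fun x : ℝ => x) 2 ν) (h0 : ∫ x, x ∂ν = 0) (h1 : ∫ x, x ^ 2 ∂ν = 1) (hK0 : 0 ≤ K)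
    {ι : Type*} [Fintype ι] {c : ι → ℝ} (hc : ∑ i, c i ^ 2 = 1) {δ : ℝ} (hδ : ∀ i, |c i| ≤ δ)
    (t : ℝ) :
    ‖∫ x : ι → ℝ, Complex.exp (t * ((∑ i, c i * x i : ℝ) : ℂ) * Complex.I)
      ∂(Measure.pi fun _ => ν)‖ ≤
      Real.exp (-(t ^ 2 / 4)) + (384 * Real.exp K * δ) ^ 2 * t ^ 2 := by
  rw [integral_exp_linear_eq_prod_charFun, norm_prod]
  rcases le_or_gt (|t| * δ) (384 * Real.exp K)⁻¹ with h | h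
  · have h3 : ∏ i, ‖charFun ν (t * c i)‖ ≤ ∏ i, Real.exp (-((t * c i) ^ 2 / 4)) := by
      refine Finset.prod_le_prod (fun i _ => norm_nonneg _) fun i _ =>
        hK.norm_charFun_le h2 h0 h1 hK0 ?_
      rw [abs_mul]
      exact (mul_le_mul_of_nonneg_left (hδ i) (abs_nonneg t)).trans h
    have h4 : ∏ i, Real.exp (-((t * c i) ^ 2 / 4)) = Real.exp (-(t ^ 2 / 4)) := by
      rw [← Real.exp_sum]
      congr 1
      calc ∑ i, -((t * c i) ^ 2 / 4) = -(t ^ 2 / 4) * ∑ i, c i ^ 2 := by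
            rw [Finset.mul_sum]
            exact Finset.sum_congr rfl fun i _ => by ring
        _ = _ := by rw [hc, mul_one]
    rw [h4] at h3
    have : 0 ≤ (384 * Real.exp K * δ) ^ 2 * t ^ 2 := by positivity
    linarith
  · have h3 : ∏ i, ‖charFun ν (t * c i)‖ ≤ 1 :=
      Finset.prod_le_one (fun i _ => norm_nonneg _) fun i _ => norm_charFun_le_one _
    have h4 : 1 ≤ 384 * Real.exp K * (|t| * δ) := by
      rw [inv_lt_iff_one_lt_mul₀ (by positivity)] at h
      linarith
    have h5 : (384 * Real.exp K * δ) ^ 2 * t ^ 2 = (384 * Real.exp K * (|t| * δ)) ^ 2 := by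
      rw [← sq_abs t]; ring
    have h6 := Real.exp_pos (-(t ^ 2 / 4))
    nlinarith

/-- Small-ball estimate for normalized linear forms with small coefficients, in Gaussian-smoothed
form. -/
theorem ConvexConcentration.integral_exp_neg_sq_linear_le (hK : ConvexConcentration ν K)
    (h2 : MemLp (fun x : ℝ => x) 2 ν) (h0 : ∫ x, x ∂ν = 0) (h1 : ∫ x, x ^ 2 ∂ν = 1) (hK0 : 0 ≤ K)
    {ι : Type*} [Fintype ι] {c : ι → ℝ} (hc : ∑ i, c i ^ 2 = 1) {δ : ℝ} (hδ : ∀ i, |c i| ≤ δ)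
    {r : ℝ} (hr : 0 < r) :
    ∫ x : ι → ℝ, Real.exp (-((∑ i, c i * x i) / r) ^ 2 / 2) ∂(Measure.pi fun _ => ν) ≤
      4 * r + (384 * Real.exp K * δ / r) ^ 2 := by
  -- The Gaussian weight is the characteristic function of a standard normal variable `u`, so by
  -- Fubini the integral is the mean over `u` of the characteristic function of the linear form at
  -- `u / r`.
  set γ := gaussianReal 0 1 with hγ
  set π := Measure.pi fun _ : ι => ν
  set F : (ι → ℝ) → ℝ := fun x => ∑ i, c i * x i with hF
  have hFc : Continuous F := by fun_prop
  have hgauss : ∀ x : ι → ℝ, ((Real.exp (-(F x / r) ^ 2 / 2) : ℝ) : ℂ) =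
      ∫ u : ℝ, Complex.exp (((u / r : ℝ) : ℂ) * (F x : ℂ) * Complex.I) ∂γ := by
    intro x
    have h3 := charFun_gaussianReal (μ := 0) (v := 1) (F x / r)
    rw [charFun_apply_real] at h3
    have e : ∀ u : ℝ, Complex.exp (((u / r : ℝ) : ℂ) * (F x : ℂ) * Complex.I) =
        Complex.exp (((F x / r : ℝ) : ℂ) * u * Complex.I) := by
      intro u
      congr 1
      push_cast
      ring
    simp_rw [e]
    rw [h3]
    push_cast
    congr 1
    simp
    ring
  have hint : Integrable (Function.uncurry fun (x : ι → ℝ) (u : ℝ) =>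
      Complex.exp (((u / r : ℝ) : ℂ) * (F x : ℂ) * Complex.I)) (π.prod γ) := by
    refine Integrable.of_bound (C := 1) (Continuous.aestronglyMeasurable (by
      simp only [Function.uncurry_def]; fun_prop)) (Filter.Eventually.of_forall fun p => ?_)
    simp only [Function.uncurry_def]
    rw [← Complex.ofReal_mul, Complex.norm_exp_ofReal_mul_I]
  have hswap : ((∫ x, Real.exp (-(F x / r) ^ 2 / 2) ∂π : ℝ) : ℂ) =
      ∫ u : ℝ, ∫ x, Complex.exp (((u / r : ℝ) : ℂ) * (F x : ℂ) * Complex.I) ∂π ∂γ := by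
    rw [← integral_complex_ofReal, ← integral_integral_swap hint]
    exact integral_congr_ae (Filter.Eventually.of_forall hgauss)
  have hsq : ∫ u, u ^ 2 ∂γ = 1 := by
    have h3 := variance_fun_id_gaussianReal (μ := 0) (v := 1)
    rw [variance_eq_integral measurable_id'.aemeasurable, integral_id_gaussianReal] at h3
    simpa using h3
  have isq : Integrable (fun u : ℝ => u ^ 2) γ :=
    (memLp_id_gaussianReal' 2 (by simp)).integrable_sq
  have iexp : Integrable (fun u : ℝ => Real.exp (-((u / r) ^ 2 / 4))) γ := by
    refine Integrable.of_bound (C := 1) (by fun_prop : Continuous _).aestronglyMeasurable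
      (Filter.Eventually.of_forall fun u => ?_)
    rw [Real.norm_eq_abs, Real.abs_exp, Real.exp_le_one_iff]
    have : 0 ≤ (u / r) ^ 2 / 4 := by positivity
    linarith
  -- The standard normal density is at most one, and `∫ exp (-u^2 / (4 r^2)) = 2 r √π ≤ 4 r`.
  have hgint : ∫ u, Real.exp (-((u / r) ^ 2 / 4)) ∂γ ≤ 4 * r := by
    rw [hγ, integral_gaussianReal_eq_integral_smul one_ne_zero]
    have hb : 0 < (1 / (4 * r ^ 2)) := by positivity
    have i3 : Integrable (fun u : ℝ => Real.exp (-(1 / (4 * r ^ 2)) * u ^ 2)) :=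
      integrable_exp_neg_mul_sq hb
    have h3 : ∀ u : ℝ, gaussianPDFReal 0 1 u • Real.exp (-((u / r) ^ 2 / 4)) ≤
        Real.exp (-(1 / (4 * r ^ 2)) * u ^ 2) := by
      intro u
      have e : -((u / r) ^ 2 / 4) = -(1 / (4 * r ^ 2)) * u ^ 2 := by field_simp
      rw [smul_eq_mul, e]
      refine mul_le_of_le_one_left (Real.exp_pos _).le ?_
      rw [gaussianPDFReal_def]
      refine mul_le_one₀ (inv_le_one_of_one_le₀ ?_) (Real.exp_pos _).le ?_
      · rw [Real.one_le_sqrt]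
        have := Real.pi_gt_three
        simp only [NNReal.coe_one]
        linarith
      · rw [Real.exp_le_one_iff]
        have : 0 ≤ (u - 0) ^ 2 / (2 * ((1 : NNReal) : ℝ)) := by positivity
        rw [neg_div]
        linarith
    refine (integral_mono_of_nonneg (Filter.Eventually.of_forall fun u => ?_) i3
      (Filter.Eventually.of_forall h3)).trans ?_
    · exact mul_nonneg (gaussianPDFReal_nonneg _ _ _) (Real.exp_pos _).le
    · rw [integral_gaussian, Real.sqrt_le_left (by positivity)]
      have : Real.pi / (1 / (4 * r ^ 2)) = Real.pi * (4 * r ^ 2) := by field_simp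
      rw [this]
      nlinarith [Real.pi_le_four, sq_nonneg r]
  have hfin : ‖((∫ x, Real.exp (-(F x / r) ^ 2 / 2) ∂π : ℝ) : ℂ)‖ ≤
      4 * r + (384 * Real.exp K * δ / r) ^ 2 := by
    rw [hswap]
    refine (norm_integral_le_of_norm_le (iexp.add (isq.const_mul
      ((384 * Real.exp K * δ / r) ^ 2))) (Filter.Eventually.of_forall fun u => ?_)).trans ?_
    · refine (hK.norm_integral_exp_linear_le h2 h0 h1 hK0 hc hδ (u / r)).trans (le_of_eq ?_)
      simp only [Pi.add_apply]
      ring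
    · rw [integral_add' iexp (isq.const_mul _), integral_const_mul, hsq, mul_one]
      linarith
  rw [Complex.norm_real] at hfin
  exact (le_abs_self _).trans hfin

end

/-! ### Expectations of the two error terms. -/

noncomputable section

/-- The coefficients of `scaledDeriv n m v y` as a linear form in `v`. -/
def scaledCoeff (n m : ℕ) (y : ℝ) : Fin n ⊕ Fin n → ℝ :=
  Sum.elim
    (fun j => 1 / √n * ((((j : ℕ) + 1 : ℝ) / n) ^ m *
      Real.cos (((j : ℕ) + 1 : ℝ) / n * y + m * (Real.pi / 2))))
    (fun j => 1 / √n * ((((j : ℕ) + 1 : ℝ) / n) ^ m *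
      Real.sin (((j : ℕ) + 1 : ℝ) / n * y + m * (Real.pi / 2))))

end

section

variable {n : ℕ}

theorem scaledDeriv_eq_sum (m : ℕ) (v : Fin n ⊕ Fin n → ℝ) (y : ℝ) :
    scaledDeriv n m v y = ∑ i, scaledCoeff n m y i * v i := by
  simp only [scaledDeriv, scaledCoeff, Fintype.sum_sum_type, Sum.elim_inl, Sum.elim_inr,
    ← Finset.sum_add_distrib, Finset.mul_sum]
  exact Finset.sum_congr rfl fun j _ => by ring

theorem sum_scaledCoeff_sq (m : ℕ) (y : ℝ) :
    ∑ i, scaledCoeff n m y i ^ 2 = ∑ j : Fin n, 1 / n * ((((j : ℕ) + 1 : ℝ) / n) ^ m) ^ 2 := by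
  simp only [scaledCoeff, Fintype.sum_sum_type, Sum.elim_inl, Sum.elim_inr,
    ← Finset.sum_add_distrib]
  refine Finset.sum_congr rfl fun j _ => ?_
  set θ := ((j : ℕ) + 1 : ℝ) / n * y + m * (Real.pi / 2)
  have h : (1 / √(n : ℝ)) ^ 2 = 1 / n := by
    rw [div_pow, one_pow, Real.sq_sqrt (Nat.cast_nonneg _)]
  rw [mul_pow, mul_pow, mul_pow, mul_pow, h]
  linear_combination (1 / n * ((((j : ℕ) + 1 : ℝ) / n) ^ m) ^ 2) * Real.cos_sq_add_sin_sq θ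

theorem sum_scaledCoeff_zero_sq (hn : 0 < n) (y : ℝ) : ∑ i, scaledCoeff n 0 y i ^ 2 = 1 := by
  rw [sum_scaledCoeff_sq (n := n) 0 y]
  have : (n : ℝ) ≠ 0 := Nat.cast_ne_zero.2 hn.ne'
  simp [this]

theorem sum_scaledCoeff_sq_le (hn : 0 < n) (m : ℕ) (y : ℝ) : ∑ i, scaledCoeff n m y i ^ 2 ≤ 1 := by
  have h := sum_scaledCoeff_zero_sq hn y
  rw [sum_scaledCoeff_sq] at h ⊢
  refine le_trans (Finset.sum_le_sum fun j _ => ?_) h.le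
  refine mul_le_mul_of_nonneg_left ?_ (by positivity)
  have h1 := frequency_mem hn j
  rw [pow_zero]
  exact pow_le_pow_left₀ (pow_nonneg h1.1 _) (pow_le_one₀ h1.1 h1.2) 2

theorem abs_scaledCoeff_zero_le (y : ℝ) (i : Fin n ⊕ Fin n) : |scaledCoeff n 0 y i| ≤ 1 / √n := by
  have h : |1 / √(n : ℝ)| = 1 / √n := abs_of_nonneg (by positivity)
  rcases i with j | j
  · simp only [scaledCoeff, Sum.elim_inl, pow_zero, one_mul]
    rw [abs_mul, h]
    exact mul_le_of_le_one_right (by positivity) (Real.abs_cos_le_one _)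
  · simp only [scaledCoeff, Sum.elim_inr, pow_zero, one_mul]
    rw [abs_mul, h]
    exact mul_le_of_le_one_right (by positivity) (Real.abs_sin_le_one _)

/-- Integrating a uniform bound on the expectation of a nonnegative continuous random function. -/
theorem integral_intervalIntegral_le {V : Type*} [TopologicalSpace V] [MeasurableSpace V]
    [BorelSpace V] [SecondCountableTopology V] {P : Measure V} [SFinite P] {g : V → ℝ → ℝ}
    (hg : Continuous (Function.uncurry g)) (hg0 : ∀ v y, 0 ≤ g v y)
    (hi : ∀ y, Integrable (fun v => g v y) P) {B : ℝ} (hB : ∀ y, ∫ v, g v y ∂P ≤ B) {p q : ℝ}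
    (hpq : p ≤ q) : ∫ v, (∫ y in p..q, g v y) ∂P ≤ (q - p) * B := by
  have hB0 : 0 ≤ B := (integral_nonneg fun v => hg0 v 0).trans (hB 0)
  have hinner : ∀ v, ENNReal.ofReal (∫ y in p..q, g v y) =
      ∫⁻ y in Set.Ioc p q, ENNReal.ofReal (g v y) := by
    intro v
    have hc : Continuous (g v) := hg.comp (by fun_prop : Continuous fun y : ℝ => (v, y))
    rw [intervalIntegral.integral_of_le hpq]
    exact ofReal_integral_eq_lintegral_ofReal (hc.integrableOn_Ioc)
      (Filter.Eventually.of_forall fun y => hg0 v y)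
  have hcont : Continuous fun v => ∫ y in p..q, g v y :=
    intervalIntegral.continuous_parametric_intervalIntegral_of_continuous' hg p q
  rw [integral_eq_lintegral_of_nonneg_ae
    (Filter.Eventually.of_forall fun v => intervalIntegral.integral_nonneg hpq fun y _ => hg0 v y)
    hcont.aestronglyMeasurable]
  refine ENNReal.toReal_le_of_le_ofReal (mul_nonneg (by linarith) hB0) ?_
  simp_rw [hinner]
  have hm : AEMeasurable (Function.uncurry fun v y => ENNReal.ofReal (g v y))
      (P.prod (volume.restrict (Set.Ioc p q))) :=
    (ENNReal.continuous_ofReal.comp hg).aemeasurable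
  rw [lintegral_lintegral_swap hm]
  calc ∫⁻ y in Set.Ioc p q, ∫⁻ v, ENNReal.ofReal (g v y) ∂P
      ≤ ∫⁻ _y in Set.Ioc p q, ENNReal.ofReal B := by
        refine lintegral_mono fun y => ?_
        rw [← ofReal_integral_eq_lintegral_ofReal (hi y)
          (Filter.Eventually.of_forall fun v => hg0 v y)]
        exact ENNReal.ofReal_le_ofReal (hB y)
    _ = ENNReal.ofReal ((q - p) * B) := by
        rw [lintegral_const, Measure.restrict_apply_univ, Real.volume_Ioc, mul_comm,
          ENNReal.ofReal_mul (by linarith)]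

theorem nearZero_le_one (x : ℝ) : nearZero x ≤ 1 :=
  (nearZero_le_indicator x).trans (Set.indicator_le_self' (fun _ _ => zero_le_one) _)

theorem nearZero_le_exp (x : ℝ) : nearZero x ≤ 2 * Real.exp (-(x / 2) ^ 2 / 2) := by
  refine (nearZero_le_indicator x).trans ?_
  by_cases h : x ∈ {x : ℝ | |x| ≤ 2}
  · rw [Set.indicator_of_mem h, Pi.one_apply]
    have h1 : x ^ 2 ≤ 4 := by
      have h : |x| ≤ 2 := h
      rw [← sq_abs]
      nlinarith [abs_nonneg x]
    have := Real.add_one_le_exp (-(x / 2) ^ 2 / 2)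
    nlinarith
  · rw [Set.indicator_of_notMem h]
    positivity

theorem derivExcess_scaledDeriv (M : ℕ) (s : ℝ) (v : Fin n ⊕ Fin n → ℝ) (y : ℝ) :
    derivExcess M s (scaledDeriv n 0 v) y =
      ∑ m ∈ Finset.range (M + 1), (1 / 2 : ℝ) ^ m * max (|scaledDeriv n m v y| - s) 0 := by
  simp only [derivExcess, iteratedDeriv_scaledDeriv]

theorem sum_half_pow_le (M : ℕ) : ∑ m ∈ Finset.range M, (1 / 2 : ℝ) ^ m ≤ 2 := by
  rw [geom_sum_eq (by norm_num), show (1 / 2 : ℝ) - 1 = -(1 / 2) by norm_num, div_neg, div_eq_mul_inv]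
  norm_num
  have : (0 : ℝ) ≤ (1 / 2) ^ M := by positivity
  linarith

variable {ν : Measure ℝ} [IsProbabilityMeasure ν] {K : ℝ}

/-- At every `y` the coefficient vector has norm one and entries at most `1 / √n`, so the small-ball
estimate is uniform in `y`. It is used at scale `2r`, as `nearZero` is supported in `[-2, 2]`. -/
theorem ConvexConcentration.integral_nearZero_scaledDeriv_le (hK : ConvexConcentration ν K)
    (h2 : MemLp (fun x : ℝ => x) 2 ν) (h0 : ∫ x, x ∂ν = 0) (h1 : ∫ x, x ^ 2 ∂ν = 1) (hK0 : 0 ≤ K)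
    (hn : 0 < n) {r : ℝ} (hr : 0 < r) :
    ∫ v, (∫ y in (-(2 * Real.pi * n))..(2 * Real.pi * n), nearZero (scaledDeriv n 0 v y / r))
      ∂(Measure.pi fun _ : Fin n ⊕ Fin n => ν) ≤
      (2 * Real.pi * n - -(2 * Real.pi * n)) *
        (2 * (4 * (2 * r) + (384 * Real.exp K * (1 / √n) / (2 * r)) ^ 2)) := by
  have hpn : 0 ≤ 2 * Real.pi * n := by positivity
  have hcont : Continuous (Function.uncurry fun (v : Fin n ⊕ Fin n → ℝ) y =>
      nearZero (scaledDeriv n 0 v y / r)) :=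
    continuous_nearZero.comp ((continuous_uncurry_scaledDeriv 0).div_const r)
  have hb : ∀ (F : (Fin n ⊕ Fin n → ℝ) → ℝ), Continuous F → (∀ v, 0 ≤ F v ∧ F v ≤ 1) →
      Integrable F (Measure.pi fun _ : Fin n ⊕ Fin n => ν) := fun F hF hF1 =>
    Integrable.of_bound (C := 1) hF.aestronglyMeasurable (Filter.Eventually.of_forall fun v => by
      rw [Real.norm_eq_abs, abs_of_nonneg (hF1 v).1]
      exact (hF1 v).2)
  have hsc : ∀ y, Continuous fun v : Fin n ⊕ Fin n → ℝ => scaledDeriv n 0 v y := by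
    intro y
    unfold scaledDeriv
    fun_prop
  have hi : ∀ y, Integrable (fun v => nearZero (scaledDeriv n 0 v y / r))
      (Measure.pi fun _ : Fin n ⊕ Fin n => ν) := by
    intro y
    have hc : Continuous fun v => nearZero (scaledDeriv n 0 v y / r) :=
      continuous_nearZero.comp ((hsc y).div_const r)
    exact hb _ hc fun v => ⟨nearZero_nonneg _, nearZero_le_one _⟩
  refine integral_intervalIntegral_le hcont (fun v y => nearZero_nonneg _) hi (fun y => ?_)
    (by linarith)
  have h3 := hK.integral_exp_neg_sq_linear_le h2 h0 h1 hK0 (sum_scaledCoeff_zero_sq hn y)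
    (abs_scaledCoeff_zero_le y) (r := 2 * r) (by positivity)
  simp_rw [← scaledDeriv_eq_sum] at h3
  have hscy := hsc y
  have hexp : Integrable (fun v => Real.exp (-(scaledDeriv n 0 v y / (2 * r)) ^ 2 / 2))
      (Measure.pi fun _ : Fin n ⊕ Fin n => ν) := by
    refine hb _ (by fun_prop) fun v => ⟨(Real.exp_pos _).le, ?_⟩
    rw [Real.exp_le_one_iff]
    have : 0 ≤ (scaledDeriv n 0 v y / (2 * r)) ^ 2 / 2 := by positivity
    linarith
  refine (integral_mono (hi y) (hexp.const_mul 2) fun v => ?_).trans ?_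
  · refine (nearZero_le_exp _).trans (le_of_eq ?_)
    congr 3
    ring
  · rw [integral_const_mul]
    linarith

/-- Every derivative is a linear form of norm at most one, hence has the same tail bound, and the
weights `2^(-m)` sum to at most 2 whatever `M` is. -/
theorem ConvexConcentration.integral_derivExcess_scaledDeriv_le (hK : ConvexConcentration ν K)
    (h2 : MemLp (fun x : ℝ => x) 2 ν) (h0 : ∫ x, x ∂ν = 0) (hn : 0 < n) (M : ℕ) (s : ℝ) :
    ∫ v, (∫ y in (-(2 * Real.pi * n))..(2 * Real.pi * n), derivExcess M s (scaledDeriv n 0 v) y)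
      ∂(Measure.pi fun _ : Fin n ⊕ Fin n => ν) ≤
      (2 * Real.pi * n - -(2 * Real.pi * n)) * (4 * Real.exp K * Real.exp (-s)) := by
  have hpn : 0 ≤ 2 * Real.pi * n := by positivity
  simp_rw [derivExcess_scaledDeriv]
  have hi : ∀ (m : ℕ) (y : ℝ), Integrable (fun v => max (|scaledDeriv n m v y| - s) 0)
      (Measure.pi fun _ : Fin n ⊕ Fin n => ν) := by
    intro m y
    refine integrable_of_l2_lipschitz h2 zero_le_one fun v w => ?_
    refine (abs_max_sub_max_le_abs _ _ _).trans ?_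
    rw [sub_sub_sub_cancel_right, scaledDeriv_eq_sum, scaledDeriv_eq_sum]
    exact (abs_abs_sub_abs_le_abs_sub _ _).trans (abs_sum_mul_sub_le (sum_scaledCoeff_sq_le hn m y) _ _)
  refine integral_intervalIntegral_le ?_ (fun v y => Finset.sum_nonneg fun m _ =>
    mul_nonneg (pow_nonneg (by norm_num) m) (le_max_right _ _))
    (fun y => integrable_finsetSum _ fun m _ => (hi m y).const_mul _) (fun y => ?_) (by linarith)
  · refine continuous_finsetSum _ fun m _ => ?_
    have := continuous_uncurry_scaledDeriv (n := n) m
    fun_prop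
  · rw [integral_finsetSum _ fun m _ => (hi m y).const_mul _]
    have h3 : ∀ m ∈ Finset.range (M + 1), ∫ v, (1 / 2 : ℝ) ^ m * max (|scaledDeriv n m v y| - s) 0
        ∂(Measure.pi fun _ : Fin n ⊕ Fin n => ν) ≤
        (1 / 2 : ℝ) ^ m * (2 * Real.exp K * Real.exp (-s)) := by
      intro m _
      rw [integral_const_mul]
      refine mul_le_mul_of_nonneg_left ?_ (by positivity)
      simp_rw [scaledDeriv_eq_sum]
      exact hK.integral_excess_linear_le h2 h0 (sum_scaledCoeff_sq_le hn m y) s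
    refine (Finset.sum_le_sum h3).trans ?_
    rw [← Finset.sum_mul]
    have h4 := sum_half_pow_le (M + 1)
    have : 0 ≤ 2 * Real.exp K * Real.exp (-s) := by positivity
    nlinarith

end

/-! ### Differences of convex Lipschitz functions. -/

noncomputable section

/-- `F` is convex, and `L`-Lipschitz for the Euclidean distance. -/
def ConvexLipschitz {ι : Type*} [Fintype ι] (F : (ι → ℝ) → ℝ) (L : ℝ) : Prop :=
  ConvexOn ℝ Set.univ F ∧ ∀ x y, |F x - F y| ≤ L * √(∑ i, (x i - y i) ^ 2)

end

section

variable {ι : Type*} [Fintype ι] {F G : (ι → ℝ) → ℝ} {L L' : ℝ}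

theorem ConvexLipschitz.mono (hF : ConvexLipschitz F L) (h : L ≤ L') : ConvexLipschitz F L' :=
  ⟨hF.1, fun x y => (hF.2 x y).trans (mul_le_mul_of_nonneg_right h (Real.sqrt_nonneg _))⟩

theorem ConvexLipschitz.add (hF : ConvexLipschitz F L) (hG : ConvexLipschitz G L') :
    ConvexLipschitz (fun x => F x + G x) (L + L') := by
  refine ⟨hF.1.add hG.1, fun x y => ?_⟩
  have h1 := hF.2 x y
  have h2 := hG.2 x y
  rw [add_mul, add_sub_add_comm]
  exact (abs_add_le _ _).trans (add_le_add h1 h2)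

theorem ConvexLipschitz.const_mul {c : ℝ} (hc : 0 ≤ c) (hF : ConvexLipschitz F L) :
    ConvexLipschitz (fun x => c * F x) (c * L) := by
  refine ⟨by simpa using! hF.1.smul hc, fun x y => ?_⟩
  rw [← mul_sub, abs_mul, abs_of_nonneg hc, mul_assoc]
  exact mul_le_mul_of_nonneg_left (hF.2 x y) hc

theorem ConvexLipschitz.const_add (c : ℝ) (hF : ConvexLipschitz F L) :
    ConvexLipschitz (fun x => c + F x) L := by
  refine ⟨by simpa using! (convexOn_const c convex_univ).add hF.1, fun x y => ?_⟩
  rw [add_sub_add_left_eq_sub]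
  exact hF.2 x y

/-- The increment bound `h` enters only through its integral, so the Lipschitz constant comes from
an `L¹` estimate and not from a pointwise one. -/
theorem ConvexLipschitz.intervalIntegral {g : (ι → ℝ) → ℝ → ℝ} {h : (ι → ℝ) → ℝ → ℝ} {p q : ℝ}
    (hpq : p ≤ q) (hc : ∀ v, Continuous (g v)) (hconv : ∀ y, ConvexOn ℝ Set.univ fun v => g v y)
    (hh : ∀ v, Continuous (h v)) (hle : ∀ v w y, |g v y - g w y| ≤ h (v - w) y)
    (hL : ∀ v, ∫ y in p..q, h v y ≤ L * √(∑ i, v i ^ 2)) :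
    ConvexLipschitz (fun v => ∫ y in p..q, g v y) L := by
  refine ⟨⟨convex_univ, fun v _ w _ a b ha hb hab => ?_⟩, fun v w => ?_⟩
  · simp only [smul_eq_mul]
    rw [← intervalIntegral.integral_const_mul, ← intervalIntegral.integral_const_mul,
      ← intervalIntegral.integral_add (((hc v).const_mul a).intervalIntegrable _ _)
        (((hc w).const_mul b).intervalIntegrable _ _)]
    exact intervalIntegral.integral_mono_on hpq ((hc _).intervalIntegrable _ _)
      ((((hc v).const_mul a).add ((hc w).const_mul b)).intervalIntegrable _ _)
      fun y _ => (hconv y).2 trivial trivial ha hb hab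
  · rw [← intervalIntegral.integral_sub ((hc v).intervalIntegrable _ _)
      ((hc w).intervalIntegrable _ _)]
    refine (intervalIntegral.abs_integral_le_integral_abs hpq).trans ?_
    refine (intervalIntegral.integral_mono_on hpq (((hc v).sub (hc w)).abs.intervalIntegrable _ _)
      ((hh (v - w)).intervalIntegrable _ _) fun y _ => hle v w y).trans ?_
    simpa using hL (v - w)

variable {ν : Measure ℝ} [IsProbabilityMeasure ν] {K : ℝ}

theorem ConvexLipschitz.integrable (h2 : MemLp (fun x : ℝ => x) 2 ν) (hL : 0 ≤ L)
    (hF : ConvexLipschitz F L) : Integrable F (Measure.pi fun _ => ν) :=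
  integrable_of_l2_lipschitz h2 hL hF.2

/-- Two-sided deviation bound for convex Lipschitz functions. -/
theorem ConvexConcentration.measureReal_le_abs_sub_le (hK : ConvexConcentration ν K) (hK0 : 0 < K)
    {ι : Type} [Fintype ι] {F : (ι → ℝ) → ℝ} {L : ℝ} (hL : 0 < L) (hF : ConvexLipschitz F L)
    {t : ℝ} (ht : 0 ≤ t) :
    (Measure.pi fun _ : ι => ν).real
      {x | t ≤ |F x - ∫ y, F y ∂(Measure.pi fun _ : ι => ν)|} ≤
      2 * Real.exp (-(t ^ 2 / (4 * K * L ^ 2))) := by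
  set P := Measure.pi fun _ : ι => ν
  set m := ∫ y, F y ∂P
  have hc := hK ι F L hL.le hF.1 hF.2
  have hi : ∀ lam, Integrable (fun x => Real.exp (lam * (F x - m))) P := by
    intro lam
    have h1 := ((hc lam).1).mul_const (Real.exp (-(lam * m)))
    refine h1.congr (Filter.Eventually.of_forall fun x => ?_)
    simp only
    rw [← Real.exp_add]
    ring_nf
  -- The minimiser of the Chernoff exponent `K lam^2 L^2 - lam t`.
  set lam := t / (2 * K * L ^ 2) with hlam
  have hlam0 : 0 ≤ lam := by positivity
  have e : Real.exp (-lam * t) * Real.exp (K * lam ^ 2 * L ^ 2) =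
      Real.exp (-(t ^ 2 / (4 * K * L ^ 2))) := by
    rw [← Real.exp_add]
    congr 1
    rw [hlam]
    field_simp
    ring
  have b1 : P.real {x | t ≤ F x - m} ≤ Real.exp (-(t ^ 2 / (4 * K * L ^ 2))) := by
    rw [← e]
    refine (measure_ge_le_exp_mul_mgf t hlam0 (hi lam)).trans ?_
    exact mul_le_mul_of_nonneg_left (hc lam).2 (Real.exp_pos _).le
  have b2 : P.real {x | F x - m ≤ -t} ≤ Real.exp (-(t ^ 2 / (4 * K * L ^ 2))) := by
    rw [← e]
    refine (measure_le_le_exp_mul_mgf (t := -lam) (-t) (by linarith) (hi (-lam))).trans ?_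
    have := (hc (-lam)).2
    rw [neg_sq] at this
    rw [neg_neg, mul_neg, ← neg_mul]
    exact mul_le_mul_of_nonneg_left this (Real.exp_pos _).le
  have hsub : {x | t ≤ |F x - m|} ⊆ {x | t ≤ F x - m} ∪ {x | F x - m ≤ -t} := by
    intro x hx
    rcases le_abs.1 (show t ≤ |F x - m| from hx) with h | h
    · exact Or.inl h
    · exact Or.inr (show F x - m ≤ -t by linarith)
  have := (measureReal_mono (μ := P) hsub).trans (measureReal_union_le _ _)
  linarith

/-- Deviation bound for a difference of convex Lipschitz functions. -/
theorem ConvexConcentration.measureReal_le_abs_sub_sub_le (hK : ConvexConcentration ν K)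
    (hK0 : 0 < K) (h2 : MemLp (fun x : ℝ => x) 2 ν)
    {ι : Type} [Fintype ι] {F G : (ι → ℝ) → ℝ} {L : ℝ} (hL : 0 < L)
    (hF : ConvexLipschitz F L) (hG : ConvexLipschitz G L) {t : ℝ} (ht : 0 ≤ t) :
    (Measure.pi fun _ : ι => ν).real
      {x | 2 * t ≤ |(F x - G x) - ∫ y, (F y - G y) ∂(Measure.pi fun _ : ι => ν)|} ≤
      4 * Real.exp (-(t ^ 2 / (4 * K * L ^ 2))) := by
  set P := Measure.pi fun _ : ι => ν
  have h1 := hK.measureReal_le_abs_sub_le hK0 hL hF ht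
  have h3 := hK.measureReal_le_abs_sub_le hK0 hL hG ht
  rw [integral_sub (hF.integrable h2 hL.le) (hG.integrable h2 hL.le)]
  set mF := ∫ y, F y ∂P
  set mG := ∫ y, G y ∂P
  have hsub : {x | 2 * t ≤ |(F x - G x) - (mF - mG)|} ⊆
      {x | t ≤ |F x - mF|} ∪ {x | t ≤ |G x - mG|} := by
    intro x hx
    have hx' : 2 * t ≤ |(F x - G x) - (mF - mG)| := hx
    by_contra hcon
    rw [Set.mem_union, not_or] at hcon
    have h4 : |F x - mF| < t := not_le.1 hcon.1
    have h5 : |G x - mG| < t := not_le.1 hcon.2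
    have h6 := abs_sub (F x - mF) (G x - mG)
    rw [show (F x - mF) - (G x - mG) = (F x - G x) - (mF - mG) by ring] at h6
    linarith
  have := (measureReal_mono (μ := P) hsub).trans (measureReal_union_le _ _)
  linarith

end

section

variable {n : ℕ}

theorem convexOn_max_div_add (r c : ℝ) : ConvexOn ℝ Set.univ fun x : ℝ => max (x / r + c) 0 := by
  have h : ConvexOn ℝ Set.univ fun x : ℝ => x / r + c :=
    ⟨convex_univ, fun x _ y _ s t _ _ hst => le_of_eq (by
      simp only [smul_eq_mul]
      linear_combination -c * hst)⟩
  exact h.sup (convexOn_const 0 convex_univ)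

theorem convexOn_max_abs_div_sub (r s : ℝ) :
    ConvexOn ℝ Set.univ fun x : ℝ => max (|x / r| - s) 0 := by
  have h : ConvexOn ℝ Set.univ fun x : ℝ => |x / r| - s := by
    refine ⟨convex_univ, fun x _ y _ a b ha hb hab => ?_⟩
    simp only [smul_eq_mul]
    have h1 := abs_add_le (a * (x / r)) (b * (y / r))
    rw [abs_mul, abs_mul, abs_of_nonneg ha, abs_of_nonneg hb] at h1
    rw [show (a * x + b * y) / r = a * (x / r) + b * (y / r) by ring]
    have h2 : s = a * s + b * s := by rw [← add_mul, hab, one_mul]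
    linarith
  exact h.sup (convexOn_const 0 convex_univ)

theorem ConvexOn.comp_scaledDeriv {φ : ℝ → ℝ} (hφ : ConvexOn ℝ Set.univ φ) (m : ℕ) (y : ℝ) :
    ConvexOn ℝ Set.univ fun v : Fin n ⊕ Fin n → ℝ => φ (scaledDeriv n m v y) := by
  refine ⟨convex_univ, fun v _ w _ s t hs ht hst => ?_⟩
  simp only [scaledDeriv_add_smul]
  exact hφ.2 trivial trivial hs ht hst

theorem abs_max_div_add_sub_le {r : ℝ} (hr : 0 < r) (c x y : ℝ) :
    |max (x / r + c) 0 - max (y / r + c) 0| ≤ |x - y| / r := by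
  refine (abs_max_sub_max_le_abs _ _ _).trans (le_of_eq ?_)
  rw [add_sub_add_right_eq_sub, ← sub_div, abs_div, abs_of_pos hr]

theorem abs_max_abs_div_sub_sub_le {r : ℝ} (hr : 0 < r) (s x y : ℝ) :
    |max (|x / r| - s) 0 - max (|y / r| - s) 0| ≤ |x - y| / r := by
  refine (abs_max_sub_max_le_abs _ _ _).trans ?_
  rw [sub_sub_sub_cancel_right]
  refine (abs_abs_sub_abs_le_abs_sub _ _).trans (le_of_eq ?_)
  rw [← sub_div, abs_div, abs_of_pos hr]

theorem convexLipschitz_integral_max_abs_sub (hn : 0 < n) {r : ℝ} (hr : 0 < r) (s : ℝ) :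
    ConvexLipschitz (fun v : Fin n ⊕ Fin n → ℝ => ∫ y in (-(2 * Real.pi * n))..(2 * Real.pi * n),
      max (|scaledDeriv n 0 v y / r| - s) 0) (9 * √n / r) := by
  have hpn : 0 ≤ 2 * Real.pi * n := by positivity
  have hc := fun v : Fin n ⊕ Fin n → ℝ => (contDiff_scaledDeriv 0 v).continuous
  refine ConvexLipschitz.intervalIntegral (h := fun v y => |scaledDeriv n 0 v y| / r)
    (by linarith) (fun v => ?_) (fun y => (convexOn_max_abs_div_sub r s).comp_scaledDeriv 0 y)
    (fun v => (hc v).abs.div_const r) (fun v w y => ?_) fun v => ?_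
  · have := hc v
    fun_prop
  · rw [scaledDeriv_sub]
    exact abs_max_abs_div_sub_sub_le hr _ _ _
  · rw [intervalIntegral.integral_div, div_mul_eq_mul_div]
    exact div_le_div_of_nonneg_right (integral_abs_scaledDeriv_le hn 0 v) hr.le

theorem convexLipschitz_integral_derivExcess (hn : 0 < n) (M : ℕ) (s : ℝ) :
    ConvexLipschitz (fun v : Fin n ⊕ Fin n → ℝ => ∫ y in (-(2 * Real.pi * n))..(2 * Real.pi * n),
      derivExcess M s (scaledDeriv n 0 v) y) (18 * √n) := by
  have hpn : 0 ≤ 2 * Real.pi * n := by positivity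
  have hc := fun (m : ℕ) (v : Fin n ⊕ Fin n → ℝ) => (contDiff_scaledDeriv m v).continuous
  have h2 : ∀ m : ℕ, (0 : ℝ) ≤ (1 / 2) ^ m := fun m => by positivity
  refine ConvexLipschitz.intervalIntegral
    (h := fun v y => ∑ m ∈ Finset.range (M + 1), (1 / 2 : ℝ) ^ m * |scaledDeriv n m v y|)
    (by linarith) (fun v => continuous_derivExcess (contDiff_scaledDeriv 0 v)) (fun y => ?_)
    (fun v => continuous_finsetSum _ fun m _ => (hc m v).abs.const_mul _) (fun v w y => ?_)
    fun v => ?_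
  · simp_rw [derivExcess_scaledDeriv]
    refine ⟨convex_univ, fun v _ w _ a b ha hb hab => ?_⟩
    simp only [smul_eq_mul, Finset.mul_sum, ← Finset.sum_add_distrib]
    refine Finset.sum_le_sum fun m _ => ?_
    have h := ((convexOn_max_abs_div_sub 1 s).comp_scaledDeriv (n := n) m y).2
      (x := v) (y := w) trivial trivial ha hb hab
    simp only [smul_eq_mul, div_one] at h
    have := mul_le_mul_of_nonneg_left h (h2 m)
    linarith
  · rw [derivExcess_scaledDeriv, derivExcess_scaledDeriv, ← Finset.sum_sub_distrib]
    refine (Finset.abs_sum_le_sum_abs _ _).trans (Finset.sum_le_sum fun m _ => ?_)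
    rw [← mul_sub, abs_mul, abs_of_nonneg (h2 m), scaledDeriv_sub]
    refine mul_le_mul_of_nonneg_left ?_ (h2 m)
    simpa using abs_max_abs_div_sub_sub_le one_pos s (scaledDeriv n m v y) (scaledDeriv n m w y)
  · rw [intervalIntegral.integral_finsetSum fun m _ =>
      ((hc m v).abs.const_mul _).intervalIntegrable _ _]
    have h3 : ∀ m ∈ Finset.range (M + 1), ∫ y in (-(2 * Real.pi * n))..(2 * Real.pi * n),
        (1 / 2 : ℝ) ^ m * |scaledDeriv n m v y| ≤ (1 / 2 : ℝ) ^ m * (9 * √n * √(∑ i, v i ^ 2)) := by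
      intro m _
      rw [intervalIntegral.integral_const_mul]
      exact mul_le_mul_of_nonneg_left (integral_abs_scaledDeriv_le hn m v) (h2 m)
    refine (Finset.sum_le_sum h3).trans ?_
    rw [← Finset.sum_mul]
    have h4 := sum_half_pow_le (M + 1)
    have : 0 ≤ 9 * √(n : ℝ) * √(∑ i, v i ^ 2) := by positivity
    nlinarith

theorem integral_nearZero_eq_sub {r : ℝ} (v : Fin n ⊕ Fin n → ℝ) :
    ∫ y in (-(2 * Real.pi * n))..(2 * Real.pi * n), nearZero (scaledDeriv n 0 v y / r) =
      (2 * Real.pi * n - -(2 * Real.pi * n) + ∫ y in (-(2 * Real.pi * n))..(2 * Real.pi * n),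
        max (|scaledDeriv n 0 v y / r| - 2) 0) -
      ∫ y in (-(2 * Real.pi * n))..(2 * Real.pi * n), max (|scaledDeriv n 0 v y / r| - 1) 0 := by
  have hc := (contDiff_scaledDeriv 0 v).continuous
  have i1 : ∀ s : ℝ, IntervalIntegrable (fun y => max (|scaledDeriv n 0 v y / r| - s) 0) volume
      (-(2 * Real.pi * n)) (2 * Real.pi * n) := fun s =>
    (by fun_prop : Continuous fun y => max (|scaledDeriv n 0 v y / r| - s) 0).intervalIntegrable _ _
  have i2 : IntervalIntegrable (fun y => 1 + max (|scaledDeriv n 0 v y / r| - 2) 0) volume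
      (-(2 * Real.pi * n)) (2 * Real.pi * n) := intervalIntegrable_const.add (i1 2)
  simp only [nearZero]
  rw [intervalIntegral.integral_sub i2 (i1 1),
    intervalIntegral.integral_add intervalIntegrable_const (i1 2),
    intervalIntegral.integral_const, smul_eq_mul, mul_one]

theorem clampUnit_eq (x : ℝ) : clampUnit x = max (x + 1) 0 - max (x + -1) 0 - 1 := by
  unfold clampUnit
  rcases max_cases (x + 1) 0 with h | h <;> rcases max_cases (x + -1) 0 with h' | h' <;>
    rcases min_cases 1 x with h'' | h'' <;> rw [h.1, h'.1, h''.1] <;>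
    rcases max_cases (-1) (min 1 x) with h3 | h3 <;> rw [h''.1] at h3 <;> rw [h3.1] <;> linarith

/-- The two competing convex functions whose difference controls `signChange`. -/
theorem signChange_eq (r u v : ℝ) :
    signChange r u v =
      max (max (u / r + 1) 0 + max (v / r + -1) 0) (max (v / r + 1) 0 + max (u / r + -1) 0) -
      1 / 2 * ((max (u / r + 1) 0 + max (v / r + -1) 0) +
        (max (v / r + 1) 0 + max (u / r + -1) 0)) := by
  rw [signChange, clampUnit_eq, clampUnit_eq]
  set p := max (u / r + 1) 0 + max (v / r + -1) 0 with hp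
  set q := max (v / r + 1) 0 + max (u / r + -1) 0 with hq
  rw [show max (u / r + 1) 0 - max (u / r + -1) 0 - 1 -
    (max (v / r + 1) 0 - max (v / r + -1) 0 - 1) = p - q by rw [hp, hq]; ring]
  rcases abs_cases (p - q) with h | h <;> rcases max_cases p q with h' | h' <;>
    rw [h.1, h'.1] <;> linarith

theorem integral_abs_scaledDeriv_shift_le (hn : 0 < n) {η : ℝ} (hη : 0 ≤ η) (hη1 : η ≤ 1)
    (v : Fin n ⊕ Fin n → ℝ) :
    ∫ y in (-(Real.pi * n))..(Real.pi * n), |scaledDeriv n 0 v (y + η)| ≤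
      9 * √n * √(∑ i, v i ^ 2) := by
  have hc := (contDiff_scaledDeriv 0 v).continuous
  have hn1 : (1 : ℝ) ≤ n := by exact_mod_cast hn
  have hpi := Real.pi_gt_three
  have h1 : 1 ≤ Real.pi * n := by nlinarith
  rw [intervalIntegral.integral_comp_add_right fun y => |scaledDeriv n 0 v y|]
  refine le_trans ?_ (integral_abs_scaledDeriv_le hn 0 v)
  exact intervalIntegral.integral_mono_interval (by linarith) (by linarith) (by linarith)
    (Filter.Eventually.of_forall fun y => abs_nonneg _) (hc.abs.intervalIntegrable _ _)

/-- The smoothed count of sign changes is a difference of convex Lipschitz functions. -/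
theorem exists_integral_signChange_eq_sub (hn : 0 < n) {r η : ℝ} (hr : 0 < r) (hη : 0 ≤ η)
    (hη1 : η ≤ 1) : ∃ F G : (Fin n ⊕ Fin n → ℝ) → ℝ,
      ConvexLipschitz F (18 * √n / r) ∧ ConvexLipschitz G (18 * √n / r) ∧
      ∀ v, ∫ y in (-(Real.pi * n))..(Real.pi * n),
        signChange r (scaledDeriv n 0 v y) (scaledDeriv n 0 v (y + η)) = F v - G v := by
  have hpn : 0 ≤ Real.pi * n := by positivity
  have hc := fun v : Fin n ⊕ Fin n → ℝ => (contDiff_scaledDeriv 0 v).continuous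
  have hcs : ∀ v : Fin n ⊕ Fin n → ℝ, Continuous fun y => scaledDeriv n 0 v (y + η) := fun v =>
    (hc v).comp (by fun_prop)
  set p : (Fin n ⊕ Fin n → ℝ) → ℝ → ℝ := fun v y =>
    max (scaledDeriv n 0 v y / r + 1) 0 + max (scaledDeriv n 0 v (y + η) / r + -1) 0 with hp
  set q : (Fin n ⊕ Fin n → ℝ) → ℝ → ℝ := fun v y =>
    max (scaledDeriv n 0 v (y + η) / r + 1) 0 + max (scaledDeriv n 0 v y / r + -1) 0 with hq
  set h : (Fin n ⊕ Fin n → ℝ) → ℝ → ℝ := fun v y =>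
    |scaledDeriv n 0 v y| / r + |scaledDeriv n 0 v (y + η)| / r with hh
  have hpc : ∀ v, Continuous (p v) := fun v => by
    have h1 := hc v
    have h2 := hcs v
    fun_prop
  have hqc : ∀ v, Continuous (q v) := fun v => by
    have h1 := hc v
    have h2 := hcs v
    fun_prop
  have hhc : ∀ v, Continuous (h v) := fun v => by
    have h1 := hc v
    have h2 := hcs v
    fun_prop
  have hpx : ∀ y, ConvexOn ℝ Set.univ fun v => p v y := fun y =>
    ((convexOn_max_div_add r 1).comp_scaledDeriv 0 y).add
      ((convexOn_max_div_add r (-1)).comp_scaledDeriv 0 (y + η))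
  have hqx : ∀ y, ConvexOn ℝ Set.univ fun v => q v y := fun y =>
    ((convexOn_max_div_add r 1).comp_scaledDeriv 0 (y + η)).add
      ((convexOn_max_div_add r (-1)).comp_scaledDeriv 0 y)
  have hpl : ∀ v w y, |p v y - p w y| ≤ h (v - w) y := by
    intro v w y
    simp only [hp, hh, scaledDeriv_sub]
    rw [add_sub_add_comm]
    exact (abs_add_le _ _).trans (add_le_add (abs_max_div_add_sub_le hr _ _ _)
      (abs_max_div_add_sub_le hr _ _ _))
  have hql : ∀ v w y, |q v y - q w y| ≤ h (v - w) y := by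
    intro v w y
    simp only [hq, hh, scaledDeriv_sub]
    rw [add_sub_add_comm, add_comm (|scaledDeriv n 0 v y - scaledDeriv n 0 w y| / r)]
    exact (abs_add_le _ _).trans (add_le_add (abs_max_div_add_sub_le hr _ _ _)
      (abs_max_div_add_sub_le hr _ _ _))
  have hL : ∀ v, ∫ y in (-(Real.pi * n))..(Real.pi * n), h v y ≤
      18 * √n / r * √(∑ i, v i ^ 2) := by
    intro v
    have i1 : IntervalIntegrable (fun y => |scaledDeriv n 0 v y| / r) volume
        (-(Real.pi * n)) (Real.pi * n) := ((hc v).abs.div_const r).intervalIntegrable _ _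
    have i2 : IntervalIntegrable (fun y => |scaledDeriv n 0 v (y + η)| / r) volume
        (-(Real.pi * n)) (Real.pi * n) := ((hcs v).abs.div_const r).intervalIntegrable _ _
    simp only [hh]
    rw [intervalIntegral.integral_add i1 i2, intervalIntegral.integral_div,
      intervalIntegral.integral_div, ← add_div, div_mul_eq_mul_div]
    refine div_le_div_of_nonneg_right ?_ hr.le
    have h1 := integral_abs_scaledDeriv_shift_le hn le_rfl zero_le_one v
    simp only [add_zero] at h1
    have h2 := integral_abs_scaledDeriv_shift_le hn hη hη1 v
    linarith
  refine ⟨fun v => ∫ y in (-(Real.pi * n))..(Real.pi * n), max (p v y) (q v y),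
    fun v => ∫ y in (-(Real.pi * n))..(Real.pi * n), 1 / 2 * (p v y + q v y), ?_, ?_, fun v => ?_⟩
  · refine ConvexLipschitz.intervalIntegral (h := h) (by linarith)
      (fun v => (hpc v).max (hqc v)) (fun y => (hpx y).sup (hqx y)) hhc (fun v w y => ?_) hL
    exact (abs_max_sub_max_le_max _ _ _ _).trans (max_le (hpl v w y) (hql v w y))
  · refine ConvexLipschitz.intervalIntegral (h := h) (by linarith)
      (fun v => ((hpc v).add (hqc v)).const_mul _)
      (fun y => by simpa using! ((hpx y).add (hqx y)).smul (by norm_num : (0 : ℝ) ≤ 1 / 2))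
      hhc (fun v w y => ?_) hL
    rw [← mul_sub, add_sub_add_comm, abs_mul, abs_of_pos (by norm_num : (0 : ℝ) < 1 / 2)]
    have h1 := abs_add_le (p v y - p w y) (q v y - q w y)
    have h2 := hpl v w y
    have h3 := hql v w y
    linarith
  · have c1 : Continuous fun y => max (p v y) (q v y) := (hpc v).max (hqc v)
    have c2 : Continuous fun y => 1 / 2 * (p v y + q v y) := ((hpc v).add (hqc v)).const_mul _
    simp only
    rw [← intervalIntegral.integral_sub (c1.intervalIntegrable _ _) (c2.intervalIntegrable _ _)]
    -- Pointwise this is `|p - q| / 2 = max p q - (p + q) / 2`, with `p` and `q` convex in the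
    -- coefficients.
    exact intervalIntegral.integral_congr fun y _ => signChange_eq _ _ _

end

/-! ### Deviation bound for the root count with free parameters. -/

section

variable {n : ℕ} {ν : Measure ℝ} [IsProbabilityMeasure ν] {K : ℝ}

theorem integrable_rootCount (n : ℕ) :
    Integrable (fun v : Fin n ⊕ Fin n → ℝ =>
      (rootCount n (fun j => v (Sum.inl j)) (fun j => v (Sum.inr j)) : ℝ))
      (Measure.pi fun _ => ν) := by
  have hm : Measurable fun v : Fin n ⊕ Fin n → ℝ =>
      (rootCount n (fun j => v (Sum.inl j)) (fun j => v (Sum.inr j)) : ℝ) :=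
    measurable_from_top.comp (measurable_rootCount n)
  refine Integrable.of_bound (C := 2 * n + 1) hm.aestronglyMeasurable
    (Filter.Eventually.of_forall fun v => ?_)
  rw [Real.norm_natCast]
  exact_mod_cast rootCount_le _ _

/-- If `|N - F| ≤ R` with `𝔼 R ≤ T / 4`, then deviations of `N` come from those of `F` and `R`. -/
theorem measureReal_le_abs_sub_le_add {V : Type*} [MeasurableSpace V] {P : Measure V}
    [IsProbabilityMeasure P] {N F R : V → ℝ} (hN : Integrable N P) (hF : Integrable F P)
    (hR : Integrable R P) (h : ∀ v, |N v - F v| ≤ R v) {T : ℝ} (hRT : ∫ v, R v ∂P ≤ T / 4) :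
    P.real {v | T ≤ |N v - ∫ w, N w ∂P|} ≤
      P.real {v | T / 4 ≤ |F v - ∫ w, F w ∂P|} + P.real {v | T / 4 ≤ |R v - ∫ w, R w ∂P|} := by
  -- Off both events `|N - 𝔼 N|` is below `T`: one quarter from `F`, two from `R < 𝔼 R + T / 4`, and
  -- one from the distance of the two means.
  have h1 : |∫ w, N w ∂P - ∫ w, F w ∂P| ≤ ∫ w, R w ∂P := by
    rw [← integral_sub hN hF]
    exact (abs_integral_le_integral_abs).trans (integral_mono (hN.sub hF).abs hR h)
  refine (measureReal_mono (μ := P) fun v hv => ?_).trans (measureReal_union_le _ _)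
  have hv' : T ≤ |N v - ∫ w, N w ∂P| := hv
  by_contra hcon
  rw [Set.mem_union, not_or] at hcon
  have h2 : |F v - ∫ w, F w ∂P| < T / 4 := not_le.1 hcon.1
  have h3 : |R v - ∫ w, R w ∂P| < T / 4 := not_le.1 hcon.2
  have h4 := h v
  have h5 := abs_add_three (N v - F v) (F v - ∫ w, F w ∂P) (∫ w, F w ∂P - ∫ w, N w ∂P)
  rw [show N v - F v + (F v - ∫ w, F w ∂P) + (∫ w, F w ∂P - ∫ w, N w ∂P) =
    N v - ∫ w, N w ∂P by ring, abs_sub_comm (∫ w, F w ∂P)] at h5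
  have h6 := (abs_lt.1 h3).2
  linarith

/-- Combines the deterministic comparison with concentration of the statistic and of its error
bound. Each is a difference of two convex functions and contributes 4 to the prefactor 8. -/
theorem ConvexConcentration.measureReal_rootCount_le (hK : ConvexConcentration ν K) (hK0 : 0 < K)
    (h2 : MemLp (fun x : ℝ => x) 2 ν) (h0 : ∫ x, x ∂ν = 0) (h1 : ∫ x, x ^ 2 ∂ν = 1)
    {k : ℕ} (hn : 0 < n) (hk : 1 ≤ k) {b r s η : ℝ}
    (hbk : b * 2 ^ k = 2 * Real.pi * n) (hb : 1 ≤ b)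
    (hs : 0 ≤ s) (hsb : s ≤ b) (hr0 : 0 < r) (hr1 : r ≤ 1)
    (hr : ∀ m : ℕ, b ≤ m → 6 * (1 / 2 : ℝ) ^ m ≤ r)
    (hη : 0 < η) (hη1 : η ≤ 1) (hηr : η ^ 2 * (6 * s * b + 16) ≤ r) {T : ℝ} (hT : 0 ≤ T)
    (hmean : 2 + 162 * b / η * (4 * Real.pi * n *
        (2 * (8 * r + (384 * Real.exp K * (1 / √n) / (2 * r)) ^ 2))) +
      160 * b * (4 * Real.pi * n * (4 * Real.exp K * Real.exp (-s))) ≤ T / 4) :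
    (Measure.pi fun _ : Fin n ⊕ Fin n => ν).real
      {v | T ≤ |(rootCount n (fun j => v (Sum.inl j)) (fun j => v (Sum.inr j)) : ℝ) -
        ∫ w, (rootCount n (fun j => w (Sum.inl j)) (fun j => w (Sum.inr j)) : ℝ)
          ∂(Measure.pi fun _ : Fin n ⊕ Fin n => ν)|} ≤
      8 * Real.exp (-((T / 8) ^ 2 / (4 * K * (4400 * b * √n / (η * r)) ^ 2))) := by
  set P := Measure.pi fun _ : Fin n ⊕ Fin n => ν
  have hn' : (0 : ℝ) < n := Nat.cast_pos.2 hn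
  have hsn : 0 < √(n : ℝ) := Real.sqrt_pos.2 hn'
  -- A common Lipschitz constant for the four convex functions; the largest need is `1458 + 2880 =
  -- 4338`, with `1458 = 162 · 9` and `2880 = 160 · 18`.
  set L := 4400 * b * √n / (η * r) with hL
  have hηr0 : 0 < η * r := by positivity
  have hηr1 : η * r ≤ 1 := mul_le_one₀ hη1 hr0.le hr1
  have hL0 : 0 < L := by positivity
  have hLS : η⁻¹ * (18 * √n / r) ≤ L := by
    rw [hL, show η⁻¹ * (18 * √n / r) = 18 * √n / (η * r) by field_simp]
    gcongr
    nlinarith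
  have hLA : 162 * b / η * (9 * √n / r) ≤ L := by
    rw [hL, show 162 * b / η * (9 * √n / r) = 1458 * b * √n / (η * r) by field_simp; ring]
    gcongr
    norm_num
  have hLD : 162 * b / η * (9 * √n / r) + 160 * b * (18 * √n) ≤ L := by
    have h3 : 160 * b * (18 * √n) ≤ 2880 * b * √n / (η * r) := by
      rw [le_div_iff₀ hηr0]
      have : 0 ≤ b * √n := by positivity
      nlinarith
    have h4 : 162 * b / η * (9 * √n / r) = 1458 * b * √n / (η * r) := by field_simp; ring
    have h5 : 1458 * b * √n / (η * r) + 2880 * b * √n / (η * r) ≤ L := by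
      rw [← add_div, hL]
      gcongr
      nlinarith [mul_pos (by linarith : 0 < b) hsn]
    linarith
  obtain ⟨F₁, F₂, hF₁, hF₂, hF⟩ := exists_integral_signChange_eq_sub hn hr0 hη.le hη1
  have cF₁ := (hF₁.const_mul (inv_nonneg.2 hη.le)).mono hLS
  have cF₂ := (hF₂.const_mul (inv_nonneg.2 hη.le)).mono hLS
  have hbη : 0 ≤ 162 * b / η := by positivity
  have cA₁ := convexLipschitz_integral_max_abs_sub hn hr0 2
  have cA₂ := (convexLipschitz_integral_max_abs_sub hn hr0 1)
  have cD := convexLipschitz_integral_derivExcess hn (2 * n + 3) s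
  have cR₁ := ((((cA₁.const_add (2 * Real.pi * n - -(2 * Real.pi * n))).const_mul hbη).add
    (cD.const_mul (by positivity : 0 ≤ 160 * b))).const_add 2).mono hLD
  have cR₂ := (cA₂.const_mul hbη).mono hLA
  set A : (Fin n ⊕ Fin n → ℝ) → ℝ := fun v => ∫ y in (-(2 * Real.pi * n))..(2 * Real.pi * n),
    nearZero (scaledDeriv n 0 v y / r) with hA
  set D : (Fin n ⊕ Fin n → ℝ) → ℝ := fun v => ∫ y in (-(2 * Real.pi * n))..(2 * Real.pi * n),
    derivExcess (2 * n + 3) s (scaledDeriv n 0 v) y with hD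
  set R₁ : (Fin n ⊕ Fin n → ℝ) → ℝ := fun v => 2 + (162 * b / η *
    (2 * Real.pi * n - -(2 * Real.pi * n) + ∫ y in (-(2 * Real.pi * n))..(2 * Real.pi * n),
        max (|scaledDeriv n 0 v y / r| - 2) 0) + 160 * b * D v) with hR₁
  set R₂ : (Fin n ⊕ Fin n → ℝ) → ℝ := fun v => 162 * b / η *
    ∫ y in (-(2 * Real.pi * n))..(2 * Real.pi * n),
      max (|scaledDeriv n 0 v y / r| - 1) 0 with hR₂
  have hRe : ∀ v, R₁ v - R₂ v = 2 + 162 * b / η * A v + 160 * b * D v := by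
    intro v
    rw [hA, hR₁, hR₂]
    simp only
    rw [integral_nearZero_eq_sub]
    ring
  have iF : Integrable (fun v => η⁻¹ * F₁ v - η⁻¹ * F₂ v) P :=
    (cF₁.integrable h2 hL0.le).sub (cF₂.integrable h2 hL0.le)
  have iR : Integrable (fun v => R₁ v - R₂ v) P :=
    (cR₁.integrable h2 hL0.le).sub (cR₂.integrable h2 hL0.le)
  have iD : Integrable D P := cD.integrable h2 (by positivity)
  have iA : Integrable A P := by
    have h3 := (((cA₁.const_add (2 * Real.pi * n - -(2 * Real.pi * n))).integrable
      (ν := ν) h2 (by positivity)).sub (cA₂.integrable (ν := ν) h2 (by positivity)))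
    refine h3.congr (Filter.Eventually.of_forall fun v => ?_)
    rw [hA]
    simp only [Pi.sub_apply]
    rw [integral_nearZero_eq_sub]
  have hER : ∫ v, (R₁ v - R₂ v) ∂P ≤ T / 4 := by
    simp_rw [hRe]
    have i3 : Integrable (fun v => 2 + 162 * b / η * A v) P :=
      (integrable_const 2).add (iA.const_mul _)
    rw [integral_add i3 (iD.const_mul _), integral_add (integrable_const 2) (iA.const_mul _),
      integral_const_mul, integral_const_mul, integral_const, probReal_univ, one_smul]
    refine le_trans (add_le_add (add_le_add_right (mul_le_mul_of_nonneg_left ?_ hbη) 2)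
      (mul_le_mul_of_nonneg_left ?_ (by positivity))) hmean
    · refine (hK.integral_nearZero_scaledDeriv_le h2 h0 h1 hK0.le hn hr0).trans (le_of_eq ?_)
      ring
    · refine (hK.integral_derivExcess_scaledDeriv_le h2 h0 hn _ s).trans (le_of_eq ?_)
      ring
  have hdev := measureReal_le_abs_sub_le_add (P := P) (integrable_rootCount n) iF iR (fun v => by
    rw [hRe, ← mul_sub, ← hF]
    exact abs_rootCount_sub_le hn hk hbk hb hs hsb hr0 hr hη hη1 hηr v) hER
  have hd1 := hK.measureReal_le_abs_sub_sub_le hK0 h2 hL0 cF₁ cF₂ (t := T / 8) (by positivity)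
  have hd2 := hK.measureReal_le_abs_sub_sub_le hK0 h2 hL0 cR₁ cR₂ (t := T / 8) (by positivity)
  rw [show 2 * (T / 8) = T / 4 by ring] at hd1 hd2
  linarith

end

/-! ### Choice of the parameters as powers of one small number. -/

section

theorem exists_exp_neg_inv_le (N : ℕ) :
    ∃ B : ℝ, 0 < B ∧ ∀ x : ℝ, 0 < x → Real.exp (-x⁻¹) ≤ B * x ^ N := by
  refine ⟨N.factorial, by positivity, fun x hx => ?_⟩
  have h := Real.pow_div_factorial_le_exp x⁻¹ (inv_nonneg.2 hx.le) N
  rw [Real.exp_neg, inv_le_comm₀ (Real.exp_pos _) (by positivity)]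
  refine le_trans (le_of_eq ?_) h
  rw [inv_pow]
  field_simp

theorem exists_half_pow_le (N : ℕ) :
    ∃ A : ℝ, 0 < A ∧ ∀ (x : ℝ) (m : ℕ), 0 < x → x⁻¹ ≤ m → (1 / 2 : ℝ) ^ m ≤ A * x ^ N := by
  obtain ⟨B, hB0, hB⟩ := exists_exp_neg_inv_le N
  refine ⟨B * 2 ^ N, by positivity, fun x m hx hm => ?_⟩
  have h2 := hB (2 * x) (by positivity)
  rw [mul_pow, ← mul_assoc] at h2
  refine le_trans ?_ h2
  have h1 : (1 / 2 : ℝ) ≤ Real.exp (-(1 / 2)) := by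
    have := Real.add_one_le_exp (-(1 / 2 : ℝ))
    linarith
  calc (1 / 2 : ℝ) ^ m ≤ Real.exp (-(1 / 2)) ^ m := pow_le_pow_left₀ (by norm_num) h1 m
    _ = Real.exp (-(m / 2)) := by
        rw [← Real.exp_nat_mul]
        ring_nf
    _ ≤ Real.exp (-(2 * x)⁻¹) := by
        refine Real.exp_le_exp.2 (neg_le_neg ?_)
        rw [mul_inv]
        linarith

/-- The factor `q` in `[1, 2]` adjusts the cell length so that the whole interval is exactly a
dyadic multiple of it. -/
theorem exists_scale {x ρ : ℝ} (hρ : 0 < ρ) (hx : 2 ≤ x * ρ) :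
    ∃ (k : ℕ) (q : ℝ), 1 ≤ k ∧ 1 ≤ q ∧ q ≤ 2 ∧ q / ρ * 2 ^ k = x := by
  obtain ⟨k, h1, h2⟩ := exists_nat_pow_near (by linarith : 1 ≤ x * ρ) one_lt_two
  refine ⟨k, x * ρ / 2 ^ k, ?_, ?_, ?_, ?_⟩
  · by_contra h
    have : k = 0 := by omega
    subst this
    norm_num at h2
    linarith
  · rwa [le_div_iff₀ (by positivity), one_mul]
  · rw [div_le_iff₀ (by positivity)]
    rw [pow_succ] at h2
    linarith
  · field_simp

/-- Orders of magnitude: `(b / η) n r` is `ρ^25 n`; the small-ball correction `(b / η) / r^2` is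
`ρ^(-137)`, at most `ρ^25 n` by `h162`; the excess term is `ρ^(-1) ρ^26 n`. -/
theorem mean_error_le {ρ q E B : ℝ} {n : ℕ} (hρ : 0 < ρ) (hn : 0 < n) (h25 : 1 ≤ ρ ^ 25 * n)
    (h162 : 1 ≤ ρ ^ 162 * n) (hq0 : 0 < q) (hq2 : q ≤ 2) (hE : 0 < E) (hB0 : 0 < B)
    (hB : Real.exp (-ρ⁻¹) ≤ B * ρ ^ 26) :
    2 + 162 * (q / ρ) / ρ ^ 28 * (4 * Real.pi * n * (2 * (8 * (28 * ρ ^ 54) +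
        (384 * E * (1 / √n) / (2 * (28 * ρ ^ 54))) ^ 2))) +
      160 * (q / ρ) * (4 * Real.pi * n * (4 * E * Real.exp (-ρ⁻¹))) ≤
    (2 + 162 * 64 * 28 * 8 + 162 * 64 * (192 * E) ^ 2 + 160 * 128 * E * B) * (ρ ^ 25 * n) := by
  have hn' : (0 : ℝ) < n := Nat.cast_pos.2 hn
  have hpi4 := Real.pi_le_four
  have hsqn : (1 / √(n : ℝ)) ^ 2 = 1 / n := by
    rw [div_pow, one_pow, Real.sq_sqrt hn'.le]
  set X := ρ ^ 25 * n with hX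
  have t1 : 162 * (q / ρ) / ρ ^ 28 * (4 * Real.pi * n * (2 * (8 * (28 * ρ ^ 54) +
      (384 * E * (1 / √n) / (2 * (28 * ρ ^ 54))) ^ 2))) =
      162 * 64 * 28 * (q * Real.pi) * X +
        162 * 8 * (192 * E) ^ 2 / 784 * (q * Real.pi) * (1 / ρ ^ 137) := by
    rw [div_pow (384 * E * (1 / √n)), mul_pow (384 * E), hsqn, hX]
    field_simp
    ring
  have t2 : 1 / ρ ^ 137 ≤ X := by
    rw [div_le_iff₀ (by positivity), hX]
    refine h162.trans (le_of_eq ?_)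
    ring
  have hqπ : q * Real.pi ≤ 8 := by nlinarith [Real.pi_pos]
  have hqπ0 : 0 < q * Real.pi := mul_pos hq0 Real.pi_pos
  have t3 : 162 * 64 * 28 * (q * Real.pi) * X ≤ 162 * 64 * 28 * 8 * X := by gcongr
  have t4 : 162 * 8 * (192 * E) ^ 2 / 784 * (q * Real.pi) * (1 / ρ ^ 137) ≤
      162 * 64 * (192 * E) ^ 2 * X := by
    calc 162 * 8 * (192 * E) ^ 2 / 784 * (q * Real.pi) * (1 / ρ ^ 137)
        ≤ 162 * 8 * (192 * E) ^ 2 / 784 * 8 * X := by gcongr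
      _ = 162 * 64 / 784 * ((192 * E) ^ 2 * X) := by ring
      _ ≤ 162 * 64 * ((192 * E) ^ 2 * X) :=
          mul_le_mul_of_nonneg_right (by norm_num) (by positivity)
      _ = 162 * 64 * (192 * E) ^ 2 * X := by ring
  have t5 : 160 * (q / ρ) * (4 * Real.pi * n * (4 * E * Real.exp (-ρ⁻¹))) ≤
      160 * 128 * E * B * X := by
    calc 160 * (q / ρ) * (4 * Real.pi * n * (4 * E * Real.exp (-ρ⁻¹)))
        ≤ 160 * (q / ρ) * (4 * Real.pi * n * (4 * E * (B * ρ ^ 26))) := by gcongr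
      _ = 160 * 16 * E * B * (q * Real.pi) * X := by
          rw [hX]
          field_simp
          ring
      _ ≤ 160 * 16 * E * B * 8 * X := by gcongr
      _ = _ := by ring
  rw [t1, add_mul, add_mul, add_mul]
  linarith

/-- The squared Lipschitz constant is of order `ρ^(-166) n`, so the quotient is of order `ρ^214 n`.
A factor `ρ^2` is given away to reach `216 = 9 · 24`; and `4400 · 2 / 28 ≤ 315`. -/
theorem exponent_le {ρ q K : ℝ} {n : ℕ} (hρ : 0 < ρ) (hρ1 : ρ ≤ 1) (hn : 0 < n) (hq0 : 0 < q)
    (hq2 : q ≤ 2) (hK0 : 0 < K) :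
    (256 * K * 315 ^ 2)⁻¹ * (ρ ^ 216 * n) ≤ (ρ ^ 24 * n / 8) ^ 2 /
      (4 * K * (4400 * (q / ρ) * √n / (ρ ^ 28 * (28 * ρ ^ 54))) ^ 2) := by
  have hn' : (0 : ℝ) < n := Nat.cast_pos.2 hn
  have hL : (4400 * (q / ρ) * √n / (ρ ^ 28 * (28 * ρ ^ 54))) ^ 2 =
      (4400 * q / 28) ^ 2 * n / ρ ^ 166 := by
    rw [div_pow, mul_pow (4400 * (q / ρ)), Real.sq_sqrt hn'.le]
    field_simp
  have hq : (4400 * q / 28) ^ 2 ≤ 315 ^ 2 := pow_le_pow_left₀ (by positivity) (by linarith) 2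
  rw [hL, le_div_iff₀ (by positivity)]
  set Q := (4400 * q / 28) ^ 2
  have e : (256 * K * 315 ^ 2)⁻¹ * (ρ ^ 216 * n) * (4 * K * (Q * n / ρ ^ 166)) =
      ρ ^ 50 * n ^ 2 / 64 * (Q / 315 ^ 2) := by
    field_simp
    ring
  rw [e]
  calc ρ ^ 50 * n ^ 2 / 64 * (Q / 315 ^ 2)
      ≤ ρ ^ 48 * n ^ 2 / 64 * 1 := by
        gcongr ?_ * _ / _ * ?_
        · exact pow_le_pow_of_le_one hρ.le hρ1 (by norm_num)
        · rw [div_le_one (by norm_num)]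
          exact hq
    _ = (ρ ^ 24 * n / 8) ^ 2 := by ring

theorem exists_measureReal_rootCount_le {K : ℝ} (hK0 : 0 < K) :
    ∃ ρ₀ : ℝ, 0 < ρ₀ ∧ ρ₀ ≤ 1 ∧ ∀ (ν : Measure ℝ) [IsProbabilityMeasure ν],
      ConvexConcentration ν K → MemLp (fun x : ℝ => x) 2 ν → ∫ x, x ∂ν = 0 → ∫ x, x ^ 2 ∂ν = 1 →
      ∀ (n : ℕ) (ρ : ℝ), 0 < ρ → ρ ≤ ρ₀ → 1 ≤ ρ ^ 432 * n →
      (Measure.pi fun _ : Fin n ⊕ Fin n => ν).real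
        {v | ρ ^ 24 * n ≤ |(rootCount n (fun j => v (Sum.inl j)) (fun j => v (Sum.inr j)) : ℝ) -
          ∫ w, (rootCount n (fun j => w (Sum.inl j)) (fun j => w (Sum.inr j)) : ℝ)
            ∂(Measure.pi fun _ : Fin n ⊕ Fin n => ν)|} ≤
        8 * Real.exp (-((256 * K * 315 ^ 2)⁻¹ * (ρ ^ 216 * n))) := by
  obtain ⟨A, hA0, hA⟩ := exists_half_pow_le 55
  obtain ⟨B, hB0, hB⟩ := exists_exp_neg_inv_le 26
  set C₁ : ℝ := 6 * A with hC₁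
  set E := Real.exp K with hE
  set C₂ : ℝ := 2 + 162 * 64 * 28 * 8 + 162 * 64 * (192 * E) ^ 2 +
    160 * 128 * E * B with hC₂
  have hE1 : 0 < E := Real.exp_pos K
  have hC₁0 : 0 < C₁ := by positivity
  have hC₂0 : 0 < C₂ := by positivity
  have hM : 28 ≤ 28 + C₁ + 4 * C₂ := by linarith
  -- The three summands yield in turn `r ≤ 1`, the bound `6 · 2^(-m) ≤ r`, and a mean error of at
  -- most a quarter of `ρ^24 n`.
  refine ⟨(28 + C₁ + 4 * C₂)⁻¹, by positivity, inv_le_one_of_one_le₀ (by linarith), ?_⟩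
  intro ν _ hK h2 h0 h1 n ρ hρ hρ₀ hn1
  have hρM : ρ * (28 + C₁ + 4 * C₂) ≤ 1 := by
    rwa [← le_div_iff₀ (by linarith), one_div]
  have hρ28 : 28 * ρ ≤ 1 := by nlinarith
  have hρ1 : ρ ≤ 1 := by linarith
  have hρC₁ : C₁ * ρ ≤ 1 := by nlinarith
  have hρC₂ : C₂ * ρ ≤ 1 / 4 := by nlinarith
  have hn : 0 < n := by
    rcases Nat.eq_zero_or_pos n with h | h
    · subst h
      norm_num at hn1
    · exact h
  have hn' : (0 : ℝ) < n := Nat.cast_pos.2 hn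
  have hpow : ∀ a b : ℕ, a ≤ b → ρ ^ b ≤ ρ ^ a := fun a b hab =>
    pow_le_pow_of_le_one hρ.le hρ1 hab
  have hpown : ∀ a : ℕ, a ≤ 432 → 1 ≤ ρ ^ a * n := fun a ha =>
    hn1.trans (mul_le_mul_of_nonneg_right (hpow a 432 ha) hn'.le)
  have hpi := Real.pi_gt_three
  obtain ⟨k, q, hk, hq1, hq2, hbk⟩ := exists_scale (x := 2 * Real.pi * n) hρ (by
    have := hpown 1 (by norm_num)
    nlinarith)
  have hq0 : 0 < q := by linarith
  have hbinv : ρ⁻¹ ≤ q / ρ := by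
    rw [inv_eq_one_div]
    gcongr
  have hr0 : 0 < 28 * ρ ^ 54 := by positivity
  have hX1 := hpown 25 (by norm_num)
  -- The 28 in `r` is `6 q + 16` at `q = 2`: with these values `η^2 (6 s b + 16) = 6 q ρ^54 + 16
  -- ρ^56 ≤ r`.
  have hmain := hK.measureReal_rootCount_le hK0 h2 h0 h1 (n := n) (k := k) (b := q / ρ)
    (r := 28 * ρ ^ 54) (s := ρ⁻¹) (η := ρ ^ 28) (T := ρ ^ 24 * n) hn hk hbk
    ((one_le_inv₀ hρ).2 hρ1 |>.trans hbinv) (inv_nonneg.2 hρ.le) hbinv hr0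
    (by have := hpow 1 54 (by norm_num); rw [pow_one] at this; linarith)
    (fun m hm => by
      have h3 := hA ρ m hρ (hbinv.trans hm)
      have h4 : 0 < ρ ^ 54 := by positivity
      have h5 : 6 * (1 / 2 : ℝ) ^ m ≤ C₁ * ρ * ρ ^ 54 := by
        rw [hC₁]
        calc 6 * (1 / 2 : ℝ) ^ m ≤ 6 * (A * ρ ^ 55) := by gcongr
          _ = 6 * A * ρ * ρ ^ 54 := by ring
      refine h5.trans (mul_le_mul_of_nonneg_right ?_ h4.le)
      linarith)
    (by positivity) (pow_le_one₀ hρ.le hρ1)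
    (by
      have h3 : (ρ ^ 28) ^ 2 * (6 * ρ⁻¹ * (q / ρ) + 16) = 6 * q * ρ ^ 54 + 16 * ρ ^ 56 := by
        field_simp
      have h4 := hpow 54 56 (by norm_num)
      have h5 : 0 < ρ ^ 54 := by positivity
      rw [h3]
      nlinarith)
    (by positivity)
    ((mean_error_le hρ hn hX1 (hpown 162 (by norm_num)) hq0 hq2 hE1 hB0 (hB ρ hρ)).trans (by
      rw [show C₂ * (ρ ^ 25 * n) = C₂ * ρ * (ρ ^ 24 * n) by ring, div_eq_mul_one_div, mul_comm]
      exact mul_le_mul_of_nonneg_left hρC₂ (by positivity)))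
  refine hmain.trans (mul_le_mul_of_nonneg_left (Real.exp_le_exp.2 (neg_le_neg ?_)) (by norm_num))
  exact exponent_le hρ hρ1 hn hq0 hq2 hK0

end

/-! ### Transfer to the given random variables and conclusion. -/

theorem measureReal_rootCount_eq_pi {ν : Measure ℝ} [IsProbabilityMeasure ν] {n : ℕ} {Ω : Type*}
    [MeasurableSpace Ω] {μ : Measure Ω} [IsProbabilityMeasure μ] {a b : Fin n → Ω → ℝ}
    (ha : ∀ j, HasLaw (a j) ν μ) (hb : ∀ j, HasLaw (b j) ν μ) (hab : iIndepFun (Sum.elim a b) μ)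
    (T : ℝ) :
    μ.real {ω | T ≤ |(rootCount n (fun j => a j ω) (fun j => b j ω) : ℝ) -
      ∫ ω', (rootCount n (fun j => a j ω') (fun j => b j ω') : ℝ) ∂μ|} =
    (Measure.pi fun _ : Fin n ⊕ Fin n => ν).real
      {v | T ≤ |(rootCount n (fun j => v (Sum.inl j)) (fun j => v (Sum.inr j)) : ℝ) -
        ∫ w, (rootCount n (fun j => w (Sum.inl j)) (fun j => w (Sum.inr j)) : ℝ)
          ∂(Measure.pi fun _ : Fin n ⊕ Fin n => ν)|} := by
  have hlaw : ∀ i, HasLaw (Sum.elim a b i) ν μ := by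
    rintro (j | j)
    · exact ha j
    · exact hb j
  have haem : ∀ i, AEMeasurable (Sum.elim a b i) μ := fun i => (hlaw i).aemeasurable
  have hmap : μ.map (fun ω i => Sum.elim a b i ω) = Measure.pi fun _ : Fin n ⊕ Fin n => ν := by
    rw [(iIndepFun_iff_map_fun_eq_pi_map haem).1 hab]
    congr 1
    ext1 i
    exact (hlaw i).map_eq
  have hX : AEMeasurable (fun ω i => Sum.elim a b i ω) μ := aemeasurable_pi_lambda _ haem
  have hN : Measurable fun v : Fin n ⊕ Fin n → ℝ =>
      (rootCount n (fun j => v (Sum.inl j)) (fun j => v (Sum.inr j)) : ℝ) :=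
    measurable_from_top.comp (measurable_rootCount n)
  rw [← hmap, integral_map hX hN.aestronglyMeasurable, measureReal_def, measureReal_def,
    Measure.map_apply_of_aemeasurable hX
      (measurableSet_le measurable_const ((hN.sub_const _).abs))]
  rfl

theorem theorem1p4 (C₀ : ℝ) (hC₀ : 0 < C₀) :
    ∃ c : ℝ, 0 < c ∧ ∃ c' : ℝ, 0 < c' ∧ ∃ n₀ : ℕ,
      ∀ (ν : Measure ℝ) [IsProbabilityMeasure ν],
        MemLp (fun x : ℝ => x) 2 ν →
        ∫ x, x ∂ν = 0 →
        ∫ x, x ^ 2 ∂ν = 1 →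
        ((∀ᵐ x ∂ν, |x| ≤ C₀) ∨ SatisfiesLogSobolev ν C₀) →
        ∀ n : ℕ, n₀ ≤ n →
        ∀ (Ω : Type*) [MeasurableSpace Ω] (μ : Measure Ω) [IsProbabilityMeasure μ]
          (a b : Fin n → Ω → ℝ),
          (∀ j, HasLaw (a j) ν μ) →
          (∀ j, HasLaw (b j) ν μ) →
          iIndepFun (Sum.elim a b) μ →
          ∀ ε : ℝ, (n : ℝ) ^ (-c) ≤ ε →
            μ.real {ω | ε * n ≤
                |(rootCount n (fun j => a j ω) (fun j => b j ω) : ℝ)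
                  - ∫ ω', (rootCount n (fun j => a j ω') (fun j => b j ω') : ℝ) ∂μ|}
              ≤ Real.exp (-c' * ε ^ 9 * n) := by
  obtain ⟨K, hK0, hconc⟩ := exists_convexConcentration hC₀
  obtain ⟨ρ₀, hρ₀, hρ₀1, hmain⟩ := exists_measureReal_rootCount_le hK0
  set c₁ := (256 * K * 315 ^ 2)⁻¹ with hc₁
  have hc₁0 : 0 < c₁ := by positivity
  set ε₀ := ρ₀ ^ 24 with hε₀
  have hε₀0 : 0 < ε₀ := by positivity
  have hε₀1 : ε₀ ≤ 1 := pow_le_one₀ hρ₀.le hρ₀1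
  obtain ⟨n₀, hn₀⟩ : ∃ n₀ : ℕ, ∀ n : ℕ, n₀ ≤ n →
      2 ≤ n ∧ (n : ℝ) ^ (-(1 / 18) : ℝ) ≤ ε₀ ∧ 6 / c₁ ≤ √(n : ℝ) := by
    have h1 : ∀ᶠ n : ℕ in Filter.atTop, (n : ℝ) ^ (-(1 / 18) : ℝ) ≤ ε₀ :=
      ((tendsto_rpow_neg_atTop (by norm_num : (0 : ℝ) < 1 / 18)).comp
        tendsto_natCast_atTop_atTop).eventually_le_const hε₀0
    have h2 : ∀ᶠ n : ℕ in Filter.atTop, 6 / c₁ ≤ √(n : ℝ) :=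
      (Real.tendsto_sqrt_atTop.comp tendsto_natCast_atTop_atTop).eventually_ge_atTop _
    exact Filter.eventually_atTop.1 ((Filter.eventually_ge_atTop 2).and (h1.and h2))
  refine ⟨1 / 18, by norm_num, c₁ * (ε₀ / 3) ^ 9 / 2, by positivity, n₀, ?_⟩
  intro ν _ h2 h0 h1 hν n hn Ω _ μ _ a b ha hb hab ε hε
  obtain ⟨hn2, hnε, hnc⟩ := hn₀ n hn
  have hn' : (0 : ℝ) < n := by exact_mod_cast (by omega : 0 < n)
  have hn2' : (2 : ℝ) ≤ n := by exact_mod_cast hn2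
  have hε0 : 0 < ε := (Real.rpow_pos_of_pos hn' _).trans_le hε
  -- For `ε ≥ 3` the event is empty, as `0 ≤ N ≤ 2n + 1 < 3n` when `n ≥ 2`.
  rcases le_or_gt 3 ε with h3 | h3
  · have hempty : {ω | ε * n ≤ |(rootCount n (fun j => a j ω) (fun j => b j ω) : ℝ) -
        ∫ ω', (rootCount n (fun j => a j ω') (fun j => b j ω') : ℝ) ∂μ|} = ∅ := by
      rw [Set.eq_empty_iff_forall_notMem]
      intro ω hω
      have hω' : ε * n ≤ |(rootCount n (fun j => a j ω) (fun j => b j ω) : ℝ) -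
        ∫ ω', (rootCount n (fun j => a j ω') (fun j => b j ω') : ℝ) ∂μ| := hω
      have hle : ∀ ω', (rootCount n (fun j => a j ω') (fun j => b j ω') : ℝ) ≤ 2 * n + 1 :=
        fun ω' => by exact_mod_cast rootCount_le _ _
      have h4 : 0 ≤ ∫ ω', (rootCount n (fun j => a j ω') (fun j => b j ω') : ℝ) ∂μ :=
        integral_nonneg fun ω' => Nat.cast_nonneg _
      have h5 : ∫ ω', (rootCount n (fun j => a j ω') (fun j => b j ω') : ℝ) ∂μ ≤ 2 * n + 1 := by
        refine (integral_mono_of_nonneg (Filter.Eventually.of_forall fun ω' => Nat.cast_nonneg _)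
          (integrable_const (2 * n + 1 : ℝ)) (Filter.Eventually.of_forall hle)).trans ?_
        simp
      have h6 := hle ω
      have h7 : (0 : ℝ) ≤ rootCount n (fun j => a j ω) (fun j => b j ω) := Nat.cast_nonneg _
      have h8 := abs_le.2 ⟨by linarith, by linarith⟩ |> le_trans hω' (c := 2 * (n : ℝ) + 1)
      nlinarith
    rw [hempty, measureReal_empty]
    exact (Real.exp_pos _).le
  -- The estimate holds only for small deviations; larger `ε` are lowered to `ε₀`. As `ε < 3`, this
  -- loses at most the constant factor `ε₀ / 3`.
  · set δ := min ε ε₀ with hδ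
    have hδ0 : 0 < δ := lt_min hε0 hε₀0
    have hδn : (n : ℝ) ^ (-(1 / 18) : ℝ) ≤ δ := le_min hε hnε
    have hδε : ε₀ / 3 * ε ≤ δ := le_min (by nlinarith) (by nlinarith)
    -- The exponent `c = 1/18` is chosen for this: it is the condition `ρ^432 n ≥ 1`, and it also
    -- gives `√n ≤ δ^9 n`, so that for large `n` half of the exponent absorbs the prefactor `8 ≤
    -- e^3`.
    have h18 : 1 ≤ δ ^ 18 * n := by
      have h4 := pow_le_pow_left₀ (Real.rpow_nonneg hn'.le _) hδn 18
      rw [← Real.rpow_natCast, ← Real.rpow_mul hn'.le] at h4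
      norm_num at h4
      rw [Real.rpow_neg_one] at h4
      rwa [inv_le_iff_one_le_mul₀ hn'] at h4
    set ρ := δ ^ (1 / 24 : ℝ) with hρ
    have hρ0 : 0 < ρ := Real.rpow_pos_of_pos hδ0 _
    have hρ24 : ρ ^ 24 = δ := by
      rw [hρ, ← Real.rpow_natCast, ← Real.rpow_mul hδ0.le]
      norm_num
    have hρρ₀ : ρ ≤ ρ₀ := by
      refine le_of_pow_le_pow_left₀ (n := 24) (by norm_num) hρ₀.le ?_
      rw [hρ24]
      exact min_le_right _ _
    have hmn := hmain ν (hconc ν h2 hν) h2 h0 h1 n ρ hρ0 hρρ₀ (by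
      rwa [show ρ ^ 432 = (ρ ^ 24) ^ 18 by ring, hρ24])
    rw [show ρ ^ 216 = (ρ ^ 24) ^ 9 by ring, hρ24, ← measureReal_rootCount_eq_pi ha hb hab] at hmn
    have hsq : √(n : ℝ) ≤ δ ^ 9 * n := by
      refine (Real.sqrt_le_left (by positivity)).2 ?_
      have : (δ ^ 9 * n) ^ 2 = δ ^ 18 * n * n := by ring
      rw [this]
      nlinarith
    have hlarge : 3 ≤ c₁ * (δ ^ 9 * n) / 2 := by
      have h4 := hnc.trans hsq
      rw [div_le_iff₀ hc₁0] at h4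
      linarith
    have h8 : (8 : ℝ) ≤ Real.exp 3 := by
      have h4 := Real.exp_one_gt_d9
      have h5 : Real.exp 3 = Real.exp 1 ^ 3 := by rw [← Real.exp_nat_mul]; norm_num
      rw [h5]
      calc (8 : ℝ) = 2 ^ 3 := by norm_num
        _ ≤ Real.exp 1 ^ 3 := pow_le_pow_left₀ (by norm_num) (by linarith) 3
    refine (measureReal_mono (μ := μ) fun ω hω => ?_).trans (hmn.trans ?_)
    · exact (mul_le_mul_of_nonneg_right (min_le_left _ _) hn'.le).trans hω
    · calc 8 * Real.exp (-(c₁ * (δ ^ 9 * n)))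
          ≤ Real.exp 3 * Real.exp (-(c₁ * (δ ^ 9 * n))) :=
            mul_le_mul_of_nonneg_right h8 (Real.exp_pos _).le
        _ = Real.exp (3 - c₁ * (δ ^ 9 * n)) := by rw [← Real.exp_add, sub_eq_add_neg]
        _ ≤ Real.exp (-(c₁ * (ε₀ / 3) ^ 9 / 2) * ε ^ 9 * n) := by
            refine Real.exp_le_exp.2 ?_
            have h4 := pow_le_pow_left₀ (by positivity) hδε 9
            have h5 : c₁ * ((ε₀ / 3 * ε) ^ 9 * n) ≤ c₁ * (δ ^ 9 * n) := by gcongr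
            rw [mul_pow] at h5
            linarith
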